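/- **Setting.** Let $U$ be a finite universe and $k$ a bound on the size of the input sets. A set mechanism consists of a randomized algorithm $\mathsf{Encode}$, which maps a set $S\subseteq U$ with $|S|\le k$ to an encoding $\hat S$, and a deterministic algorithm $\mathsf{Decode}$, which maps $\hat S$ and $u\in U$ to a bit. It is $(\varepsilon,\delta)$-DP if for all $S,S'\subseteq U$ of size at most $k$ with $|S\,\triangle\,S'|=1$ and all sets $R$ of encodings, $\Pr[\mathsf{Encode}(S)\in R]\le e^{\varepsilon}\Pr[\mathsf{Encode}(S')\in R]+\delta$. It has error probability (at most) $\alpha$ if for all $S\subseteq U$ with $|S|\le k$ and all $Q\subseteq U$, $\Pr[\forall q\in Q:\ \mathsf{Decode}(\mathsf{Encode}(S),q)\neq \mathbf 1_{q\in S}]\le\alpha^{|Q|}$. Running times are numbers of unit-cost operations (field operations, index computations, comparisons, memory accesses, random draws, hash evaluations per returned symbol); input sets are given as sorted arrays. Write $\log^+x=\max(0,\ln x)$, and $\log$ for the logarithm to base $2$. **The mechanism.** Let $\mathbb F$ be a finite field, and let $m\ge w\ge 1$. $\mathsf{Encode}(S)$ draws independent, uniformly random hash functions $h:U\to\mathbb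 F$, $h_1:U\to\{1,\dots,m-w+1\}$ and $h_2:U\to\mathbb F^{w}$. Let $\mathsf{Row}(u)\in\mathbb F^{1\times m}$ be the row vector that carries $h_2(u)$ in the columns $h_1(u),\dots,h_1(u)+w-1$ and is zero elsewhere. $\mathsf{Encode}(S)$ excludes each element of $S$ independently with probability $1/(|\mathbb F|-1)$, which leaves $S'\subseteq S$. It sorts the equations $\mathsf{Row}(s)\cdot x=h(s)$, $s\in S'$, by $h_1(s)$ and solves them by Gaussian elimination, with independent uniform values for the free variables. It returns $(x,h,h_1,h_2)$ if the rows are linearly independent, and $S$ itself otherwise (it *fails*). $\mathsf{Decode}$ tests whether $\mathsf{Row}(u)\cdot x=h(u)$, or searches $u$ in $S$ (by binary search) if the encoding is $S$. **Theorem.** For every $\beta>0$ there is a constant $C>0$ such that the following holds for all $\varepsilon,\delta>0$ for which there is a finite field $\mathbb F$ with $|\mathbb F|=e^{\varepsilon}+1$ (that is, for which $e^{\varepsilon}+1$ is a prime power), for every such $\mathbb F$, every finite universe $U$, and every integer $k\ge C(1+\log^+(1/\delta))$. With $m=\lfloor(1+\beta)k\rfloor$ there is a band width $w$ with $$1\le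 w\le m,\qquad w\le C\bigl(\log^+(1/\delta)+\ln k\bigr),$$ such that the mechanism above has the following properties for input sets of size at most $k$. 1. It is $(\varepsilon,\delta)$-DP and has error probability $1/(e^{\varepsilon}+1)$. 2. Except with probability at most $\delta$ (for each input set), the encoding consists of a vector of $m\le(1+\beta)k$ elements of $\mathbb F$ and of the three hash functions $h,h_1,h_2$. The vector takes $$m\log|\mathbb F|\le(1+\beta)\,k\,\bigl(\varepsilon\log e+\log(1+e^{-\varepsilon})\bigr)$$ bits (for $\beta=0.05$, $1.05\,k\varepsilon\log e$ bits up to the lower-order term $\log(1+e^{-\varepsilon})\le1$ per element). 3. $\mathsf{Encode}$ takes $O(kw)$ time: for each input set the expected number of steps is at most $C\,k\,w$, and if $k\ge C(1+\log^+(1/\delta))^2$, then the number of steps is at most $C\,k\,w$ except with probability at most $\delta$. 4. $\mathsf{Decode}$ takes at most $C\,w$ steps on every encoding produced by $\mathsf{Encode}$. -/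

import Mathlib

namespace DPSet

/-! ### Step-counted computations

The unit-cost RAM model: a computation returns its value together with the number of elementary
operations it has executed. One elementary operation is: an arithmetic operation or a test in the
field, an index computation or a comparison, reading or writing one memory cell, drawing one random
symbol, or evaluating a hash function (one operation for each field element or index that it
returns). Nothing but `op` and `alloc` ever adds to the counter. -/

structure Timed (α : Type) where
  val : α
  steps : ℕ

instance : Monad Timed where
  pure a := ⟨a, 0⟩
  bind x f := ⟨(f x.val).val, x.steps + (f x.val).steps⟩

/-- One elementary operation with result `a`. -/
def op {α : Type} (a : α) : Timed α := ⟨a, 1⟩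

/-- Initialising `n` memory cells. -/
def alloc (n : ℕ) : Timed Unit := ⟨(), n⟩

/-! ### Set mechanisms

`Ω` is the (finite) space of the random choices of the encoder, with the uniform distribution, and
`O` is the type of the encodings. -/

structure SetMechanism (U Ω O : Type) where
  encode : Finset U → Ω → Timed O
  decode : O → U → Timed Bool

/-- Probability of an event under the uniform distribution on `Ω`. -/
noncomputable def prob {Ω : Type} [Fintype Ω] [Nonempty Ω] (A : Set Ω) : ℝ :=
  ((PMF.uniformOfFintype Ω).toOuterMeasure A).toReal

/-- Expectation under the uniform distribution on `Ω`. -/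
noncomputable def expect {Ω : Type} [Fintype Ω] [Nonempty Ω] (X : Ω → ℝ) : ℝ :=
  ∑ ω, (PMF.uniformOfFintype Ω ω).toReal * X ω

namespace SetMechanism

variable {U Ω O : Type} [DecidableEq U] [Fintype Ω] [Nonempty Ω]

/-- `(ε, δ)`-differential privacy on the sets of at most `k` elements, two sets being neighbouring
if their symmetric difference has one element. -/
def IsDP (M : SetMechanism U Ω O) (k : ℕ) (ε δ : ℝ) : Prop :=
  ∀ S T : Finset U, S.card ≤ k → T.card ≤ k → (symmDiff S T).card = 1 → ∀ R : Set O,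
    prob {ω | (M.encode S ω).val ∈ R} ≤ Real.exp ε * prob {ω | (M.encode T ω).val ∈ R} + δ

/-- Error probability at most `α` on the sets of at most `k` elements: for every set `Q` of queries,
all the answers are wrong simultaneously with probability at most `α ^ |Q|`. -/
def HasError (M : SetMechanism U Ω O) (k : ℕ) (α : ℝ) : Prop :=
  ∀ S : Finset U, S.card ≤ k → ∀ Q : Finset U,
    prob {ω | ∀ u ∈ Q, (M.decode (M.encode S ω).val u).val ≠ decide (u ∈ S)} ≤ α ^ Q.card

end SetMechanism

/-! ### Linear algebra on band matrices -/

section Band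

variable {F : Type} [Field F] [DecidableEq F]

/-- A linear equation whose coefficients are supported in the `w` columns from `start` on. The
coefficients are indexed by the columns themselves. -/
structure Equation (F : Type) where
  start : ℕ
  coeff : ℕ → F
  rhs : F

/-- An array filled at the given indices, and zero elsewhere. -/
def tabulate (f : ℕ → Timed F) : List ℕ → Timed (ℕ → F)
  | [] => pure (fun _ => 0)
  | j :: js => do
    let y ← f j
    let v ← tabulate f js
    op (Function.update v j y)

/-- The sum of `a j * x j` over the given indices. -/
def dot (a x : ℕ → F) : List ℕ → Timed F
  | [] => pure 0
  | j :: js => do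
    let s ← dot a x js
    let aj ← op (a j)
    let xj ← op (x j)
    let y ← op (aj * xj)
    op (s + y)

/-- Subtract the multiple of the pivot equation `p` that cancels column `c` of `e` (`p` has
coefficient `1` there). -/
def cancel (w c : ℕ) (e p : Equation F) : Timed (Equation F) := do
  let a ← op (e.coeff c)
  let v ← tabulate (fun j => do
    let ej ← op (e.coeff j)
    let pj ← op (p.coeff j)
    let y ← op (a * pj)
    op (ej - y)) (List.range' e.start w)
  let y ← op (a * p.rhs)
  let b ← op (e.rhs - y)
  pure ⟨e.start, v, b⟩

/-- Scale `e` so that its coefficient in column `c` becomes `1`. -/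
def normalize (w c : ℕ) (e : Equation F) : Timed (Equation F) := do
  let a ← op (e.coeff c)
  let i ← op a⁻¹
  let v ← tabulate (fun j => do
    let ej ← op (e.coeff j)
    op (i * ej)) (List.range' e.start w)
  let b ← op (i * e.rhs)
  pure ⟨e.start, v, b⟩

/-- Elimination step for one equation. `P c` is the equation with pivot in column `c`, if there is
one so far. The columns in the list are scanned from left to right; the result is `none` if the
left-hand side of the equation is reduced to zero, that is, if it depends linearly on the earlier
ones. -/
def insertEq (w : ℕ) (P : ℕ → Option (Equation F)) :
    List ℕ → Equation F → Timed (Option (ℕ → Option (Equation F)))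
  | [], _ => pure none
  | c :: cs, e => do
    let z ← op (decide (e.coeff c = 0))
    if z then insertEq w P cs e
    else
      let t ← op (P c)
      match t with
      | none => do
        let n ← normalize w c e
        op (some (Function.update P c (some n)))
      | some p => do
        let r ← cancel w c e p
        insertEq w P cs r

/-- Gaussian elimination, equation by equation. -/
def eliminate (w : ℕ) :
    List (Equation F) → (ℕ → Option (Equation F)) → Timed (Option (ℕ → Option (Equation F)))
  | [], P => pure (some P)
  | e :: es, P => do
    let t ← insertEq w P (List.range' e.start w) e
    match t with
    | none => pure none
    | some Q => eliminate w es Q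

/-- Back substitution over the listed columns (from right to left); the variable of a column
without pivot gets the value prescribed by `free`. -/
def backSubst (w : ℕ) (P : ℕ → Option (Equation F)) (free : ℕ → F) :
    List ℕ → (ℕ → F) → Timed (ℕ → F)
  | [], x => pure x
  | c :: cs, x => do
    let t ← op (P c)
    match t with
    | none => do
      let y ← op (free c)
      let z ← op (Function.update x c y)
      backSubst w P free cs z
    | some p => do
      let s ← dot p.coeff x (List.range' (c + 1) (w - 1))
      let y ← op (p.rhs - s)
      let z ← op (Function.update x c y)
      backSubst w P free cs z

/-- Put every equation into the bucket of its starting column. -/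
def distribute : List (Equation F) → Timed (ℕ → List (Equation F))
  | [] => pure (fun _ => [])
  | e :: es => do
    let B ← distribute es
    op (Function.update B e.start (e :: B e.start))

def concat : List (Equation F) → List (Equation F) → Timed (List (Equation F))
  | [], l => op l
  | e :: es, l => do
    let r ← concat es l
    op (e :: r)

/-- Concatenate the listed buckets. -/
def collect (B : ℕ → List (Equation F)) : List ℕ → Timed (List (Equation F))
  | [] => pure []
  | c :: cs => do
    let l ← collect B cs
    concat (B c) l

/-- The array `x` of length `m`, continued by zero. -/
def extend {m : ℕ} (x : Fin m → F) (j : ℕ) : F := if h : j < m then x ⟨j, h⟩ else 0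

/-- Solve a system in `m` variables whose equations are supported in bands of width `w`: sort the
equations by starting column, eliminate, and substitute back with the values `free` for the free
variables. The result is `none` if the rows of the system are linearly dependent. -/
def solveBand (m w : ℕ) (es : List (Equation F)) (free : Fin m → F) :
    Timed (Option (Fin m → F)) := do
  alloc (m - w + 1)
  let B ← distribute es
  let sorted ← collect B (List.range (m - w + 1))
  alloc m
  let t ← eliminate w sorted (fun _ => none)
  match t with
  | none => pure none
  | some P => do
    alloc m
    let x ← backSubst w P (extend free) (List.range m).reverse (fun _ => 0)
    pure (some (fun j => x j))

end Band

/-! ### The random band mechanism -/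

section Mechanism

variable {F U : Type} [Field F] [DecidableEq F] [LinearOrder U]

/-- The row vector of `u`: the band `h₂ u` of `w` field elements placed from column `h₁ u` on, and
zero elsewhere. -/
def rowBand {m w : ℕ} (h₁ : U → Fin (m - w + 1)) (h₂ : U → Fin w → F) (u : U) (j : ℕ) : F :=
  if h : (h₁ u : ℕ) ≤ j ∧ j < (h₁ u : ℕ) + w then h₂ u ⟨j - (h₁ u : ℕ), by omega⟩ else 0

/-- The encodings: a vector of `m` field elements and the three hash functions, or (if the linear
system could not be solved) the input set itself, as an increasing array. -/
inductive Encoding (F U : Type) (m w : ℕ) where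
  | solved (x : Fin m → F) (h : U → F) (h₁ : U → Fin (m - w + 1)) (h₂ : U → Fin w → F)
  | failed (S : List U)

/-- The random choices of the encoder: the hash functions `h`, `h₁`, `h₂`, for every element a
symbol out of `|F| - 1` that decides whether the element is excluded, and the values of the free
variables. All of them are independent and uniform, and read only when they are needed. -/
abbrev Tape (F U : Type) [Field F] (m w : ℕ) : Type :=
  (U → F) × (U → Fin (m - w + 1)) × (U → Fin w → F) × (U → Fˣ) × (Fin m → F)

/-- Keep every element of the list except with probability `1 / (|F| - 1)`, independently. With
`α = 1 / |F|` this exclusion probability is `α / (1 - α)`. -/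
def subsample (coin : U → Fˣ) : List U → Timed (List U)
  | [] => pure []
  | s :: ss => do
    let l ← subsample coin ss
    let z ← op (decide (coin s = 1))
    if z then pure l else op (s :: l)

/-- The equation `Row(u) · x = h(u)` for each of the listed elements `u`. -/
def equations {m w : ℕ} (h : U → F) (h₁ : U → Fin (m - w + 1)) (h₂ : U → Fin w → F) :
    List U → Timed (List (Equation F))
  | [] => pure []
  | u :: us => do
    let es ← equations h h₁ h₂ us
    let s ← op (h₁ u : ℕ)
    let v ← tabulate (fun j => op (rowBand h₁ h₂ u j)) (List.range' s w)
    let b ← op (h u)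
    op (⟨s, v, b⟩ :: es)

/-- The encoder. The input set is presented as an increasing array. -/
def encode (m w : ℕ) (S : Finset U) : Tape F U m w → Timed (Encoding F U m w)
  | (h, h₁, h₂, coin, free) => do
    let kept ← subsample coin (S.sort (· ≤ ·))
    let es ← equations h h₁ h₂ kept
    let t ← solveBand m w es free
    match t with
    | some x => op (Encoding.solved x h h₁ h₂)
    | none => op (Encoding.failed (S.sort (· ≤ ·)))

/-- Binary search for `u` among the positions `lo, …, hi - 1` of an increasing array. The first
number only bounds the depth of the recursion. -/
def search (a : List U) (u : U) : ℕ → ℕ → ℕ → Timed Bool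
  | 0, _, _ => pure false
  | n + 1, lo, hi => do
    let empty ← op (decide (hi ≤ lo))
    if empty then pure false
    else
      let mid ← op ((lo + hi) / 2)
      let t ← op a[mid]?
      match t with
      | none => pure false
      | some v => do
        let eq ← op (decide (v = u))
        if eq then pure true
        else
          let lt ← op (decide (v < u))
          if lt then search a u n (mid + 1) hi else search a u n lo mid

/-- The decoder: test the equation `Row(u) · x = h(u)`. -/
def decode {m w : ℕ} : Encoding F U m w → U → Timed Bool
  | .failed a, u => search a u (a.length + 1) 0 a.length
  | .solved x h h₁ h₂, u => do
    let s ← op (h₁ u : ℕ)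
    let y ← dot (rowBand h₁ h₂ u) (extend x) (List.range' s w)
    let t ← op (h u)
    op (decide (y = t))

/-- The set mechanism with `m` columns and band width `w`. -/
def bandMechanism (F U : Type) [Field F] [DecidableEq F] [LinearOrder U] (m w : ℕ) :
    SetMechanism U (Tape F U m w) (Encoding F U m w) where
  encode := encode m w
  decode := decode

/-- The encodings that consist of `m` field elements and the three hash functions. -/
def Encoding.IsSolved {m w : ℕ} : Encoding F U m w → Prop
  | .solved _ _ _ _ => True
  | .failed _ => False

end Mechanism

end DPSet

/-! Write `q` for `|F|` and `K` for the set of elements that survive the exclusion.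

Privacy and error. Fix the hash functions and the coins. If the rows of `K` are independent, the
output is uniform on the affine solution space, because the pivot columns do not depend on the
values of the free variables. Averaging over `free` thus replaces the algorithm by a density
relative to a uniform `x`: `q ^ |K|` on the solutions, `0` elsewhere (`expect_onSolved`). One more
equation multiplies this density by at most `q`, so one more element, kept with probability `(q - 2)
/ (q - 1)`, raises its average by at most `((q - 2) q + 1) / (q - 1) = q - 1 = exp ε`; exclusion
alone keeps at least a `1 / (q - 1)` share. Failures are paid for by `δ`. For the error, the density
and the event factor over the elements for fixed `x` and rows, and every queried element contributes
exactly `1 / q`.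

Failure. A dependency, cut at the first column that its bands leave uncovered, annihilates `c - a +
w - 1` columns with bands that start in only `c - a` columns. Given the starts, a fixed vector
annihilates `n` columns covered by its bands with probability at most `q ^ (-n)`, so the expected
number of vectors is at most `q ^ (starts - columns)`. Averaging this over `h₁` directly is too
costly for large `q`; by Jensen one may pass to `ρ`-th powers, with `θ = ρ log q` depending on `β`
alone. As the load is below one, the bound becomes `exp (-η (c - a) - θ (w - 1))`
(`expect_prod_rpow_le`), and a union bound finishes.

Running time. Inserting a row costs `O(w)` per column between its start and its pivot. By
rank-nullity the total of these distances is at most the sum over `c` of the dimension of the left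
kernel of the columns up to `c`, the backlog (`sum_pivots_le`). If the rows are independent, a
kernel vector covers a whole interval ending at `c`, so the same moment bound controls `exp (θ *
backlog)` and hence the mean. For the tail, when no vector spans `w` columns, the intervals ending
at the columns of one residue class modulo `w` are disjoint, the moments multiply, and Chernoff's
method applies (`expect_residue_backlog_le`). -/

namespace DPSet

/-! ### Values and costs of step-counted programs -/

section Timed

variable {α γ : Type}

@[simp] theorem Timed.pure_val (a : α) : (pure a : Timed α).val = a := rfl
@[simp] theorem Timed.pure_steps (a : α) : (pure a : Timed α).steps = 0 := rfl
@[simp] theorem Timed.bind_val (x : Timed α) (f : α → Timed γ) :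
    (x >>= f).val = (f x.val).val := rfl
@[simp] theorem Timed.bind_steps (x : Timed α) (f : α → Timed γ) :
    (x >>= f).steps = x.steps + (f x.val).steps := rfl
@[simp] theorem op_val (a : α) : (op a).val = a := rfl
@[simp] theorem op_steps (a : α) : (op a).steps = 1 := rfl
@[simp] theorem alloc_steps (n : ℕ) : (alloc n).steps = n := rfl

end Timed

/-! ### Inserting one equation into the pivot table -/

section Elimination

variable {F : Type} [Field F]

theorem tabulate_val (f : ℕ → Timed F) (l : List ℕ) (j : ℕ) :
    (tabulate f l).val j = if j ∈ l then (f j).val else 0 := by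
  induction l with
  | nil => simp [tabulate]
  | cons i l ih =>
    simp only [tabulate, Timed.bind_val, op_val, Function.update_apply, List.mem_cons, ih]
    by_cases h : j = i
    · subst h; simp
    · simp [h]

theorem tabulate_steps (f : ℕ → Timed F) (s : ℕ) (hf : ∀ j, (f j).steps = s) (l : List ℕ) :
    (tabulate f l).steps = (s + 1) * l.length := by
  induction l with
  | nil => simp [tabulate]
  | cons i l ih => simp [tabulate, ih, hf]; ring

theorem dot_val (a x : ℕ → F) (l : List ℕ) :
    (dot a x l).val = (l.map fun j => a j * x j).sum := by
  induction l with
  | nil => simp [dot]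
  | cons i l ih => simp [dot, ih, add_comm]

theorem dot_steps (a x : ℕ → F) (l : List ℕ) : (dot a x l).steps = 4 * l.length := by
  induction l with
  | nil => simp [dot]
  | cons i l ih => simp [dot, ih]; ring

/-- The coefficients of the equation vanish outside its band of width `w`. -/
def Equation.InBand (w : ℕ) (e : Equation F) : Prop :=
  ∀ j, e.coeff j ≠ 0 → e.start ≤ j ∧ j < e.start + w

/-- The augmented row vector of an equation. -/
def Equation.vec (e : Equation F) : (ℕ → F) × F := (e.coeff, e.rhs)

/-- The augmented row vectors of the pivot equations. -/
def pivotVecs (P : ℕ → Option (Equation F)) : Set ((ℕ → F) × F) :=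
  {v | ∃ c p, P c = some p ∧ v = p.vec}

/-- The pivot equations are normalized, and their bands start at `s` or earlier. -/
def IsPivotTable (w s : ℕ) (P : ℕ → Option (Equation F)) : Prop :=
  ∀ c p, P c = some p →
    p.InBand w ∧ p.coeff c = 1 ∧ (∀ j < c, p.coeff j = 0) ∧ p.start ≤ s

theorem cancel_steps (w c : ℕ) (e p : Equation F) : (cancel w c e p).steps = 5 * w + 3 := by
  simp only [cancel, Timed.bind_steps, op_steps, Timed.pure_steps]
  rw [tabulate_steps _ 4 fun _ => rfl, List.length_range']
  ring

theorem normalize_steps (w c : ℕ) (e : Equation F) : (normalize w c e).steps = 3 * w + 3 := by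
  simp only [normalize, Timed.bind_steps, op_steps, Timed.pure_steps]
  rw [tabulate_steps _ 2 fun _ => rfl, List.length_range']
  ring

theorem Equation.InBand.eq_zero {w : ℕ} {e : Equation F} (h : e.InBand w) {j : ℕ}
    (hj : j ∉ List.range' e.start w) : e.coeff j = 0 := by
  by_contra h0
  have := h j h0
  simp [List.mem_range'_1] at hj
  omega

/-- Only the columns in the band of `e` are recomputed, so this is a genuine row operation only when
the support of `p` lies in that band. -/
theorem cancel_vec {w c : ℕ} {e p : Equation F} (he : e.InBand w)
    (hp : ∀ j, p.coeff j ≠ 0 → e.start ≤ j ∧ j < e.start + w) :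
    (cancel w c e p).val.vec = e.vec - e.coeff c • p.vec := by
  refine Prod.ext ?_ ?_
  · funext j
    simp only [Equation.vec, cancel, Timed.bind_val, op_val, Timed.pure_val, tabulate_val]
    split_ifs with h
    · simp
    · have h1 : e.coeff j = 0 := he.eq_zero h
      have h2 : p.coeff j = 0 := by
        by_contra h0
        have := hp j h0
        simp [List.mem_range'_1] at h
        omega
      simp [h1, h2]
  · simp [Equation.vec, cancel]

theorem normalize_vec {w c : ℕ} {e : Equation F} (he : e.InBand w) :
    (normalize w c e).val.vec = (e.coeff c)⁻¹ • e.vec := by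
  refine Prod.ext ?_ ?_
  · funext j
    simp only [Equation.vec, normalize, Timed.bind_val, op_val, Timed.pure_val, tabulate_val]
    split_ifs with h
    · simp
    · simp [he.eq_zero h]
  · simp [Equation.vec, normalize]

theorem cancel_start (w c : ℕ) (e p : Equation F) : (cancel w c e p).val.start = e.start := rfl

/-- The table `Q` arises from `P` by reducing `e` to a pivot equation in column `c`. -/
structure PivotStep (w : ℕ) (P : ℕ → Option (Equation F)) (e : Equation F)
    (Q : ℕ → Option (Equation F)) (c : ℕ) (n : Equation F) : Prop where
  le : e.start ≤ c
  lt : c < e.start + w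
  free : P c = none
  eq : Q = Function.update P c (some n)
  start : n.start = e.start
  inBand : n.InBand w
  one : n.coeff c = 1
  zero : ∀ j < c, n.coeff j = 0
  comb : ∃ a : F, a ≠ 0 ∧ ∃ v ∈ Submodule.span F (pivotVecs P), n.vec = a • (e.vec - v)

variable [DecidableEq F]

/-- Pivot rows start no later than `e`, and the one used at column `c` vanishes before `c`; its
support therefore lies in the band of `e`, cancelling never leaves that band, and each scanned
column costs `O(w)`. Here `n` is the number of columns still to scan. The finer cost bound in terms
of `c' - c` is the one that telescopes over all insertions. -/
theorem insertEq_spec {w : ℕ} (hw : 1 ≤ w) {P : ℕ → Option (Equation F)} (n : ℕ) :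
    ∀ (c : ℕ) (e : Equation F), c + n = e.start + w → e.start ≤ c → e.InBand w →
      (∀ j < c, e.coeff j = 0) → IsPivotTable w e.start P →
      (insertEq w P (List.range' c n) e).steps ≤ 10 * w * (n + 1) ∧
      ((insertEq w P (List.range' c n) e).val = none →
        ∃ v ∈ Submodule.span F (pivotVecs P), v.1 = e.coeff) ∧
      ∀ Q, (insertEq w P (List.range' c n) e).val = some Q →
        ∃ c' p, PivotStep w P e Q c' p ∧ c ≤ c' ∧
          (insertEq w P (List.range' c n) e).steps ≤ 10 * w * (1 + (c' - c)) := by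
  induction n with
  | zero =>
    intro c e hc hs he hz hP
    refine ⟨by simp [insertEq], fun _ => ⟨0, Submodule.zero_mem _, ?_⟩, by simp [insertEq]⟩
    funext j
    by_contra h
    have h1 := he j (fun h0 => h (by simp [h0]))
    exact h (by simp [hz j (by omega)])
  | succ n ih =>
    intro c e hc hs he hz hP
    rw [List.range'_succ]
    by_cases h0 : e.coeff c = 0
    · have heq : insertEq w P (c :: List.range' (c + 1) n) e =
          ⟨(insertEq w P (List.range' (c + 1) n) e).val,
            1 + (insertEq w P (List.range' (c + 1) n) e).steps⟩ := by
        simp [insertEq, h0]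
        rfl
      have hz' : ∀ j < c + 1, e.coeff j = 0 := by
        intro j hj
        rcases Nat.lt_succ_iff_lt_or_eq.1 hj with h | h
        · exact hz j h
        · rw [h, h0]
      obtain ⟨i1, i2, i3⟩ := ih (c + 1) e (by omega) (by omega) he hz' hP
      rw [heq]
      refine ⟨?_, i2, ?_⟩
      · dsimp only
        nlinarith
      · intro Q hQ
        obtain ⟨c', p, hp, hc', hst⟩ := i3 Q hQ
        refine ⟨c', p, hp, by omega, ?_⟩
        dsimp only
        obtain ⟨d, rfl⟩ := Nat.exists_eq_add_of_le hc'
        have e1 : c + 1 + d - (c + 1) = d := by omega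
        have e2 : c + 1 + d - c = d + 1 := by omega
        rw [e1] at hst
        rw [e2]
        nlinarith
    · cases hPc : P c with
      | none =>
        have heq : insertEq w P (c :: List.range' (c + 1) n) e =
            ⟨some (Function.update P c (some (normalize w c e).val)), 3 * w + 6⟩ := by
          have : (insertEq w P (c :: List.range' (c + 1) n) e).steps = 3 * w + 6 := by
            simp [insertEq, h0, hPc, normalize_steps]
            ring
          rw [← this]
          simp [insertEq, h0, hPc]
          rfl
        rw [heq]
        refine ⟨?_, by simp, ?_⟩
        · dsimp only
          nlinarith
        · intro Q hQ
          have hv := normalize_vec (c := c) he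
          have hco : ∀ j, (normalize w c e).val.coeff j = (e.coeff c)⁻¹ * e.coeff j := fun j =>
            congrFun (congrArg Prod.fst hv) j
          refine ⟨c, (normalize w c e).val, ⟨hs, by omega, hPc, ?_, rfl, ?_, ?_, ?_, ?_⟩, le_rfl, ?_⟩
          · simpa using hQ.symm
          · intro j hj
            rw [hco] at hj
            exact he j (right_ne_zero_of_mul hj)
          · rw [hco, inv_mul_cancel₀ h0]
          · intro j hj
            rw [hco, hz j hj, mul_zero]
          · exact ⟨_, inv_ne_zero h0, 0, Submodule.zero_mem _, by rw [hv, sub_zero]⟩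
          · dsimp only
            nlinarith
      | some p =>
        obtain ⟨p1, p2, p3, p4⟩ := hP c p hPc
        have hpb : ∀ j, p.coeff j ≠ 0 → e.start ≤ j ∧ j < e.start + w := by
          intro j hj
          have := p1 j hj
          have : ¬ j < c := fun h => hj (p3 j h)
          omega
        have heq : insertEq w P (c :: List.range' (c + 1) n) e =
            ⟨(insertEq w P (List.range' (c + 1) n) (cancel w c e p).val).val,
              (5 * w + 5) + (insertEq w P (List.range' (c + 1) n) (cancel w c e p).val).steps⟩ := by
          have : (insertEq w P (c :: List.range' (c + 1) n) e).steps =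
              (5 * w + 5) +
                (insertEq w P (List.range' (c + 1) n) (cancel w c e p).val).steps := by
            simp [insertEq, h0, hPc, cancel_steps]
            ring
          rw [← this]
          simp [insertEq, h0, hPc]
          rfl
        have hv := cancel_vec (c := c) he hpb
        have hco : ∀ j, (cancel w c e p).val.coeff j = e.coeff j - e.coeff c * p.coeff j := fun j =>
          congrFun (congrArg Prod.fst hv) j
        have hpm : p.vec ∈ Submodule.span F (pivotVecs P) := Submodule.subset_span ⟨c, p, hPc, rfl⟩
        have hb' : (cancel w c e p).val.InBand w := by
          intro j hj
          rw [cancel_start]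
          rw [hco] at hj
          by_cases h : e.coeff j = 0
          · exact hpb j (fun h' => hj (by simp [h, h']))
          · exact he j h
        have hz' : ∀ j < c + 1, (cancel w c e p).val.coeff j = 0 := by
          intro j hj
          rw [hco]
          rcases Nat.lt_succ_iff_lt_or_eq.1 hj with h | h
          · simp [hz j h, p3 j h]
          · simp [h, p2]
        obtain ⟨i1, i2, i3⟩ := ih (c + 1) (cancel w c e p).val (by rw [cancel_start]; omega)
          (by rw [cancel_start]; omega) hb' hz' hP
        rw [heq]
        refine ⟨?_, ?_, ?_⟩
        · dsimp only
          nlinarith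
        · intro hn
          obtain ⟨v, hvm, hve⟩ := i2 hn
          refine ⟨v + e.coeff c • p.vec,
            Submodule.add_mem _ hvm (Submodule.smul_mem _ _ hpm), ?_⟩
          funext j
          simp [hve, hco, Equation.vec]
        · intro Q hQ
          obtain ⟨c', r, hr, hc', hst⟩ := i3 Q hQ
          obtain ⟨a, ha, v, hvm, hve⟩ := hr.comb
          refine ⟨c', r, ⟨hr.le, hr.lt, hr.free, hr.eq, hr.start, hr.inBand, hr.one, hr.zero,
            a, ha, v + e.coeff c • p.vec,
            Submodule.add_mem _ hvm (Submodule.smul_mem _ _ hpm), ?_⟩, by omega, ?_⟩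
          · rw [hve, hv]
            congr 1
            abel
          · dsimp only
            obtain ⟨d, rfl⟩ := Nat.exists_eq_add_of_le hc'
            have e1 : c + 1 + d - (c + 1) = d := by omega
            have e2 : c + 1 + d - c = d + 1 := by omega
            rw [e1] at hst
            rw [e2]
            nlinarith

end Elimination

/-! ### Invariants and total cost of the elimination -/

section Eliminate

variable {F : Type} [Field F]

/-- The augmented row vector of the pivot equation of column `c`, or zero. -/
def pivotVec (P : ℕ → Option (Equation F)) (c : ℕ) : (ℕ → F) × F :=
  (P c).elim 0 Equation.vec

theorem pivotVecs_subset_range (P : ℕ → Option (Equation F)) :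
    pivotVecs P ⊆ Set.range (pivotVec P) := by
  rintro v ⟨c, p, hp, rfl⟩
  exact ⟨c, by simp [pivotVec, hp]⟩

theorem IsPivotTable.pivotVec_eq_zero {w s : ℕ} {P : ℕ → Option (Equation F)}
    (hP : IsPivotTable w s P) {c j : ℕ} (h : j < c) : (pivotVec P c).1 j = 0 := by
  cases hc : P c with
  | none => simp [pivotVec, hc]
  | some p => simpa [pivotVec, hc, Equation.vec] using (hP c p hc).2.2.1 j h

/-- Echelon form: if `v` is nonzero at the free column `c`, some pivot row with column below `c`
occurs in it, and at the smallest such pivot column `v` equals the nonzero coefficient of that row.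
-/
theorem IsPivotTable.leading {w s : ℕ} {P : ℕ → Option (Equation F)} (hP : IsPivotTable w s P)
    {v : (ℕ → F) × F} (hv : v ∈ Submodule.span F (pivotVecs P)) {c : ℕ} (hc : P c = none)
    (hz : ∀ j < c, v.1 j = 0) : v.1 c = 0 := by
  have hv' := Submodule.span_mono (pivotVecs_subset_range P) hv
  obtain ⟨f, hf⟩ := Finsupp.mem_span_range_iff_exists_finsupp.1 hv'
  have hval : ∀ j, v.1 j = ∑ i ∈ f.support, f i * (pivotVec P i).1 j := by
    intro j
    rw [← hf, Finsupp.sum, Prod.fst_sum, Finset.sum_apply]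
    rfl
  by_contra hne
  have hex : ∃ i, f i ≠ 0 ∧ P i ≠ none ∧ i < c := by
    rw [hval] at hne
    obtain ⟨i, hi, hi2⟩ := Finset.exists_ne_zero_of_sum_ne_zero hne
    have h1 := left_ne_zero_of_mul hi2
    have h2 := right_ne_zero_of_mul hi2
    have h3 : P i ≠ none := fun h => h2 (by simp [pivotVec, h])
    refine ⟨i, h1, h3, ?_⟩
    rcases lt_trichotomy i c with h | h | h
    · exact h
    · exact absurd hc (h ▸ h3)
    · exact absurd (hP.pivotVec_eq_zero h) h2
  classical
  obtain ⟨h1, h2, h3⟩ := Nat.find_spec hex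
  have hmin := fun j (hj : j < Nat.find hex) => Nat.find_min hex hj
  set i := Nat.find hex
  obtain ⟨p, hp⟩ := Option.ne_none_iff_exists'.1 h2
  have : v.1 i = f i := by
    rw [hval, Finset.sum_eq_single i]
    · have := (hP i p hp).2.1
      simp [pivotVec, hp, Equation.vec, this]
    · intro j _ hj
      rcases lt_or_gt_of_ne hj with h | h
      · have := hmin j h
        by_cases hfj : f j = 0
        · simp [hfj]
        · have hPj : P j = none := by
            by_contra hPj
            exact this ⟨hfj, hPj, h.trans h3⟩
          simp [pivotVec, hPj]
      · simp [hP.pivotVec_eq_zero h]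
    · intro h
      simp [Finsupp.notMem_support_iff.1 h]
  exact h1 (this ▸ hz i h3)

/-- The pivot columns below `m`. -/
def pivots {F : Type} (m : ℕ) (P : ℕ → Option (Equation F)) : Finset ℕ :=
  (Finset.range m).filter fun c => (P c).isSome

theorem mem_pivots {F : Type} {m c : ℕ} {P : ℕ → Option (Equation F)} :
    c ∈ pivots m P ↔ c < m ∧ ∃ p, P c = some p := by
  simp [pivots, Option.isSome_iff_exists]

namespace PivotStep

variable {w c : ℕ} {P Q : ℕ → Option (Equation F)} {e n : Equation F}

theorem pivotVecs_eq (h : PivotStep w P e Q c n) : pivotVecs Q = insert n.vec (pivotVecs P) := by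
  ext v
  simp only [pivotVecs, h.eq, Function.update_apply, Set.mem_ofPred_eq, Set.mem_insert_iff]
  constructor
  · rintro ⟨c', p, hp, rfl⟩
    split_ifs at hp with hc
    · left
      rw [← Option.some.inj hp]
    · exact Or.inr ⟨c', p, hp, rfl⟩
  · rintro (rfl | ⟨c', p, hp, rfl⟩)
    · exact ⟨c, n, by simp⟩
    · refine ⟨c', p, ?_, rfl⟩
      rw [if_neg, hp]
      rintro rfl
      simp [h.free] at hp

theorem span_eq (h : PivotStep w P e Q c n) :
    Submodule.span F (pivotVecs Q) = Submodule.span F (insert e.vec (pivotVecs P)) := by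
  obtain ⟨a, ha, v, hv, hn⟩ := h.comb
  rw [h.pivotVecs_eq]
  have hsub : ∀ x, Submodule.span F (pivotVecs P) ≤ Submodule.span F (insert x (pivotVecs P)) :=
    fun x => Submodule.span_mono (Set.subset_insert _ _)
  have hmem : ∀ x, x ∈ Submodule.span F (insert x (pivotVecs P)) :=
    fun x => Submodule.subset_span (Set.mem_insert _ _)
  apply le_antisymm
  · rw [Submodule.span_le, Set.insert_subset_iff]
    refine ⟨?_, Submodule.subset_span.trans (hsub e.vec)⟩
    rw [hn]
    exact Submodule.smul_mem _ _ (Submodule.sub_mem _ (hmem _) (hsub _ hv))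
  · rw [Submodule.span_le, Set.insert_subset_iff]
    refine ⟨?_, Submodule.subset_span.trans (hsub n.vec)⟩
    have : e.vec = a⁻¹ • n.vec + v := by
      rw [hn, smul_smul, inv_mul_cancel₀ ha, one_smul, sub_add_cancel]
    rw [this]
    exact Submodule.add_mem _ (Submodule.smul_mem _ _ (hmem _)) (hsub _ hv)

theorem isPivotTable {s : ℕ} (h : PivotStep w P e Q c n) (hP : IsPivotTable w s P)
    (hs : s ≤ e.start) : IsPivotTable w e.start Q := by
  intro c' p hp
  rw [h.eq, Function.update_apply] at hp
  split_ifs at hp with hc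
  · obtain rfl := Option.some.inj hp
    subst hc
    exact ⟨h.inBand, h.one, h.zero, h.start.le⟩
  · obtain ⟨h1, h2, h3, h4⟩ := hP c' p hp
    exact ⟨h1, h2, h3, h4.trans hs⟩

theorem pivots_eq {m : ℕ} (h : PivotStep w P e Q c n) (hm : e.start + w ≤ m) :
    pivots m Q = insert c (pivots m P) := by
  have hc := h.lt
  ext c'
  rw [Finset.mem_insert, mem_pivots, mem_pivots, h.eq, Function.update_apply]
  by_cases hcc : c' = c
  · simp [hcc]
    omega
  · simp [hcc]

theorem notMem_pivots {m : ℕ} (h : PivotStep w P e Q c n) : c ∉ pivots m P := by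
  simp [mem_pivots, h.free]

/-- Otherwise the left-hand side of the new pivot row would come from the span of the old table and
lead in a column that was free, against `IsPivotTable.leading`. -/
theorem coeff_notMem {s : ℕ} (h : PivotStep w P e Q c n) (hP : IsPivotTable w s P)
    {v : (ℕ → F) × F} (hv : v ∈ Submodule.span F (pivotVecs P)) : v.1 ≠ e.coeff := by
  intro hve
  obtain ⟨a, ha, u, hu, hn⟩ := h.comb
  have hn1 : n.coeff = (a • (v - u)).1 := by
    have := congrArg Prod.fst hn
    simpa [Equation.vec, ← hve] using this
  have := hP.leading (Submodule.smul_mem _ a (Submodule.sub_mem _ hv hu)) h.free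
    (fun j hj => by rw [← hn1]; exact h.zero j hj)
  rw [← hn1, h.one] at this
  exact one_ne_zero this

end PivotStep

variable [DecidableEq F] {U : Type}

/-- `A` collects the elements already inserted; the invariant is that the table spans the augmented
rows of `A`, whose left-hand sides are independent. Each insertion costs `10 w` times one plus the
distance from start to pivot, so the costs telescope to `∑ pivots - ∑ starts`, stated additively to
avoid truncated subtraction. -/
theorem eliminate_spec {w m : ℕ} (hw : 1 ≤ w) (E : U → Equation F)
    (hE : ∀ u, (E u).InBand w) (hm : ∀ u, (E u).start + w ≤ m) (us : List U) :
    ∀ (A : Set U) (P : ℕ → Option (Equation F)) (s : ℕ), us.Nodup → (∀ u ∈ us, u ∉ A) →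
      us.Pairwise (fun u v => (E u).start ≤ (E v).start) → (∀ u ∈ us, s ≤ (E u).start) →
      IsPivotTable w s P →
      Submodule.span F (pivotVecs P) = Submodule.span F ((fun u => (E u).vec) '' A) →
      LinearIndepOn F (fun u => (E u).coeff) A →
      (eliminate w (us.map E) P).steps ≤ 10 * w * (w + 1) * us.length ∧
      ((eliminate w (us.map E) P).val = none →
        ¬ LinearIndepOn F (fun u => (E u).coeff) (A ∪ {u | u ∈ us})) ∧
      ∀ Q, (eliminate w (us.map E) P).val = some Q →
        LinearIndepOn F (fun u => (E u).coeff) (A ∪ {u | u ∈ us}) ∧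
        Submodule.span F (pivotVecs Q) =
          Submodule.span F ((fun u => (E u).vec) '' (A ∪ {u | u ∈ us})) ∧
        (∃ s', IsPivotTable w s' Q) ∧
        (pivots m Q).card = (pivots m P).card + us.length ∧
        (∀ c, m ≤ c → P c = none → Q c = none) ∧
        (eliminate w (us.map E) P).steps +
            10 * w * (∑ c ∈ pivots m P, c + (us.map fun u => (E u).start).sum) ≤
          10 * w * (us.length + ∑ c ∈ pivots m Q, c) := by
  induction us with
  | nil =>
    intro A P s _ _ _ _ hP hspan hind
    simp only [List.map_nil, eliminate, Timed.pure_steps, Timed.pure_val]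
    refine ⟨by simp, by simp, ?_⟩
    rintro Q hQ
    obtain rfl := Option.some.inj hQ
    simpa [hind, hspan] using ⟨s, hP⟩
  | cons u us ih =>
    intro A P s hnd hA hsort hs hP hspan hind
    obtain ⟨hu, hnd'⟩ := List.nodup_cons.1 hnd
    obtain ⟨hsu, hsort'⟩ := List.pairwise_cons.1 hsort
    have hPe : IsPivotTable w (E u).start P := fun c p hp => by
      obtain ⟨h1, h2, h3, h4⟩ := hP c p hp
      exact ⟨h1, h2, h3, h4.trans (hs u (by simp))⟩
    obtain ⟨i1, i2, i3⟩ := insertEq_spec hw (P := P) w (E u).start (E u) rfl le_rfl (hE u)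
      (fun j hj => by
        by_contra h
        have := (hE u j h).1
        omega) hPe
    have hset : A ∪ {v | v ∈ u :: us} = insert u A ∪ {v | v ∈ us} := by
      ext v
      simp only [Set.mem_union, Set.mem_ofPred_eq, List.mem_cons, Set.mem_insert_iff]
      tauto
    -- Spans are tracked for augmented rows, which determine the solutions, whereas dependence
    -- concerns left-hand sides only; the first projection links the two.
    have hmap : ∀ x : ℕ → F, x ∈ Submodule.span F ((fun u => (E u).coeff) '' A) ↔
        ∃ v ∈ Submodule.span F (pivotVecs P), v.1 = x := by
      intro x
      have : (fun u => (E u).coeff) '' A =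
          LinearMap.fst F (ℕ → F) F '' ((fun u => (E u).vec) '' A) := by
        rw [Set.image_image]
        rfl
      rw [hspan, this, Submodule.span_image, Submodule.mem_map]
      rfl
    have huA : u ∉ A := hA u (by simp)
    have hstep : (eliminate w ((u :: us).map E) P) =
        ⟨match (insertEq w P (List.range' (E u).start w) (E u)).val with
          | none => none
          | some Q => (eliminate w (us.map E) Q).val,
        (insertEq w P (List.range' (E u).start w) (E u)).steps +
          match (insertEq w P (List.range' (E u).start w) (E u)).val with
          | none => 0
          | some Q => (eliminate w (us.map E) Q).steps⟩ := by
      have : ∀ t : Timed (Option (ℕ → Option (Equation F))),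
          (t >>= fun t => match t with
            | none => pure none
            | some Q => eliminate w (us.map E) Q) =
          ⟨match t.val with
          | none => none
          | some Q => (eliminate w (us.map E) Q).val,
          t.steps + match t.val with
          | none => 0
          | some Q => (eliminate w (us.map E) Q).steps⟩ := by
        rintro ⟨_ | Q, n⟩ <;> rfl
      exact this _
    rw [hstep, hset]
    cases hins : (insertEq w P (List.range' (E u).start w) (E u)).val with
    | none =>
      refine ⟨?_, fun _ hcon => ?_, by simp⟩
      · simp only [List.length_cons]
        nlinarith
      · have h1 := hcon.mono (Set.subset_union_left)
        rw [linearIndepOn_insert huA] at h1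
        exact h1.2 ((hmap _).2 (i2 hins))
    | some R =>
      obtain ⟨c, n, hps, -, hst⟩ := i3 R hins
      have hind' : LinearIndepOn F (fun u => (E u).coeff) (insert u A) := by
        rw [linearIndepOn_insert huA]
        refine ⟨hind, fun hmem => ?_⟩
        obtain ⟨v, hv, hve⟩ := (hmap _).1 hmem
        exact hps.coeff_notMem hP hv hve
      have hspan' : Submodule.span F (pivotVecs R) =
          Submodule.span F ((fun u => (E u).vec) '' (insert u A)) := by
        rw [hps.span_eq, Set.image_insert_eq, Submodule.span_insert, Submodule.span_insert, hspan]
      obtain ⟨j1, j2, j3⟩ := ih (insert u A) R (E u).start hnd'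
        (by
          intro v hv hmem
          rcases Set.mem_insert_iff.1 hmem with rfl | h
          · exact hu hv
          · exact hA v (by simp [hv]) h)
        hsort' hsu (hps.isPivotTable hP (hs u (by simp))) hspan' hind'
      refine ⟨?_, j2, ?_⟩
      · simp only [List.length_cons]
        nlinarith
      · intro Q hQ
        obtain ⟨k1, k2, k3, k4, k5, k6⟩ := j3 Q hQ
        rw [hps.pivots_eq (hm u), Finset.card_insert_of_notMem hps.notMem_pivots] at k4
        rw [hps.pivots_eq (hm u), Finset.sum_insert hps.notMem_pivots] at k6
        refine ⟨k1, k2, k3, by rw [k4, List.length_cons]; ring, ?_, ?_⟩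
        · intro c' hc' hPc'
          refine k5 c' hc' ?_
          have := hps.lt
          have := hm u
          rw [hps.eq, Function.update_of_ne (by omega), hPc']
        · simp only [List.length_cons, List.map_cons, List.sum_cons]
          obtain ⟨d, rfl⟩ := Nat.exists_eq_add_of_le hps.le
          have : (E u).start + d - (E u).start = d := by omega
          rw [this] at hst
          nlinarith

end Eliminate

/-! ### Back substitution and correctness of the band solver -/

section Solve

variable {F : Type} [Field F]

theorem sum_map_range' (f : ℕ → F) (a n : ℕ) :
    ((List.range' a n).map f).sum = ∑ j ∈ Finset.Ico a (a + n), f j := by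
  have : Finset.Ico a (a + n) = ⟨List.range' a n, List.nodup_range'⟩ := by
    ext j
    rw [Finset.mem_Ico]
    exact List.mem_range'_1.symm
  rw [this]
  rfl

/-- `x` has the prescribed values in the columns without pivot below `n`, and satisfies the pivot
equations of the other columns below `n`. -/
def Substituted (w : ℕ) (P : ℕ → Option (Equation F)) (free : ℕ → F) (n : ℕ) (x : ℕ → F) : Prop :=
  ∀ c < n, (P c = none → x c = free c) ∧
    ∀ p, P c = some p → x c = p.rhs - ∑ j ∈ Finset.Ico (c + 1) (c + 1 + (w - 1)), p.coeff j * x j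

/-- Columns are filled from right to left, so each step reads only final entries and the system is
triangular. The equivalence turns "the output is `z`" into a condition on `z`, which is what
counting the outputs needs. -/
theorem backSubst_val_eq_iff (w : ℕ) (P : ℕ → Option (Equation F)) (free : ℕ → F) (n : ℕ) :
    ∀ x z : ℕ → F, (backSubst w P free (List.range n).reverse x).val = z ↔
      Substituted w P free n z ∧ ∀ j, n ≤ j → z j = x j := by
  induction n with
  | zero =>
    intro x z
    simp only [List.range_zero, List.reverse_nil, backSubst, Timed.pure_val, Substituted]
    constructor
    · rintro rfl
      simp
    · rintro ⟨-, h⟩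
      funext j
      rw [h j (Nat.zero_le _)]
  | succ n ih =>
    intro x z
    rw [List.range_succ, List.reverse_append, List.reverse_singleton, List.singleton_append]
    have key : ∀ y : F, (backSubst w P free (List.range n).reverse (Function.update x n y)).val = z ↔
        (Substituted w P free n z ∧ z n = y ∧ ∀ j, n + 1 ≤ j → z j = x j) := by
      intro y
      rw [ih]
      refine and_congr_right fun _ => ⟨fun h => ⟨by simpa using h n le_rfl, fun j hj => ?_⟩, ?_⟩
      · rw [h j (by omega), Function.update_of_ne (by omega)]
      · rintro ⟨h1, h2⟩ j hj
        rcases Nat.eq_or_lt_of_le hj with rfl | hj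
        · simpa using h1
        · rw [h2 j hj, Function.update_of_ne (by omega)]
    have hsub : Substituted w P free (n + 1) z ↔ Substituted w P free n z ∧
        (P n = none → z n = free n) ∧ ∀ p, P n = some p →
          z n = p.rhs - ∑ j ∈ Finset.Ico (n + 1) (n + 1 + (w - 1)), p.coeff j * z j := by
      constructor
      · exact fun h => ⟨fun c hc => h c (by omega), h n (by omega)⟩
      · rintro ⟨h1, h2⟩ c hc
        rcases Nat.lt_succ_iff_lt_or_eq.1 hc with h | rfl
        · exact h1 c h
        · exact h2
    cases hP : P n with
    | none =>
      have : (backSubst w P free (n :: (List.range n).reverse) x).val =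
          (backSubst w P free (List.range n).reverse (Function.update x n (free n))).val := by
        simp [backSubst, hP]
      rw [this, key, hsub]
      simp only [hP]
      simp
      tauto
    | some p =>
      have : (backSubst w P free (n :: (List.range n).reverse) x).val =
          (backSubst w P free (List.range n).reverse (Function.update x n
            (p.rhs - ∑ j ∈ Finset.Ico (n + 1) (n + 1 + (w - 1)), p.coeff j * x j))).val := by
        simp [backSubst, hP, dot_val, sum_map_range']
      rw [this, key, hsub]
      simp only [hP]
      simp only [reduceCtorEq, false_imp_iff, true_and, Option.some.injEq, forall_eq']
      rw [and_assoc]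
      refine and_congr_right fun _ => and_congr_left fun h => ?_
      have hsum : ∑ j ∈ Finset.Ico (n + 1) (n + 1 + (w - 1)), p.coeff j * z j =
          ∑ j ∈ Finset.Ico (n + 1) (n + 1 + (w - 1)), p.coeff j * x j :=
        Finset.sum_congr rfl fun j hj => by rw [h j (Finset.mem_Ico.1 hj).1]
      rw [hsum]

theorem backSubst_steps {w : ℕ} (P : ℕ → Option (Equation F)) (free : ℕ → F)
    (l : List ℕ) : ∀ x : ℕ → F, (backSubst w P free l x).steps ≤ (4 * w + 3) * l.length := by
  induction l with
  | nil => simp [backSubst]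
  | cons c l ih =>
    intro x
    cases hP : P c with
    | none =>
      simp only [backSubst, Timed.bind_steps, op_steps, op_val, hP, List.length_cons]
      have := ih (Function.update x c (free c))
      nlinarith
    | some p =>
      simp only [backSubst, Timed.bind_steps, op_steps, op_val, hP, List.length_cons, dot_steps,
        List.length_range']
      have := ih (Function.update x c (p.rhs - (dot p.coeff x (List.range' (c + 1) (w - 1))).val))
      have h2 : 4 * (w - 1) ≤ 4 * w := by omega
      nlinarith

theorem distribute_spec {F : Type} (es : List (Equation F)) :
    (∀ c, (distribute es).val c = es.filter fun e => e.start = c) ∧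
      (distribute es).steps = es.length := by
  induction es with
  | nil => simp [distribute]
  | cons e es ih =>
    refine ⟨fun c => ?_, by simp [distribute, ih.2]⟩
    simp only [distribute, Timed.bind_val, op_val, Function.update_apply, List.filter_cons]
    by_cases h : c = e.start
    · simp [h, ih.1]
    · simp [h, ih.1, Ne.symm h]

theorem concat_spec {F : Type} (a b : List (Equation F)) :
    (concat a b).val = a ++ b ∧ (concat a b).steps = a.length + 1 := by
  induction a with
  | nil => simp [concat]
  | cons e a ih => simp [concat, ih.1, ih.2]

theorem collect_spec {F : Type} (B : ℕ → List (Equation F)) (l : List ℕ) :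
    (collect B l).val = l.flatMap B ∧
      (collect B l).steps = (l.flatMap B).length + l.length := by
  induction l with
  | nil => simp [collect]
  | cons c l ih =>
    refine ⟨by simp [collect, concat_spec, ih.1], ?_⟩
    simp only [collect, Timed.bind_steps, ih.2, concat_spec]
    simp
    ring

theorem extend_of_lt {m : ℕ} (x : Fin m → F) {j : ℕ} (h : j < m) : extend x j = x ⟨j, h⟩ := by
  simp [extend, h]

theorem extend_of_le {m : ℕ} (x : Fin m → F) {j : ℕ} (h : m ≤ j) : extend x j = 0 := by
  simp [extend, Nat.not_lt.2 h]

/-- The defect of `x` as a solution of an augmented equation in `m` variables. -/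
def residual (m : ℕ) (x : ℕ → F) : ((ℕ → F) × F) →ₗ[F] F where
  toFun v := ∑ j ∈ Finset.range m, v.1 j * x j - v.2
  map_add' u v := by simp [add_mul, Finset.sum_add_distrib]; ring
  map_smul' a v := by simp [mul_sub, Finset.mul_sum, mul_assoc]

theorem residual_vec_eq_zero {m : ℕ} {x : ℕ → F} {e : Equation F} :
    residual m x e.vec = 0 ↔ ∑ j ∈ Finset.range m, e.coeff j * x j = e.rhs := by
  simp [residual, Equation.vec, sub_eq_zero]

/-- A pivot row is supported in `[c, c + w)` with leading coefficient `1`, so solving it for `x c`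
is the equation itself. The window may reach beyond `m`, which is harmless because `x` vanishes
there. -/
theorem IsPivotTable.substituted_iff {w s m : ℕ} {P : ℕ → Option (Equation F)}
    (hw : 1 ≤ w) (hP : IsPivotTable w s P) (hm : ∀ c, m ≤ c → P c = none) (free : ℕ → F)
    {x : ℕ → F} (hx : ∀ j, m ≤ j → x j = 0) :
    Substituted w P free m x ↔
      (∀ c < m, P c = none → x c = free c) ∧ ∀ v ∈ pivotVecs P, residual m x v = 0 := by
  have key : ∀ c p, P c = some p → (x c = p.rhs - ∑ j ∈ Finset.Ico (c + 1) (c + 1 + (w - 1)),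
      p.coeff j * x j ↔ residual m x p.vec = 0) := by
    intro c p hp
    obtain ⟨h1, h2, h3, h4⟩ := hP c p hp
    have hcm : c < m := by
      by_contra h
      simp [hm c (not_lt.1 h)] at hp
    have hc := (h1 c (by rw [h2]; exact one_ne_zero)).1
    have : ∑ j ∈ Finset.range m, p.coeff j * x j =
        x c + ∑ j ∈ Finset.Ico (c + 1) (c + 1 + (w - 1)), p.coeff j * x j := by
      have e1 : ∑ j ∈ Finset.Ico c (c + w), p.coeff j * x j =
          x c + ∑ j ∈ Finset.Ico (c + 1) (c + 1 + (w - 1)), p.coeff j * x j := by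
        rw [← Finset.sum_Ioo_add_eq_sum_Ico (by omega : c < c + w), h2, one_mul, add_comm]
        congr 1
        congr 1
        ext j
        simp
        omega
      rw [← e1, ← Finset.sum_subset (s₁ := Finset.range m ∩ Finset.Ico c (c + w))
        (s₂ := Finset.range m) Finset.inter_subset_left,
        ← Finset.sum_subset (s₁ := Finset.range m ∩ Finset.Ico c (c + w))
        (s₂ := Finset.Ico c (c + w)) Finset.inter_subset_right]
      · intro j hj1 hj2
        rw [Finset.mem_inter, not_and_or] at hj2
        rw [hx j (by simpa using hj2.resolve_right (not_not.2 hj1)), mul_zero]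
      · intro j hj1 hj2
        by_cases h0 : p.coeff j = 0
        · rw [h0, zero_mul]
        · exfalso
          have a1 := h1 j h0
          have a2 : ¬ j < c := fun h => h0 (h3 j h)
          apply hj2
          simp only [Finset.mem_inter, Finset.mem_Ico, hj1, true_and]
          omega
    rw [residual_vec_eq_zero, this, eq_sub_iff_add_eq]
  constructor
  · intro h
    refine ⟨fun c hc => (h c hc).1, ?_⟩
    rintro v ⟨c, p, hp, rfl⟩
    rw [← key c p hp]
    refine (h c ?_).2 p hp
    by_contra h
    simp [hm c (not_lt.1 h)] at hp
  · rintro ⟨h1, h2⟩ c hc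
    exact ⟨h1 c hc, fun p hp => (key c p hp).2 (h2 _ ⟨c, p, hp, rfl⟩)⟩

variable {U : Type} {m w : ℕ}

/-- The equation `Row(u) · x = h(u)`. -/
def rowEquation (h : U → F) (h₁ : U → Fin (m - w + 1)) (h₂ : U → Fin w → F) (u : U) :
    Equation F :=
  ⟨h₁ u, rowBand h₁ h₂ u, h u⟩

theorem rowBand_eq_zero (h₁ : U → Fin (m - w + 1)) (h₂ : U → Fin w → F) {u : U} {j : ℕ}
    (hj : ¬ ((h₁ u : ℕ) ≤ j ∧ j < (h₁ u : ℕ) + w)) : rowBand h₁ h₂ u j = 0 := by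
  rw [rowBand, dif_neg hj]

theorem equations_spec (h : U → F) (h₁ : U → Fin (m - w + 1)) (h₂ : U → Fin w → F)
    (us : List U) : (equations h h₁ h₂ us).val = us.map (rowEquation h h₁ h₂) ∧
      (equations h h₁ h₂ us).steps = (2 * w + 3) * us.length := by
  induction us with
  | nil => simp [equations]
  | cons u us ih =>
    constructor
    · simp only [equations, Timed.bind_val, op_val, ih.1, List.map_cons, List.cons.injEq, and_true]
      simp only [rowEquation, Equation.mk.injEq, true_and, and_true]
      funext j
      rw [tabulate_val]
      split_ifs with hj
      · rfl
      · rw [rowBand_eq_zero]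
        simpa [List.mem_range'_1] using hj
    · simp only [equations, Timed.bind_steps, op_steps, op_val, ih.2, List.length_cons]
      rw [tabulate_steps _ 1 fun _ => rfl, List.length_range']
      ring

/-- The list `us` sorted into buckets by `h₁`. -/
def bucketSort (h₁ : U → Fin (m - w + 1)) (us : List U) : List U :=
  (List.range (m - w + 1)).flatMap fun c => us.filter fun u => (h₁ u : ℕ) = c

theorem mem_bucketSort {h₁ : U → Fin (m - w + 1)} {us : List U} {u : U} :
    u ∈ bucketSort h₁ us ↔ u ∈ us := by
  simp only [bucketSort, List.mem_flatMap, List.mem_range, List.mem_filter, decide_eq_true_eq]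
  exact ⟨fun ⟨_, _, h, _⟩ => h, fun h => ⟨_, (h₁ u).2, h, rfl⟩⟩

theorem nodup_bucketSort {h₁ : U → Fin (m - w + 1)} {us : List U} (h : us.Nodup) :
    (bucketSort h₁ us).Nodup := by
  rw [bucketSort, List.nodup_flatMap]
  refine ⟨fun c _ => h.filter _, List.nodup_range.imp fun {a b} hab => ?_⟩
  simp only [Function.onFun, List.disjoint_left]
  intro u hu hv
  simp only [List.mem_filter, decide_eq_true_eq] at hu hv
  exact hab (hu.2.symm.trans hv.2)

theorem pairwise_bucketSort (h₁ : U → Fin (m - w + 1)) (us : List U) :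
    (bucketSort h₁ us).Pairwise fun u v => (h₁ u : ℕ) ≤ h₁ v := by
  rw [bucketSort, List.pairwise_flatMap]
  constructor
  · intro c _
    rw [List.pairwise_iff_forall_sublist]
    intro u v huv
    have hu := huv.subset (a := u) (by simp)
    have hv := huv.subset (a := v) (by simp)
    simp only [List.mem_filter, decide_eq_true_eq] at hu hv
    omega
  · refine List.pairwise_lt_range.imp fun {a b} hab u hu v hv => ?_
    simp only [List.mem_filter, decide_eq_true_eq] at hu hv
    omega

theorem length_bucketSort {h₁ : U → Fin (m - w + 1)} {us : List U} (h : us.Nodup) :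
    (bucketSort h₁ us).length = us.length :=
  ((List.perm_ext_iff_of_nodup (nodup_bucketSort h) h).2 fun _ => mem_bucketSort).length_eq

theorem collect_distribute (h : U → F) (h₁ : U → Fin (m - w + 1)) (h₂ : U → Fin w → F)
    (us : List U) :
    (collect (distribute (us.map (rowEquation h h₁ h₂))).val (List.range (m - w + 1))).val =
      (bucketSort h₁ us).map (rowEquation h h₁ h₂) := by
  rw [(collect_spec _ _).1, bucketSort, List.map_flatMap]
  congr 1
  funext c
  rw [(distribute_spec _).1, List.filter_map]
  rfl

variable [DecidableEq F]

/-- What the solver does on the equations of the elements of `us`: in terms of the pivot table that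
the elimination ends with. -/
theorem solveBand_spec (hw : 1 ≤ w) (hwm : w ≤ m) (h : U → F) (h₁ : U → Fin (m - w + 1))
    (h₂ : U → Fin w → F) {us : List U} (hus : us.Nodup) :
    (∀ free : Fin m → F, (solveBand m w (us.map (rowEquation h h₁ h₂)) free).steps ≤
      10 * w * (w + 1) * (us.length + m) + 2 * us.length + 15 * w * m) ∧
    (¬ LinearIndepOn F (rowBand h₁ h₂) {u | u ∈ us} →
      ∀ free : Fin m → F, (solveBand m w (us.map (rowEquation h h₁ h₂)) free).val = none) ∧
    (LinearIndepOn F (rowBand h₁ h₂) {u | u ∈ us} →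
      ∃ P : ℕ → Option (Equation F), (∃ s, IsPivotTable w s P) ∧
        (pivots m P).card = us.length ∧
        (∀ u ∈ us, (rowEquation h h₁ h₂ u).vec ∈ Submodule.span F (pivotVecs P)) ∧
        (∀ c, m ≤ c → P c = none) ∧
        ∀ free : Fin m → F,
          (solveBand m w (us.map (rowEquation h h₁ h₂)) free).steps +
              10 * w * (us.map fun u => (h₁ u : ℕ)).sum ≤
            10 * w * (us.length + ∑ c ∈ pivots m P, c) + 2 * us.length + 15 * w * m ∧
          ∃ y, (solveBand m w (us.map (rowEquation h h₁ h₂)) free).val = some y ∧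
            ∀ x, y = x ↔ (∀ c : Fin m, (c : ℕ) ∉ pivots m P → x c = free c) ∧
              ∀ u ∈ us, ∑ j : Fin m, rowBand h₁ h₂ u j * x j = h u) := by
  set E := rowEquation h h₁ h₂ with hEdef
  have hset : ({u | u ∈ bucketSort h₁ us} : Set U) = {u | u ∈ us} := by
    ext u
    exact mem_bucketSort
  have hE : ∀ u, (E u).InBand w := fun u j hj => by
    by_contra hcon
    exact hj (rowBand_eq_zero h₁ h₂ hcon)
  have hm : ∀ u, (E u).start + w ≤ m := fun u => by
    have := (h₁ u).2
    change (h₁ u : ℕ) + w ≤ m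
    omega
  obtain ⟨s1, s2, s3⟩ := eliminate_spec hw E hE hm (bucketSort h₁ us) ∅ (fun _ => none) 0
    (nodup_bucketSort hus) (by simp) (pairwise_bucketSort h₁ us) (by simp)
    (by intro c p hp; simp at hp) (by simp [pivotVecs]) (by simp)
  rw [Set.empty_union, hset] at s2 s3
  rw [length_bucketSort hus] at s1
  have hsolve : ∀ free : Fin m → F, solveBand m w (us.map E) free =
      ⟨match (eliminate w ((bucketSort h₁ us).map E) fun _ => none).val with
        | none => none
        | some P => some fun j => (backSubst w P (extend free) (List.range m).reverse 0).val j,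
      (m - w + 1) + us.length + (us.length + (m - w + 1)) + m +
        (eliminate w ((bucketSort h₁ us).map E) fun _ => none).steps +
        match (eliminate w ((bucketSort h₁ us).map E) fun _ => none).val with
        | none => 0
        | some P => m + (backSubst w P (extend free) (List.range m).reverse 0).steps⟩ := by
    intro free
    have hcs : (collect (distribute (us.map E)).val (List.range (m - w + 1))).steps =
        us.length + (m - w + 1) := by
      rw [(collect_spec _ _).2, ← (collect_spec _ _).1, collect_distribute, List.length_map,
        length_bucketSort hus, List.length_range]
    have h1 : (solveBand m w (us.map E) free).steps = (m - w + 1) + (us.length +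
        (us.length + (m - w + 1) + (m + ((eliminate w ((bucketSort h₁ us).map E) fun _ => none).steps +
        match (eliminate w ((bucketSort h₁ us).map E) fun _ => none).val with
        | none => 0
        | some P => m + (backSubst w P (extend free) (List.range m).reverse 0).steps)))) := by
      simp only [solveBand, Timed.bind_steps, alloc_steps, (distribute_spec _).2,
        collect_distribute, List.length_map, hEdef]
      congr 5
      cases (eliminate w ((bucketSort h₁ us).map (rowEquation h h₁ h₂)) fun _ => none).val <;> rfl
    have h2 : (solveBand m w (us.map E) free).val =
        match (eliminate w ((bucketSort h₁ us).map E) fun _ => none).val with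
        | none => none
        | some P => some fun j => (backSubst w P (extend free) (List.range m).reverse 0).val j := by
      simp only [solveBand, Timed.bind_val, collect_distribute, hEdef]
      cases (eliminate w ((bucketSort h₁ us).map (rowEquation h h₁ h₂)) fun _ => none).val <;> rfl
    have : ∀ t : Timed (Option (Fin m → F)), t = ⟨t.val, t.steps⟩ := fun _ => rfl
    rw [this (solveBand m w (us.map E) free), h1, h2]
    congr 1
    ring
  have hback : ∀ (P : ℕ → Option (Equation F)) (free : Fin m → F),
      (m - w + 1) + us.length + (us.length + (m - w + 1)) + m +
        (m + (backSubst w P (extend free) (List.range m).reverse 0).steps) ≤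
      2 * us.length + 15 * w * m := by
    -- This covers allocations, bucket sort and back substitution, that is, everything except the
    -- elimination.
    intro P free
    have := backSubst_steps (w := w) P (extend free) (List.range m).reverse 0
    rw [List.length_reverse, List.length_range] at this
    have : m ≤ w * m := by nlinarith
    have : m - w + 1 ≤ m := by omega
    nlinarith
  refine ⟨fun free => ?_, fun hdep free => ?_, fun hind => ?_⟩
  · rw [hsolve]
    have h0 : 10 * w * (w + 1) * us.length ≤ 10 * w * (w + 1) * (us.length + m) := by
      gcongr
      omega
    dsimp only
    cases (eliminate w ((bucketSort h₁ us).map E) fun _ => none).val with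
    | none =>
      have := hback (fun _ => none) free
      dsimp only
      omega
    | some P =>
      have := hback P free
      dsimp only
      linarith
  · rw [hsolve]
    cases hv : (eliminate w ((bucketSort h₁ us).map E) fun _ => none).val with
    | none => rfl
    | some P => exact absurd (s3 P hv).1 hdep
  · cases hv : (eliminate w ((bucketSort h₁ us).map E) fun _ => none).val with
    | none => exact absurd hind (s2 hv)
    | some P =>
      obtain ⟨-, t2, ⟨s, t3⟩, t4, t5, t6⟩ := s3 P hv
      have hP0 : pivots m (fun _ => none : ℕ → Option (Equation F)) = ∅ := by
        ext c
        simp [mem_pivots]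
      rw [hP0, Finset.card_empty, length_bucketSort hus, zero_add] at t4
      rw [hP0, Finset.sum_empty, length_bucketSort hus, zero_add] at t6
      have hmem : ∀ u ∈ us, (E u).vec ∈ Submodule.span F (pivotVecs P) := fun u hu => by
        rw [t2]
        exact Submodule.subset_span ⟨u, hu, rfl⟩
      have hPm : ∀ c, m ≤ c → P c = none := fun c hc => t5 c hc rfl
      have hperm : ((bucketSort h₁ us).map fun u => (E u).start).sum =
          (us.map fun u => (h₁ u : ℕ)).sum :=
        (((List.perm_ext_iff_of_nodup (nodup_bucketSort hus) hus).2
          fun _ => mem_bucketSort).map _).sum_eq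
      rw [hperm] at t6
      refine ⟨P, ⟨s, t3⟩, t4, hmem, hPm, fun free => ⟨?_, ?_⟩⟩
      · rw [hsolve]
        have := hback P free
        dsimp only
        rw [hv]
        dsimp only
        linarith
      · rw [hsolve, hv]
        refine ⟨_, rfl, fun x => ?_⟩
        have hext : ((fun j : Fin m => (backSubst w P (extend free) (List.range m).reverse 0).val j) =
            x) ↔ (backSubst w P (extend free) (List.range m).reverse 0).val = extend x := by
          have hz := ((backSubst_val_eq_iff w P (extend free) m 0 _).1 rfl).2
          constructor
          · intro hx
            funext j
            by_cases hj : j < m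
            · rw [extend_of_lt x hj, ← hx]
            · rw [extend_of_le x (not_lt.1 hj), hz j (not_lt.1 hj)]
              rfl
          · intro hx
            funext j
            rw [hx, extend_of_lt x j.2]
        have hx0 : ∀ j, m ≤ j → extend x j = (0 : ℕ → F) j := fun j hj => extend_of_le x hj
        rw [hext, backSubst_val_eq_iff, and_iff_left hx0,
          t3.substituted_iff hw hPm (extend free) fun j hj => extend_of_le x hj]
        refine and_congr ?_ ?_
        · constructor
          · intro hx c hc
            have := hx c c.2 (by
              by_contra hne
              exact hc (mem_pivots.2 ⟨c.2, Option.ne_none_iff_exists'.1 hne⟩))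
            rwa [extend_of_lt x c.2, extend_of_lt free c.2] at this
          · intro hx c hc hPc
            rw [extend_of_lt x hc, extend_of_lt free hc]
            exact hx ⟨c, hc⟩ (by simp [mem_pivots, hPc])
        -- A vanishing residual is a linear condition on the augmented row, so the pivot rows and
        -- the original rows, having the same span, have the same solutions.
        · have hker : (∀ v ∈ pivotVecs P, residual m (extend x) v = 0) ↔
              ∀ v ∈ (fun u => (E u).vec) '' {u | u ∈ us}, residual m (extend x) v = 0 := by
            have hk : ∀ A : Set ((ℕ → F) × F), (∀ v ∈ A, residual m (extend x) v = 0) ↔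
                Submodule.span F A ≤ LinearMap.ker (residual m (extend x)) := by
              intro A
              rw [Submodule.span_le]
              rfl
            rw [hk, hk, t2]
          rw [hker, Set.forall_mem_image]
          refine forall₂_congr fun u _ => ?_
          rw [residual_vec_eq_zero, ← Fin.sum_univ_eq_sum_range
            (fun j => (E u).coeff j * extend x j) m]
          simp only [extend_of_lt x (Fin.is_lt _)]
          rfl

end Solve

/-! ### Pivot displacement bounded by left kernels -/

section Kernel

variable {F U : Type} [Field F] [Fintype U]

/-- The left kernel of the submatrix that consists of the columns up to `c` and the rows of the
elements of `S` that start there. -/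
def truncKer (S : Finset U) (st : U → ℕ) (row : U → ℕ → F) (c : ℕ) : Submodule F (U → F) where
  carrier := {y | (∀ u, y u ≠ 0 → u ∈ S ∧ st u ≤ c) ∧ ∀ j ≤ c, ∑ u, y u * row u j = 0}
  zero_mem' := by simp
  add_mem' := by
    rintro x y ⟨hx1, hx2⟩ ⟨hy1, hy2⟩
    refine ⟨fun u hu => ?_, fun j hj => ?_⟩
    · by_cases h : x u = 0
      · exact hy1 u fun h' => hu (by simp [h, h'])
      · exact hx1 u h
    · simp [add_mul, Finset.sum_add_distrib, hx2 j hj, hy2 j hj]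
  smul_mem' := by
    rintro a y ⟨hy1, hy2⟩
    refine ⟨fun u hu => hy1 u (right_ne_zero_of_mul hu), fun j hj => ?_⟩
    simp [mul_assoc, ← Finset.mul_sum, hy2 j hj]

theorem mem_truncKer {S : Finset U} {st : U → ℕ} {row : U → ℕ → F} {c : ℕ} {y : U → F} :
    y ∈ truncKer S st row c ↔
      (∀ u, y u ≠ 0 → u ∈ S ∧ st u ≤ c) ∧ ∀ j ≤ c, ∑ u, y u * row u j = 0 := Iff.rfl

theorem truncKer_mono {S T : Finset U} (h : S ⊆ T) (st : U → ℕ) (row : U → ℕ → F) (c : ℕ) :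
    truncKer S st row c ≤ truncKer T st row c :=
  fun _ hy => ⟨fun u hu => ⟨h (hy.1 u hu).1, (hy.1 u hu).2⟩, hy.2⟩

/-- Rank-nullity for the rows started by `c`, truncated to the columns up to `c`. The truncated rows
lie in the span of the truncated pivot rows, and a pivot row with column beyond `c` truncates to
zero, so the rank is at most the number of pivots up to `c`. -/
theorem card_starts_le {w s m : ℕ} {P : ℕ → Option (Equation F)} (hP : IsPivotTable w s P)
    (hm : ∀ c, m ≤ c → P c = none) (K : Finset U) (st : U → ℕ) (row : U → ℕ → F)
    (hrow : ∀ u ∈ K, ∃ v ∈ Submodule.span F (pivotVecs P), v.1 = row u) (c : ℕ) :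
    (K.filter fun u => st u ≤ c).card ≤
      ((pivots m P).filter fun p => p ≤ c).card + Module.finrank F (truncKer K st row c) := by
  classical
  set A := K.filter fun u => st u ≤ c with hA
  let tr : ((ℕ → F) × F) →ₗ[F] (Fin (c + 1) → F) :=
    LinearMap.funLeft F F (fun j : Fin (c + 1) => (j : ℕ)) ∘ₗ LinearMap.fst F (ℕ → F) F
  let L : (A → F) →ₗ[F] (Fin (c + 1) → F) :=
    Fintype.linearCombination F fun (a : A) (j : Fin (c + 1)) => row a j
  have hL : ∀ y j, L y j = ∑ a : A, y a * row a j := by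
    intro y j
    simp [L, Fintype.linearCombination_apply, Finset.sum_apply]
  have hrange : Module.finrank F (LinearMap.range L) ≤
      ((pivots m P).filter fun p => p ≤ c).card := by
    have hle : LinearMap.range L ≤ Submodule.span F
        (((((pivots m P).filter fun p => p ≤ c).image fun p => tr (pivotVec P p)) :
          Finset (Fin (c + 1) → F)) : Set (Fin (c + 1) → F)) := by
      rw [Fintype.range_linearCombination, Submodule.span_le]
      rintro _ ⟨a, rfl⟩
      obtain ⟨v, hv, hva⟩ := hrow a (Finset.mem_filter.1 a.2).1
      have htr : (fun j : Fin (c + 1) => row a j) = tr v := by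
        funext j
        simp [tr, LinearMap.funLeft_apply, hva]
      have h1 : tr v ∈ (Submodule.span F (pivotVecs P)).map tr := Submodule.mem_map_of_mem hv
      rw [Submodule.map_span] at h1
      change (fun j : Fin (c + 1) => row a j) ∈ Submodule.span F _
      rw [htr]
      revert h1
      refine fun h1 => Submodule.span_le.2 ?_ h1
      rintro _ ⟨_, ⟨p, e, hp, rfl⟩, rfl⟩
      have hvec : pivotVec P p = e.vec := by simp [pivotVec, hp]
      by_cases hpc : p ≤ c
      · refine Submodule.subset_span ?_
        rw [Finset.mem_coe, Finset.mem_image]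
        refine ⟨p, Finset.mem_filter.2 ⟨mem_pivots.2 ⟨?_, e, hp⟩, hpc⟩, by rw [hvec]⟩
        by_contra h
        simp [hm p (not_lt.1 h)] at hp
      · have : tr e.vec = 0 := by
          funext j
          rw [← hvec]
          have := j.2
          exact hP.pivotVec_eq_zero (show (j : ℕ) < p by omega)
        rw [this]
        exact Submodule.zero_mem _
    exact (Submodule.finrank_mono hle).trans
      ((finrank_span_finset_le_card _).trans Finset.card_image_le)
  have hker : Module.finrank F (LinearMap.ker L) ≤ Module.finrank F (truncKer K st row c) := by
    let ext : (A → F) →ₗ[F] (U → F) := Function.ExtendByZero.linearMap F ((↑) : A → U)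
    have hext1 : ∀ (y : A → F) (a : A), ext y a = y a := fun y a =>
      Subtype.val_injective.extend_apply y 0 a
    have hext2 : ∀ (y : A → F) (u : U), u ∉ A → ext y u = 0 := fun y u hu =>
      Function.extend_apply' (f := ((↑) : A → U)) y 0 u (by rintro ⟨a, rfl⟩; exact hu a.2)
    have hinj : Function.Injective ext := fun x y hxy => by
      funext a
      rw [← hext1 x, ← hext1 y, hxy]
    rw [(Submodule.equivMapOfInjective ext hinj (LinearMap.ker L)).finrank_eq]
    refine Submodule.finrank_mono ?_
    rintro _ ⟨y, hy, rfl⟩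
    refine ⟨fun u hu => ?_, fun j hj => ?_⟩
    · have : u ∈ A := by
        by_contra h
        exact hu (hext2 y u h)
      exact Finset.mem_filter.1 this
    · have h1 := hL y ⟨j, by omega⟩
      rw [LinearMap.mem_ker.1 hy] at h1
      rw [← Finset.sum_subset (Finset.subset_univ A) fun u _ hu => by rw [hext2 y u hu, zero_mul],
        ← Finset.sum_coe_sort]
      simp only [hext1]
      exact h1.symm
  have := LinearMap.finrank_range_add_finrank_ker L
  rw [Module.finrank_pi, Fintype.card_coe] at this
  omega

/-- Sum `card_starts_le` over `c < m`. Counting pairs gives `∑ c, #{i | f i ≤ c} = |A| m - ∑ f`, and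
the terms `|A| m` cancel because there are as many pivots as rows. -/
theorem sum_pivots_le {w s m : ℕ} {P : ℕ → Option (Equation F)} (hP : IsPivotTable w s P)
    (hm : ∀ c, m ≤ c → P c = none) (K : Finset U) (st : U → ℕ) (hst : ∀ u, st u ≤ m)
    (row : U → ℕ → F) (hrow : ∀ u ∈ K, ∃ v ∈ Submodule.span F (pivotVecs P), v.1 = row u)
    (hcard : (pivots m P).card = K.card) :
    ∑ c ∈ pivots m P, c ≤
      ∑ u ∈ K, st u + ∑ c ∈ Finset.range m, Module.finrank F (truncKer K st row c) := by
  have hdouble : ∀ {ι : Type} (A : Finset ι) (f : ι → ℕ), (∀ i ∈ A, f i ≤ m) →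
      ∑ c ∈ Finset.range m, (A.filter fun i => f i ≤ c).card + ∑ i ∈ A, f i = A.card * m := by
    intro ι A f hf
    simp only [Finset.card_filter]
    rw [Finset.sum_comm, ← Finset.sum_add_distrib, ← smul_eq_mul, ← Finset.sum_const]
    refine Finset.sum_congr rfl fun i hi => ?_
    rw [← Finset.card_filter]
    have : (Finset.range m).filter (fun c => f i ≤ c) = Finset.Ico (f i) m := by
      ext c
      simp
      omega
    rw [this, Nat.card_Ico]
    have := hf i hi
    omega
  have h1 := hdouble K st fun u _ => hst u
  have h2 := hdouble (pivots m P) id fun c hc => (mem_pivots.1 hc).1.le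
  have h3 := Finset.sum_le_sum fun c (_ : c ∈ Finset.range m) =>
    card_starts_le hP hm K st row hrow c
  rw [Finset.sum_add_distrib] at h3
  rw [hcard] at h2
  simp only [id] at h2
  omega

end Kernel

/-! ### Output and cost of the encoder -/

section Encode

variable {F U : Type} [Field F] {m w : ℕ}

/-- The rows of the elements of `K` are linearly independent. -/
def IndepRows (h₁ : U → Fin (m - w + 1)) (h₂ : U → Fin w → F) (K : Finset U) : Prop :=
  LinearIndepOn F (rowBand h₁ h₂) (K : Set U)

theorem IndepRows.mono {h₁ : U → Fin (m - w + 1)} {h₂ : U → Fin w → F} {K T : Finset U}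
    (h : IndepRows h₁ h₂ T) (hKT : K ⊆ T) : IndepRows h₁ h₂ K :=
  LinearIndepOn.mono h (Finset.coe_subset.2 hKT)

variable [DecidableEq F]

/-- The elements of `S` that are not excluded. -/
def kept (coin : U → Fˣ) (S : Finset U) : Finset U := S.filter fun u => coin u ≠ 1

theorem subsample_spec (coin : U → Fˣ) (l : List U) :
    (subsample coin l).val = l.filter (fun u => coin u ≠ 1) ∧
      (subsample coin l).steps ≤ 2 * l.length := by
  induction l with
  | nil => simp [subsample]
  | cons u l ih =>
    by_cases h : coin u = 1
    · refine ⟨by simp [subsample, h, ih.1], ?_⟩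
      simp [subsample, h]
      omega
    · refine ⟨by simp [subsample, h, ih.1], ?_⟩
      simp [subsample, h]
      omega

variable [LinearOrder U]

theorem nodup_subsample (coin : U → Fˣ) (S : Finset U) :
    (subsample coin (S.sort (· ≤ ·))).val.Nodup := by
  rw [(subsample_spec coin _).1]
  exact (S.sort_nodup _).filter _

theorem toFinset_subsample (coin : U → Fˣ) (S : Finset U) :
    (subsample coin (S.sort (· ≤ ·))).val.toFinset = kept coin S := by
  rw [(subsample_spec coin _).1]
  ext u
  simp [kept]

theorem length_subsample (coin : U → Fˣ) (S : Finset U) :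
    (subsample coin (S.sort (· ≤ ·))).val.length = (kept coin S).card := by
  rw [← toFinset_subsample, List.toFinset_card_of_nodup (nodup_subsample coin S)]

theorem coe_kept (coin : U → Fˣ) (S : Finset U) :
    ({u | u ∈ (subsample coin (S.sort (· ≤ ·))).val} : Set U) = (kept coin S : Set U) := by
  rw [← toFinset_subsample, List.coe_toFinset]

theorem encode_eq (h : U → F) (h₁ : U → Fin (m - w + 1)) (h₂ : U → Fin w → F) (coin : U → Fˣ)
    (free : Fin m → F) (S : Finset U) :
    (encode m w S (h, h₁, h₂, coin, free)).val =
      ((solveBand m w ((subsample coin (S.sort (· ≤ ·))).val.map (rowEquation h h₁ h₂))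
        free).val.elim (Encoding.failed (S.sort (· ≤ ·)))
        fun x => Encoding.solved x h h₁ h₂) ∧
    (encode m w S (h, h₁, h₂, coin, free)).steps ≤
      2 * S.card + (2 * w + 3) * S.card +
      (solveBand m w ((subsample coin (S.sort (· ≤ ·))).val.map (rowEquation h h₁ h₂))
        free).steps + 1 := by
  have h1 : (encode m w S (h, h₁, h₂, coin, free)).val =
      ((solveBand m w (equations h h₁ h₂ (subsample coin (S.sort (· ≤ ·))).val).val
        free).val.elim (Encoding.failed (S.sort (· ≤ ·)))
        fun x => Encoding.solved x h h₁ h₂) := by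
    simp only [encode, Timed.bind_val]
    cases (solveBand m w (equations h h₁ h₂ (subsample coin (S.sort (· ≤ ·))).val).val
        free).val <;> rfl
  have h2 : (encode m w S (h, h₁, h₂, coin, free)).steps =
      (subsample coin (S.sort (· ≤ ·))).steps +
      ((equations h h₁ h₂ (subsample coin (S.sort (· ≤ ·))).val).steps +
      ((solveBand m w (equations h h₁ h₂ (subsample coin (S.sort (· ≤ ·))).val).val
        free).steps + 1)) := by
    simp only [encode, Timed.bind_steps]
    cases (solveBand m w (equations h h₁ h₂ (subsample coin (S.sort (· ≤ ·))).val).val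
        free).val <;> rfl
  rw [(equations_spec h h₁ h₂ _).1] at h1 h2
  refine ⟨h1, ?_⟩
  rw [h2, (equations_spec h h₁ h₂ _).2, length_subsample]
  have h3 := (subsample_spec coin (S.sort (· ≤ ·))).2
  rw [Finset.length_sort] at h3
  have h4 : (2 * w + 3) * (kept coin S).card ≤ (2 * w + 3) * S.card := by
    gcongr
    exact Finset.filter_subset _ _
  omega

/-- Crude worst case, used when the rows are dependent; the small probability of that event absorbs
the extra factor `w`. -/
theorem encode_steps_le (hw : 1 ≤ w) (hwm : w ≤ m) (S : Finset U) (ω : Tape F U m w) :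
    (encode m w S ω).steps ≤ 40 * w ^ 2 * (S.card + m) := by
  obtain ⟨h, h₁, h₂, coin, free⟩ := ω
  have h1 := (encode_eq h h₁ h₂ coin free S).2
  have h2 := (solveBand_spec hw hwm h h₁ h₂ (nodup_subsample coin S)).1 free
  rw [length_subsample] at h2
  have h3 : (kept coin S).card ≤ S.card := Finset.card_le_card (Finset.filter_subset _ _)
  have h4 : 10 * w * (w + 1) * ((kept coin S).card + m) ≤ 20 * w ^ 2 * (S.card + m) := by
    refine Nat.mul_le_mul ?_ (by omega)
    nlinarith
  have h5 : w ≤ w ^ 2 := by nlinarith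
  have h6 : w * S.card ≤ w ^ 2 * S.card := Nat.mul_le_mul_right _ h5
  have h7 : w * m ≤ w ^ 2 * m := Nat.mul_le_mul_right _ h5
  have h8 : S.card ≤ w ^ 2 * S.card := Nat.le_mul_of_pos_left _ (by positivity)
  have h9 : 1 ≤ w ^ 2 * m := Nat.mul_pos (by positivity) (by omega)
  nlinarith

/-- The pivots come from the kept rows only, but independence and the truncated kernels are monotone
in the set of rows. Stating both for all of `S` makes the bound depend on `h₁` and `h₂` alone. -/
theorem encode_steps_le_of_indep [Fintype U] (hw : 1 ≤ w) (hwm : w ≤ m) (S : Finset U)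
    (h : U → F) (h₁ : U → Fin (m - w + 1)) (h₂ : U → Fin w → F) (coin : U → Fˣ)
    (free : Fin m → F) (hind : IndepRows h₁ h₂ S) :
    (encode m w S (h, h₁, h₂, coin, free)).steps ≤ 40 * w * (S.card + m +
      ∑ c ∈ Finset.range m,
        Module.finrank F (truncKer S (fun u => (h₁ u : ℕ)) (rowBand h₁ h₂) c)) := by
  have h1 := (encode_eq h h₁ h₂ coin free S).2
  obtain ⟨P, ⟨s, hP⟩, hcard, hspan, hPm, hfree⟩ :=
    (solveBand_spec hw hwm h h₁ h₂ (nodup_subsample coin S)).2.2 (by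
      rw [coe_kept]
      exact hind.mono (Finset.filter_subset _ _))
  have h2 := (hfree free).1
  rw [length_subsample] at h2 hcard
  have hsum : ((subsample coin (S.sort (· ≤ ·))).val.map fun u => (h₁ u : ℕ)).sum =
      ∑ u ∈ kept coin S, (h₁ u : ℕ) := by
    rw [← toFinset_subsample, List.sum_toFinset _ (nodup_subsample coin S)]
  rw [hsum] at h2
  have hpiv := sum_pivots_le hP hPm (kept coin S) (fun u => (h₁ u : ℕ))
    (fun u => by have := (h₁ u).2; omega) (rowBand h₁ h₂)
    (fun u hu => ⟨_, hspan u (by rwa [← List.mem_toFinset, toFinset_subsample]), rfl⟩) hcard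
  have hmono : ∑ c ∈ Finset.range m,
        Module.finrank F (truncKer (kept coin S) (fun u => (h₁ u : ℕ)) (rowBand h₁ h₂) c) ≤
      ∑ c ∈ Finset.range m,
        Module.finrank F (truncKer S (fun u => (h₁ u : ℕ)) (rowBand h₁ h₂) c) :=
    Finset.sum_le_sum fun c _ =>
      Submodule.finrank_mono (truncKer_mono (Finset.filter_subset _ _) _ _ _)
  set D := ∑ c ∈ Finset.range m,
    Module.finrank F (truncKer S (fun u => (h₁ u : ℕ)) (rowBand h₁ h₂) c)
  have h3 : (kept coin S).card ≤ S.card := Finset.card_le_card (Finset.filter_subset _ _)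
  have h4 : 10 * w * ((kept coin S).card + ∑ c ∈ pivots m P, c) ≤
      10 * w * (S.card + D + ∑ u ∈ kept coin S, (h₁ u : ℕ)) :=
    Nat.mul_le_mul_left _ (by omega)
  have h5 : S.card ≤ w * S.card := Nat.le_mul_of_pos_left _ (by omega)
  have h6 : 1 ≤ w * m := Nat.mul_pos (by omega) (by omega)
  nlinarith

theorem encode_val_of_not_indep (hw : 1 ≤ w) (hwm : w ≤ m) (S : Finset U)
    (h : U → F) (h₁ : U → Fin (m - w + 1)) (h₂ : U → Fin w → F) (coin : U → Fˣ)
    (free : Fin m → F) (hdep : ¬ IndepRows h₁ h₂ (kept coin S)) :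
    (encode m w S (h, h₁, h₂, coin, free)).val = Encoding.failed (S.sort (· ≤ ·)) := by
  rw [(encode_eq h h₁ h₂ coin free S).1,
    (solveBand_spec hw hwm h h₁ h₂ (nodup_subsample coin S)).2.1 (by rwa [coe_kept])]
  rfl

/-- The order of quantifiers matters: the set `p` of pivot columns is chosen before `free`. This
makes the output uniform on the solution space. -/
theorem encode_val_of_indep (hw : 1 ≤ w) (hwm : w ≤ m) (S : Finset U)
    (h : U → F) (h₁ : U → Fin (m - w + 1)) (h₂ : U → Fin w → F) (coin : U → Fˣ)
    (hind : IndepRows h₁ h₂ (kept coin S)) :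
    ∃ p : Finset (Fin m), p.card = (kept coin S).card ∧ ∀ free : Fin m → F, ∃ y,
      (encode m w S (h, h₁, h₂, coin, free)).val = Encoding.solved y h h₁ h₂ ∧
      ∀ x, y = x ↔ (∀ c ∉ p, x c = free c) ∧
        ∀ u ∈ kept coin S, ∑ j : Fin m, rowBand h₁ h₂ u j * x j = h u := by
  obtain ⟨P, -, hcard, -, -, hfree⟩ :=
    (solveBand_spec hw hwm h h₁ h₂ (nodup_subsample coin S)).2.2 (by rwa [coe_kept])
  rw [length_subsample] at hcard
  refine ⟨Finset.univ.filter fun c : Fin m => (c : ℕ) ∈ pivots m P, ?_, fun free => ?_⟩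
  · rw [← hcard, ← Finset.card_map Fin.valEmbedding]
    congr 1
    ext c
    simp only [Finset.mem_map, Finset.mem_filter, Finset.mem_univ, true_and,
      Fin.valEmbedding_apply]
    exact ⟨fun ⟨_, h, e⟩ => e ▸ h, fun h => ⟨⟨c, (mem_pivots.1 h).1⟩, h, rfl⟩⟩
  · obtain ⟨y, hy, hx⟩ := (hfree free).2
    refine ⟨y, by rw [(encode_eq h h₁ h₂ coin free S).1, hy]; rfl, fun x => ?_⟩
    rw [hx, ← toFinset_subsample]
    simp

end Encode

/-! ### Binary search and the decoder -/

section Decode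

variable {U : Type} [LinearOrder U]

/-- Every round takes at most five operations and halves the interval; `t` bounds the number of
halvings, whereas `n` is mere fuel. -/
theorem search_steps (a : List U) (u : U) (n : ℕ) :
    ∀ t lo hi, hi - lo < 2 ^ t → (search a u n lo hi).steps ≤ 5 * t + 1 := by
  induction n with
  | zero => simp [search]
  | succ n ih =>
    intro t lo hi ht
    by_cases hle : hi ≤ lo
    · simp [search, hle]
    · have ht0 : t ≠ 0 := by
        rintro rfl
        simp at ht
        omega
      obtain ⟨t, rfl⟩ := Nat.exists_eq_succ_of_ne_zero ht0
      rw [Nat.succ_eq_add_one, pow_succ] at ht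
      have i1 := ih t ((lo + hi) / 2 + 1) hi (by omega)
      have i2 := ih t lo ((lo + hi) / 2) (by omega)
      cases hv : a[(lo + hi) / 2]? with
      | none =>
        simp [search, hle, hv]
        omega
      | some v =>
        by_cases h1 : v = u
        · simp [search, hle, hv, h1]
          omega
        · by_cases h2 : v < u
          · simp [search, hle, hv, h1, h2]
            omega
          · simp [search, hle, hv, h1, h2]
            omega

theorem search_val {a : List U} (ha : a.Pairwise (· < ·)) (u : U) (n : ℕ) :
    ∀ lo hi, hi ≤ a.length → hi - lo < n →
      ((search a u n lo hi).val = true ↔ ∃ i, lo ≤ i ∧ i < hi ∧ a[i]? = some u) := by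
  induction n with
  | zero => intro lo hi _ h; omega
  | succ n ih =>
    intro lo hi hlen hn
    by_cases hle : hi ≤ lo
    · simp [search, hle]
      intro i h1 h2
      omega
    · have hmid : (lo + hi) / 2 < a.length := by omega
      have hlt : ∀ i j (hi : i < a.length) (hj : j < a.length), i < j → a[i] < a[j] :=
        List.pairwise_iff_getElem.1 ha
      obtain ⟨mid, hm⟩ : ∃ mid, mid = (lo + hi) / 2 := ⟨_, rfl⟩
      rw [← hm] at hmid
      obtain ⟨v, hvm⟩ : ∃ v, v = a[mid] := ⟨_, rfl⟩
      have hv : a[(lo + hi) / 2]? = some v := by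
        rw [hvm, ← List.getElem?_eq_getElem hmid, hm]
      by_cases h1 : v = u
      · have : (search a u (n + 1) lo hi).val = true := by
          simp [search, hle, hv, h1]
        rw [this]
        exact iff_of_true rfl ⟨mid, by omega, by omega, by rw [hm, hv, h1]⟩
      · by_cases h2 : v < u
        · have : (search a u (n + 1) lo hi).val = (search a u n (mid + 1) hi).val := by
            simp [search, hle, hv, h1, h2, hm]
          rw [this, ih _ _ hlen (by omega)]
          refine exists_congr fun i => ⟨fun ⟨e1, e2, e3⟩ => ⟨by omega, e2, e3⟩, ?_⟩
          rintro ⟨e1, e2, e3⟩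
          refine ⟨?_, e2, e3⟩
          by_contra hcon
          rw [List.getElem?_eq_getElem (by omega), Option.some.injEq] at e3
          rcases Nat.lt_or_ge i mid with h | h
          · exact absurd (hlt i mid (by omega) hmid h) (by rw [e3, ← hvm]; exact h2.not_gt)
          · obtain rfl : i = mid := by omega
            exact h1 (hvm.trans e3)
        · have : (search a u (n + 1) lo hi).val = (search a u n lo mid).val := by
            simp [search, hle, hv, h1, h2, hm]
          rw [this, ih _ _ (by omega) (by omega)]
          refine exists_congr fun i => ⟨fun ⟨e1, e2, e3⟩ => ⟨e1, by omega, e3⟩, ?_⟩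
          rintro ⟨e1, e2, e3⟩
          refine ⟨e1, ?_, e3⟩
          by_contra hcon
          rw [List.getElem?_eq_getElem (by omega), Option.some.injEq] at e3
          rcases Nat.lt_or_ge mid i with h | h
          · exact h2 (hvm ▸ e3 ▸ hlt mid i hmid (by omega) h)
          · obtain rfl : i = mid := by omega
            exact h1 (hvm.trans e3)

variable {F : Type} [Field F] [DecidableEq F] {m w : ℕ}

theorem decode_failed_val (S : Finset U) (u : U) :
    (decode (Encoding.failed (S.sort (· ≤ ·)) : Encoding F U m w) u).val = decide (u ∈ S) := by
  rw [Bool.eq_iff_iff, decide_eq_true_iff]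
  have hs : (S.sort (· ≤ ·)).Pairwise (· < ·) := (S.sortedLT_sort).pairwise
  refine (search_val hs u _ 0 _ le_rfl (by omega)).trans ?_
  rw [← Finset.mem_sort (· ≤ ·), List.mem_iff_getElem?]
  constructor
  · rintro ⟨i, -, -, h⟩
    exact ⟨i, h⟩
  · rintro ⟨i, h⟩
    exact ⟨i, Nat.zero_le _, (List.getElem?_eq_some_iff.1 h).1, h⟩

theorem decode_failed_steps (S : Finset U) (u : U) :
    (decode (Encoding.failed (S.sort (· ≤ ·)) : Encoding F U m w) u).steps ≤
      5 * (Nat.log 2 S.card + 1) + 1 := by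
  refine search_steps _ u _ _ _ _ ?_
  rw [Finset.length_sort]
  exact Nat.lt_pow_succ_log_self (by norm_num) _

theorem decode_solved_steps (x : Fin m → F) (h : U → F) (h₁ : U → Fin (m - w + 1))
    (h₂ : U → Fin w → F) (u : U) : (decode (Encoding.solved x h h₁ h₂) u).steps = 4 * w + 3 := by
  simp only [decode, Timed.bind_steps, op_steps, dot_steps, List.length_range']
  ring

theorem decode_solved_val (hwm : w ≤ m) (x : Fin m → F) (h : U → F) (h₁ : U → Fin (m - w + 1))
    (h₂ : U → Fin w → F) (u : U) : (decode (Encoding.solved x h h₁ h₂) u).val =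
      decide (∑ j : Fin m, rowBand h₁ h₂ u j * x j = h u) := by
  have h1 : ∑ j : Fin m, rowBand h₁ h₂ u j * x j =
      ∑ j ∈ Finset.Ico (h₁ u : ℕ) (h₁ u + w), rowBand h₁ h₂ u j * extend x j := by
    have h2 := Fin.sum_univ_eq_sum_range (fun j => rowBand h₁ h₂ u j * extend x j) m
    simp only [extend_of_lt x (Fin.is_lt _)] at h2
    rw [h2]
    symm
    refine Finset.sum_subset (fun j hj => ?_) fun j _ hj => ?_
    · have := (h₁ u).2
      simp only [Finset.mem_Ico, Finset.mem_range] at hj ⊢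
      omega
    · rw [rowBand_eq_zero h₁ h₂ (by simpa using hj), zero_mul]
  rw [h1]
  simp only [decode, Timed.bind_val, op_val, dot_val, sum_map_range']
  congr

end Decode

/-! ### Finite expectations, indicators and independence -/

section Expect

variable {Ω A B : Type} [Fintype Ω] [Nonempty Ω] [Fintype A] [Nonempty A] [Fintype B] [Nonempty B]

theorem expect_eq (X : Ω → ℝ) : expect X = (∑ ω, X ω) / Fintype.card Ω := by
  simp [expect, PMF.uniformOfFintype_apply, Finset.mul_sum, div_eq_inv_mul]

open Classical in
/-- The indicator of a proposition. -/
noncomputable def ind (p : Prop) : ℝ := if p then 1 else 0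

theorem ind_of {p : Prop} (h : p) : ind p = 1 := if_pos h

theorem ind_of_not {p : Prop} (h : ¬ p) : ind p = 0 := if_neg h

theorem ind_eq_ite (p : Prop) [Decidable p] : ind p = if p then 1 else 0 := by
  unfold ind
  congr

theorem ind_nonneg (p : Prop) : 0 ≤ ind p := by
  unfold ind
  split_ifs <;> norm_num

theorem ind_le_one (p : Prop) : ind p ≤ 1 := by
  unfold ind
  split_ifs <;> norm_num

theorem ind_mono {p q : Prop} (h : p → q) : ind p ≤ ind q := by
  by_cases hp : p
  · rw [ind_of hp, ind_of (h hp)]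
  · rw [ind_of_not hp]
    exact ind_nonneg q

theorem sum_ind {ι : Type*} (s : Finset ι) (p : ι → Prop) [DecidablePred p] :
    ∑ i ∈ s, ind (p i) = (s.filter p).card := by
  simp [ind_eq_ite]

theorem prob_eq (E : Set Ω) : prob E = expect fun ω => ind (ω ∈ E) := by
  classical
  rw [expect_eq, prob, PMF.toOuterMeasure_uniformOfFintype_apply]
  simp [Fintype.card_subtype, ind_eq_ite]

theorem expect_mono {X Y : Ω → ℝ} (h : ∀ ω, X ω ≤ Y ω) : expect X ≤ expect Y := by
  rw [expect_eq, expect_eq]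
  gcongr
  exact h _

theorem expect_nonneg {X : Ω → ℝ} (h : ∀ ω, 0 ≤ X ω) : 0 ≤ expect X := by
  rw [expect_eq]
  exact div_nonneg (Finset.sum_nonneg fun ω _ => h ω) (Nat.cast_nonneg _)

theorem expect_const (c : ℝ) : expect (fun _ : Ω => c) = c := by
  rw [expect_eq]
  simp

theorem expect_add (X Y : Ω → ℝ) : expect (fun ω => X ω + Y ω) = expect X + expect Y := by
  simp only [expect_eq, Finset.sum_add_distrib, add_div]

theorem expect_mul_left (c : ℝ) (X : Ω → ℝ) : expect (fun ω => c * X ω) = c * expect X := by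
  simp only [expect_eq, ← Finset.mul_sum, mul_div_assoc]

theorem expect_sum {ι : Type*} (s : Finset ι) (X : ι → Ω → ℝ) :
    expect (fun ω => ∑ i ∈ s, X i ω) = ∑ i ∈ s, expect (X i) := by
  simp only [expect_eq]
  rw [Finset.sum_comm, Finset.sum_div]

theorem expect_prod (X : A × B → ℝ) : expect X = expect fun a => expect fun b => X (a, b) := by
  simp only [expect_eq, Fintype.sum_prod_type, Fintype.card_prod, ← Finset.sum_div]
  push_cast
  rw [div_div, mul_comm]

theorem expect_comm (X : A → B → ℝ) :
    (expect fun a => expect fun b => X a b) = expect fun b => expect fun a => X a b := by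
  simp only [expect_eq, ← Finset.sum_div, div_div]
  rw [Finset.sum_comm, mul_comm]

theorem expect_pi {U : Type} [Fintype U] [DecidableEq U] (f : U → A → ℝ) :
    (expect fun g : U → A => ∏ u, f u (g u)) = ∏ u, expect (f u) := by
  simp only [expect_eq, Finset.prod_div_distrib, Finset.prod_univ_sum, Fintype.piFinset_univ]
  simp

/-- Independence of one coordinate from the others: exchanging `g u` with a fresh sample is an
involution of `A × (U → A)`, and `Z` does not notice it. -/
theorem expect_update {U : Type} [Fintype U] [DecidableEq U] (u : U) (φ : A → ℝ)
    (Z : (U → A) → ℝ) (hZ : ∀ g a, Z (Function.update g u a) = Z g) :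
    (expect fun g : U → A => φ (g u) * Z g) = expect φ * expect Z := by
  have h1 : (expect fun p : A × (U → A) => φ (p.2 u) * Z p.2) =
      expect fun p : A × (U → A) => φ p.1 * Z p.2 := by
    rw [expect_eq, expect_eq]
    congr 1
    refine Fintype.sum_equiv ⟨fun p : A × (U → A) => (p.2 u, Function.update p.2 u p.1),
      fun p => (p.2 u, Function.update p.2 u p.1), ?_, ?_⟩ _ _ ?_
    · rintro ⟨a, g⟩
      simp
    · rintro ⟨a, g⟩
      simp
    · rintro ⟨a, g⟩
      simp [hZ]
  rw [expect_prod, expect_prod] at h1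
  dsimp only at h1
  rw [expect_const] at h1
  rw [h1]
  simp only [expect_mul_left]
  rw [mul_comm (expect φ), ← expect_mul_left]
  congr 1
  funext a
  ring

theorem prob_le_one (E : Set Ω) : prob E ≤ 1 := by
  rw [prob_eq]
  exact (expect_mono fun _ => ind_le_one _).trans_eq (expect_const 1)

end Expect

/-! ### Averages over a single coin or hash value -/

section Field

variable {F : Type} [Field F] [Fintype F]

theorem one_lt_card_real : (1 : ℝ) < Fintype.card F := by
  exact_mod_cast Fintype.one_lt_card

variable [DecidableEq F]

theorem card_units_real : (Fintype.card Fˣ : ℝ) = Fintype.card F - 1 := by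
  rw [Fintype.card_units, Nat.cast_sub Fintype.card_pos, Nat.cast_one]

theorem expect_ite_unit (a b : ℝ) :
    (expect fun c : Fˣ => if c ≠ 1 then a else b) =
      ((Fintype.card F - 2) * a + b) / (Fintype.card F - 1) := by
  have h : ∀ c : Fˣ, (if c ≠ 1 then a else b) = a + if c = 1 then b - a else 0 := by
    intro c
    split_ifs <;> simp_all
  rw [expect_eq, card_units_real, Finset.sum_congr rfl fun c _ => h c, Finset.sum_add_distrib,
    Finset.sum_ite_eq' Finset.univ (1 : Fˣ), Finset.sum_const, Finset.card_univ, nsmul_eq_mul,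
    card_units_real]
  simp
  ring

theorem expect_ite_eq (x : F) (a b : ℝ) :
    (expect fun c : F => if x = c then a else b) =
      (a + (Fintype.card F - 1) * b) / Fintype.card F := by
  have h : ∀ c : F, (if x = c then a else b) = b + if x = c then a - b else 0 := by
    intro c
    split_ifs <;> simp_all
  rw [expect_eq, Finset.sum_congr rfl fun c _ => h c, Finset.sum_add_distrib,
    Finset.sum_ite_eq Finset.univ x, Finset.sum_const, Finset.card_univ, nsmul_eq_mul]
  simp
  ring

end Field

/-! ### Effect of one element on the kept set -/

section Kept

variable {F U : Type} [Field F] [DecidableEq F] [LinearOrder U]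

theorem kept_insert (coin : U → Fˣ) (S : Finset U) (u : U) :
    kept coin (insert u S) = if coin u ≠ 1 then insert u (kept coin S) else kept coin S := by
  simp only [kept, Finset.filter_insert]

theorem kept_update (coin : U → Fˣ) {S : Finset U} {u : U} (hu : u ∉ S) (c : Fˣ) :
    kept (Function.update coin u c) S = kept coin S := by
  refine Finset.filter_congr fun v hv => ?_
  rw [Function.update_of_ne]
  rintro rfl
  exact hu hv

end Kept

/-! ### Density of the output, privacy and error probability -/

section Privacy

theorem card_agree {F : Type} [Fintype F] [DecidableEq F] {m : ℕ} (p : Finset (Fin m)) (x : Fin m → F) :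
    (Finset.univ.filter fun free : Fin m → F => ∀ c ∉ p, x c = free c).card =
      Fintype.card F ^ p.card := by
  have : (Finset.univ.filter fun free : Fin m → F => ∀ c ∉ p, x c = free c) =
      Fintype.piFinset fun c => if c ∈ p then Finset.univ else {x c} := by
    ext free
    simp only [Finset.mem_filter, Finset.mem_univ, true_and, Fintype.mem_piFinset]
    refine forall_congr' fun c => ?_
    by_cases hc : c ∈ p
    · simp [hc]
    · simp [hc, eq_comm]
  rw [this, Fintype.card_piFinset]
  have h2 : ∀ c, (if c ∈ p then (Finset.univ : Finset F) else {x c}).card =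
      if c ∈ p then Fintype.card F else 1 := by
    intro c
    split_ifs <;> simp
  rw [Finset.prod_congr rfl fun c _ => h2 c, Finset.prod_ite_mem, Finset.univ_inter,
    Finset.prod_const]

variable {F U : Type} [Field F] [Fintype F] [DecidableEq F] [Fintype U] [LinearOrder U] {m w : ℕ}

open Classical in
/-- Up to normalization, the density of the solution `x` if the rows of `K` are used. -/
noncomputable def solutionWeight (h : U → F) (h₁ : U → Fin (m - w + 1)) (h₂ : U → Fin w → F)
    (K : Finset U) (x : Fin m → F) : ℝ :=
  if IndepRows h₁ h₂ K ∧ ∀ u ∈ K, ∑ j : Fin m, rowBand h₁ h₂ u j * x j = h u then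
    (Fintype.card F : ℝ) ^ K.card else 0

theorem solutionWeight_nonneg (h : U → F) (h₁ : U → Fin (m - w + 1)) (h₂ : U → Fin w → F)
    (K : Finset U) (x : Fin m → F) : 0 ≤ solutionWeight h h₁ h₂ K x := by
  rw [solutionWeight]
  split_ifs <;> positivity

theorem solutionWeight_insert_le (h : U → F) (h₁ : U → Fin (m - w + 1)) (h₂ : U → Fin w → F)
    {K : Finset U} {u : U} (hu : u ∉ K) (x : Fin m → F) :
    solutionWeight h h₁ h₂ (insert u K) x ≤ Fintype.card F * solutionWeight h h₁ h₂ K x := by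
  rw [solutionWeight, solutionWeight]
  split_ifs with h1 h2 h2
  · rw [Finset.card_insert_of_notMem hu, pow_succ, mul_comm]
  · exact absurd ⟨h1.1.mono (Finset.subset_insert _ _),
      fun v hv => h1.2 v (Finset.mem_insert_of_mem hv)⟩ h2
  · positivity
  · simp

/-- The value of `ψ` at the solution that the encoding consists of, and zero if there is none. -/
def onSolved (ψ : (U → F) → (U → Fin (m - w + 1)) → (U → Fin w → F) → (Fin m → F) → ℝ) :
    Encoding F U m w → ℝ
  | .solved x h h₁ h₂ => ψ h h₁ h₂ x
  | .failed _ => 0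

/-- A solution `x` is output for exactly those `free` that agree with it off the pivot columns,
which are `q ^ |K|` of the `q ^ m` tapes; a non-solution is never output. -/
theorem expect_onSolved_free (hw : 1 ≤ w) (hwm : w ≤ m) (S : Finset U)
    (ψ : (U → F) → (U → Fin (m - w + 1)) → (U → Fin w → F) → (Fin m → F) → ℝ)
    (h : U → F) (h₁ : U → Fin (m - w + 1)) (h₂ : U → Fin w → F) (coin : U → Fˣ) :
    (expect fun free : Fin m → F => onSolved ψ (encode m w S (h, h₁, h₂, coin, free)).val) =
      expect fun x : Fin m → F => solutionWeight h h₁ h₂ (kept coin S) x * ψ h h₁ h₂ x := by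
  by_cases hind : IndepRows h₁ h₂ (kept coin S)
  · obtain ⟨p, hp, hy⟩ := encode_val_of_indep hw hwm S h h₁ h₂ coin hind
    choose y hy1 hy2 using hy
    simp only [hy1, onSolved, expect_eq]
    congr 1
    have h1 : ∀ free, ψ h h₁ h₂ (y free) = ∑ x, if y free = x then ψ h h₁ h₂ x else 0 := by
      intro free
      rw [Finset.sum_ite_eq Finset.univ (y free), if_pos (Finset.mem_univ _)]
    rw [Finset.sum_congr rfl fun free _ => h1 free, Finset.sum_comm]
    refine Finset.sum_congr rfl fun x _ => ?_
    rw [Finset.sum_ite, Finset.sum_const_zero, add_zero, Finset.sum_const, nsmul_eq_mul]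
    congr 1
    rw [solutionWeight]
    split_ifs with hsat
    · rw [← hp, ← Nat.cast_pow, ← card_agree p x]
      congr 2
      ext free
      simp only [Finset.mem_filter, Finset.mem_univ, true_and]
      rw [hy2]
      exact and_iff_left hsat.2
    · rw [Nat.cast_eq_zero, Finset.card_eq_zero, Finset.filter_eq_empty_iff]
      intro free _ hyx
      exact hsat ⟨hind, ((hy2 free x).1 hyx).2⟩
  · have h1 : ∀ free, (encode m w S (h, h₁, h₂, coin, free)).val =
        Encoding.failed (S.sort (· ≤ ·)) := fun free =>
      encode_val_of_not_indep hw hwm S h h₁ h₂ coin free hind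
    simp [h1, onSolved, solutionWeight, hind]

theorem expect_onSolved (hw : 1 ≤ w) (hwm : w ≤ m) (S : Finset U)
    (ψ : (U → F) → (U → Fin (m - w + 1)) → (U → Fin w → F) → (Fin m → F) → ℝ) :
    (expect fun ω : Tape F U m w => onSolved ψ (encode m w S ω).val) =
      expect fun h : U → F => expect fun h₁ : U → Fin (m - w + 1) =>
        expect fun h₂ : U → Fin w → F => expect fun coin : U → Fˣ => expect fun x : Fin m → F =>
          solutionWeight h h₁ h₂ (kept coin S) x * ψ h h₁ h₂ x := by
  simp only [← expect_onSolved_free hw hwm]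
  rw [expect_prod]
  congr 1; funext h
  rw [expect_prod]
  congr 1; funext h₁
  rw [expect_prod]
  congr 1; funext h₂
  rw [expect_prod]

/-- The comparison holds pointwise in the hash functions. Keeping `u` multiplies the weight by at
most `q`, and `((q - 2) q + 1) / (q - 1) = q - 1`; conversely, excluding `u`, which has probability
`1 / (q - 1)`, reproduces the weight for `S`. -/
theorem expect_onSolved_insert (hw : 1 ≤ w) (hwm : w ≤ m) {S : Finset U} {u : U} (hu : u ∉ S)
    (ψ : (U → F) → (U → Fin (m - w + 1)) → (U → Fin w → F) → (Fin m → F) → ℝ)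
    (hψ : ∀ h h₁ h₂ x, 0 ≤ ψ h h₁ h₂ x) :
    (expect fun ω : Tape F U m w => onSolved ψ (encode m w (insert u S) ω).val) ≤
      (Fintype.card F - 1) * (expect fun ω : Tape F U m w => onSolved ψ (encode m w S ω).val) ∧
    (expect fun ω : Tape F U m w => onSolved ψ (encode m w S ω).val) ≤
      (Fintype.card F - 1) *
        (expect fun ω : Tape F U m w => onSolved ψ (encode m w (insert u S) ω).val) := by
  have hq := one_lt_card_real (F := F)
  have hq1 : (Fintype.card F : ℝ) - 1 ≠ 0 := by linarith
  simp only [expect_onSolved hw hwm, ← expect_mul_left]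
  have key : ∀ (h : U → F) (h₁ : U → Fin (m - w + 1)) (h₂ : U → Fin w → F) (a b : ℝ),
      (expect fun coin : U → Fˣ => (if coin u ≠ 1 then a else b) *
        expect fun x : Fin m → F => solutionWeight h h₁ h₂ (kept coin S) x * ψ h h₁ h₂ x) =
      ((Fintype.card F - 2) * a + b) / (Fintype.card F - 1) * expect fun coin : U → Fˣ =>
        expect fun x : Fin m → F => solutionWeight h h₁ h₂ (kept coin S) x * ψ h h₁ h₂ x := by
    intro h h₁ h₂ a b
    rw [expect_update u (fun c : Fˣ => if c ≠ 1 then a else b), expect_ite_unit]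
    intro coin c
    rw [kept_update coin hu]
  have hnn : ∀ (h : U → F) (h₁ : U → Fin (m - w + 1)) (h₂ : U → Fin w → F) (K : Finset U)
      (x : Fin m → F), 0 ≤ solutionWeight h h₁ h₂ K x * ψ h h₁ h₂ x := fun h h₁ h₂ K x =>
    mul_nonneg (solutionWeight_nonneg _ _ _ _ _) (hψ _ _ _ _)
  constructor
  · refine expect_mono fun h => expect_mono fun h₁ => expect_mono fun h₂ => ?_
    simp only [expect_mul_left]
    have h1 := key h h₁ h₂ (Fintype.card F) 1
    have h2 : ((Fintype.card F - 2) * (Fintype.card F : ℝ) + 1) / (Fintype.card F - 1) =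
        Fintype.card F - 1 := by
      field_simp
      ring
    rw [h2] at h1
    rw [← h1]
    refine expect_mono fun coin => ?_
    rw [kept_insert]
    split_ifs with hc
    · rw [← expect_mul_left]
      refine expect_mono fun x => ?_
      rw [← mul_assoc]
      exact mul_le_mul_of_nonneg_right
        (solutionWeight_insert_le _ _ _ (fun hmem => hu (Finset.mem_filter.1 hmem).1) _)
        (hψ _ _ _ _)
    · rw [one_mul]
  · refine expect_mono fun h => expect_mono fun h₁ => expect_mono fun h₂ => ?_
    simp only [expect_mul_left]
    have h1 := key h h₁ h₂ 0 1
    have h2 : (expect fun coin : U → Fˣ =>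
        expect fun x : Fin m → F => solutionWeight h h₁ h₂ (kept coin S) x * ψ h h₁ h₂ x) =
        (Fintype.card F - 1) * (expect fun coin : U → Fˣ => (if coin u ≠ 1 then (0 : ℝ) else 1) *
        expect fun x : Fin m → F =>
          solutionWeight h h₁ h₂ (kept coin S) x * ψ h h₁ h₂ x) := by
      rw [h1, mul_zero, zero_add, ← mul_assoc, mul_one_div_cancel hq1, one_mul]
    rw [h2]
    refine mul_le_mul_of_nonneg_left (expect_mono fun coin => ?_) (by linarith)
    rw [kept_insert]
    split_ifs with hc
    · rw [zero_mul]
      exact expect_nonneg fun x => hnn _ _ _ _ _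
    · rw [one_mul]

/-- On solved encodings the bound is purely multiplicative. Failures for `S` are charged to `δ`,
those for `T` are discarded. -/
theorem isDP_bandMechanism (hw : 1 ≤ w) (hwm : w ≤ m) {k : ℕ} {ε δ : ℝ}
    (hF : (Fintype.card F : ℝ) = Real.exp ε + 1)
    (hfail : ∀ S : Finset U, S.card ≤ k →
      prob {ω | ¬ ((bandMechanism F U m w).encode S ω).val.IsSolved} ≤ δ) :
    (bandMechanism F U m w).IsDP k ε δ := by
  intro S T hS hT hST R
  let ψ : (U → F) → (U → Fin (m - w + 1)) → (U → Fin w → F) → (Fin m → F) → ℝ :=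
    fun h h₁ h₂ x => ind (Encoding.solved x h h₁ h₂ ∈ R)
  have hψ : ∀ h h₁ h₂ x, 0 ≤ ψ h h₁ h₂ x := fun h h₁ h₂ x => ind_nonneg _
  have hle : prob {ω | ((bandMechanism F U m w).encode S ω).val ∈ R} ≤
      (expect fun ω : Tape F U m w => onSolved ψ (encode m w S ω).val) + δ := by
    refine le_trans ?_ (add_le_add_right (hfail S hS) _)
    rw [prob_eq, prob_eq, ← expect_add]
    refine expect_mono fun ω => ?_
    simp only [Set.mem_ofPred_eq, bandMechanism]
    cases (encode m w S ω).val with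
    | solved x h h₁ h₂ => exact le_add_of_nonneg_right (ind_nonneg _)
    | failed l =>
      rw [ind_of (p := ¬ Encoding.IsSolved (Encoding.failed l)) id]
      simpa only [onSolved, zero_add] using ind_le_one _
  have hge : (expect fun ω : Tape F U m w => onSolved ψ (encode m w T ω).val) ≤
      prob {ω | ((bandMechanism F U m w).encode T ω).val ∈ R} := by
    rw [prob_eq]
    refine expect_mono fun ω => ?_
    simp only [Set.mem_ofPred_eq, bandMechanism]
    cases (encode m w T ω).val with
    | solved x h h₁ h₂ => exact le_rfl
    | failed l => exact ind_nonneg _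
  have hexp : (Fintype.card F : ℝ) - 1 = Real.exp ε := by rw [hF]; ring
  have hcmp : (expect fun ω : Tape F U m w => onSolved ψ (encode m w S ω).val) ≤ Real.exp ε *
      expect fun ω : Tape F U m w => onSolved ψ (encode m w T ω).val := by
    rw [← hexp]
    obtain ⟨u, hu⟩ := Finset.card_eq_one.1 hST
    have hmem : ∀ v, (v ∈ S ∧ v ∉ T ∨ v ∈ T ∧ v ∉ S) ↔ v = u := fun v => by
      rw [← Finset.mem_symmDiff, hu, Finset.mem_singleton]
    rcases (hmem u).2 rfl with ⟨h1, h2⟩ | ⟨h1, h2⟩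
    · have : S = insert u T := by
        ext v
        rw [Finset.mem_insert, ← hmem v]
        by_cases hv : v = u
        · subst hv
          tauto
        · have := (hmem v).not.2 hv
          tauto
      rw [this]
      exact (expect_onSolved_insert hw hwm h2 ψ hψ).1
    · have : T = insert u S := by
        ext v
        rw [Finset.mem_insert, ← hmem v]
        by_cases hv : v = u
        · subst hv
          tauto
        · have := (hmem v).not.2 hv
          tauto
      rw [this]
      exact (expect_onSolved_insert hw hwm h2 ψ hψ).2
  have := mul_le_mul_of_nonneg_left hge (Real.exp_nonneg ε)
  linarith

/-- A queried member is answered wrongly only if it is excluded and its equation fails, which gives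
`1 / (q - 1) * (1 - 1 / q) = 1 / q`; a queried non-member is wrong if its equation holds, again `1 /
q`. Without a query the density of a member averages to one. The exclusion probability is tuned to
make the two error rates equal. -/
theorem expect_wrong_factor (x : F) (inS inQ : Prop) [Decidable inS] [Decidable inQ] :
    (expect fun a : F => expect fun c : Fˣ =>
      (if inS ∧ c ≠ 1 then (if x = a then (Fintype.card F : ℝ) else 0) else 1) *
        (if inQ then (if decide (x = a) ≠ decide inS then 1 else 0) else 1)) =
      if inQ then 1 / (Fintype.card F : ℝ) else 1 := by
  have hq := one_lt_card_real (F := F)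
  have hq0 : (Fintype.card F : ℝ) ≠ 0 := by linarith
  have hq1 : (Fintype.card F : ℝ) - 1 ≠ 0 := by linarith
  by_cases hS : inS <;> by_cases hQ : inQ
  · have : ∀ (a : F) (c : Fˣ),
        (if inS ∧ c ≠ 1 then (if x = a then (Fintype.card F : ℝ) else 0) else 1) *
        (if inQ then (if decide (x = a) ≠ decide inS then (1 : ℝ) else 0) else 1) =
        if c ≠ 1 then 0 else if x = a then 0 else 1 := by
      intro a c
      by_cases h1 : c = 1 <;> by_cases h2 : x = a <;> simp [hS, hQ, h1, h2]
    simp only [this]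
    simp only [expect_ite_unit, hQ, if_true, mul_zero, zero_add]
    simp only [div_eq_inv_mul, expect_mul_left, expect_ite_eq]
    field_simp
    ring
  · have : ∀ (a : F) (c : Fˣ),
        (if inS ∧ c ≠ 1 then (if x = a then (Fintype.card F : ℝ) else 0) else 1) *
        (if inQ then (if decide (x = a) ≠ decide inS then (1 : ℝ) else 0) else 1) =
        if c ≠ 1 then (if x = a then (Fintype.card F : ℝ) else 0) else 1 := by
      intro a c
      by_cases h1 : c = 1 <;> by_cases h2 : x = a <;> simp [hS, hQ, h1, h2]
    simp only [this]
    simp only [expect_ite_unit, hQ, if_false]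
    simp only [div_eq_inv_mul, expect_mul_left, expect_add, expect_const, expect_ite_eq]
    field_simp
    ring
  · have : ∀ (a : F) (c : Fˣ),
        (if inS ∧ c ≠ 1 then (if x = a then (Fintype.card F : ℝ) else 0) else 1) *
        (if inQ then (if decide (x = a) ≠ decide inS then (1 : ℝ) else 0) else 1) =
        if x = a then 1 else 0 := by
      intro a c
      by_cases h2 : x = a <;> simp [hS, hQ, h2]
    simp only [this]
    simp only [expect_const, expect_ite_eq, hQ, if_true]
    simp
  · simp [hS, hQ, expect_const]

theorem hasError_bandMechanism (hw : 1 ≤ w) (hwm : w ≤ m) (k : ℕ) :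
    (bandMechanism F U m w).HasError k (1 / (Fintype.card F : ℝ)) := by
  intro S _ Q
  -- A failed encoding answers everything correctly and so contributes nothing, unless there is no
  -- query at all.
  rcases Q.eq_empty_or_nonempty with rfl | hQ
  · simpa using prob_le_one _
  let b : (U → Fin (m - w + 1)) → (U → Fin w → F) → (Fin m → F) → U → F :=
    fun h₁ h₂ x u => ∑ j : Fin m, rowBand h₁ h₂ u j * x j
  let ψ : (U → F) → (U → Fin (m - w + 1)) → (U → Fin w → F) → (Fin m → F) → ℝ :=
    fun h h₁ h₂ x => ind (∀ u ∈ Q, decide (b h₁ h₂ x u = h u) ≠ decide (u ∈ S))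
  have heq : prob {ω | ∀ u ∈ Q, ((bandMechanism F U m w).decode
      ((bandMechanism F U m w).encode S ω).val u).val ≠ decide (u ∈ S)} ≤
      expect fun ω : Tape F U m w => onSolved ψ (encode m w S ω).val := by
    rw [prob_eq]
    refine expect_mono fun ω => ?_
    obtain ⟨h, h₁, h₂, coin, free⟩ := ω
    simp only [Set.mem_ofPred_eq, bandMechanism]
    by_cases hind : IndepRows h₁ h₂ (kept coin S)
    · obtain ⟨p, -, hy⟩ := encode_val_of_indep hw hwm S h h₁ h₂ coin hind
      obtain ⟨y, hy, -⟩ := hy free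
      rw [hy]
      simp only [onSolved, ψ, b, decode_solved_val hwm]
      exact le_rfl
    · rw [encode_val_of_not_indep hw hwm S h h₁ h₂ coin free hind]
      simp only [onSolved, decode_failed_val]
      obtain ⟨u, hu⟩ := hQ
      rw [ind_of_not fun hall => hall u hu rfl]
  refine heq.trans ?_
  rw [expect_onSolved hw hwm]
  have hswap : (expect fun h : U → F => expect fun h₁ : U → Fin (m - w + 1) =>
        expect fun h₂ : U → Fin w → F => expect fun coin : U → Fˣ => expect fun x : Fin m → F =>
          solutionWeight h h₁ h₂ (kept coin S) x * ψ h h₁ h₂ x) =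
      expect fun h₁ : U → Fin (m - w + 1) => expect fun h₂ : U → Fin w → F =>
        expect fun x : Fin m → F => expect fun h : U → F => expect fun coin : U → Fˣ =>
          solutionWeight h h₁ h₂ (kept coin S) x * ψ h h₁ h₂ x := by
    rw [expect_comm]
    congr 1; funext h₁
    rw [expect_comm]
    congr 1; funext h₂
    rw [expect_comm (A := Fin m → F)]
    congr 1; funext h
    rw [expect_comm]
  rw [hswap]
  have hle : ∀ h₁ h₂ x, (expect fun h : U → F => expect fun coin : U → Fˣ =>
      solutionWeight h h₁ h₂ (kept coin S) x * ψ h h₁ h₂ x) ≤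
      (1 / (Fintype.card F : ℝ)) ^ Q.card := by
    intro h₁ h₂ x
    have hprod : ∀ (h : U → F) (coin : U → Fˣ),
        solutionWeight h h₁ h₂ (kept coin S) x * ψ h h₁ h₂ x ≤
        ∏ u, ((if u ∈ S ∧ coin u ≠ 1 then
            (if b h₁ h₂ x u = h u then (Fintype.card F : ℝ) else 0) else 1) *
          (if u ∈ Q then (if decide (b h₁ h₂ x u = h u) ≠ decide (u ∈ S) then 1 else 0)
            else 1)) := by
      intro h coin
      rw [Finset.prod_mul_distrib]
      have e1 : (∏ u, if u ∈ Q then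
          (if decide (b h₁ h₂ x u = h u) ≠ decide (u ∈ S) then (1 : ℝ) else 0) else 1) =
          ψ h h₁ h₂ x := by
        rw [Finset.prod_ite_mem, Finset.univ_inter, Finset.prod_ite_zero, Finset.prod_const_one]
        simp only [ψ, ind]
        congr
      have e2 : (∏ u, if u ∈ S ∧ coin u ≠ 1 then
            (if b h₁ h₂ x u = h u then (Fintype.card F : ℝ) else 0) else 1) =
          if ∀ u ∈ kept coin S, b h₁ h₂ x u = h u then
            (Fintype.card F : ℝ) ^ (kept coin S).card else 0 := by
        rw [← Finset.prod_const]
        refine Eq.trans ?_ (Finset.prod_ite_zero.trans (by congr))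
        rw [kept, Finset.prod_filter, ← Finset.univ_inter S, ← Finset.prod_ite_mem]
        refine Finset.prod_congr rfl fun u _ => ?_
        simp only [ite_and, Finset.univ_inter]
      rw [e1, e2]
      -- Dropping the requirement of independent rows only increases the weight and leaves a product
      -- over the elements.
      refine mul_le_mul_of_nonneg_right ?_ ?_
      · rw [solutionWeight]
        split_ifs with h1 h2 h2
        · exact le_rfl
        · exact absurd h1.2 h2
        · positivity
        · exact le_rfl
      · exact ind_nonneg _
    refine (expect_mono fun h => expect_mono fun coin => hprod h coin).trans ?_
    have e3 : ∀ h : U → F, (expect fun coin : U → Fˣ => ∏ u, ((if u ∈ S ∧ coin u ≠ 1 then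
            (if b h₁ h₂ x u = h u then (Fintype.card F : ℝ) else 0) else 1) *
          (if u ∈ Q then (if decide (b h₁ h₂ x u = h u) ≠ decide (u ∈ S) then 1 else 0)
            else 1))) = ∏ u, expect fun c : Fˣ => (if u ∈ S ∧ c ≠ 1 then
            (if b h₁ h₂ x u = h u then (Fintype.card F : ℝ) else 0) else 1) *
          (if u ∈ Q then (if decide (b h₁ h₂ x u = h u) ≠ decide (u ∈ S) then 1 else 0)
            else 1) := fun h => expect_pi (fun u (c : Fˣ) => (if u ∈ S ∧ c ≠ 1 then
            (if b h₁ h₂ x u = h u then (Fintype.card F : ℝ) else 0) else 1) *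
          (if u ∈ Q then (if decide (b h₁ h₂ x u = h u) ≠ decide (u ∈ S) then 1 else 0)
            else 1))
    simp only [e3]
    rw [expect_pi fun u (a : F) => expect fun c : Fˣ => (if u ∈ S ∧ c ≠ 1 then
            (if b h₁ h₂ x u = a then (Fintype.card F : ℝ) else 0) else 1) *
          (if u ∈ Q then (if decide (b h₁ h₂ x u = a) ≠ decide (u ∈ S) then 1 else 0)
            else 1)]
    simp only [expect_wrong_factor]
    rw [Finset.prod_ite_mem, Finset.univ_inter, Finset.prod_const]
  refine (expect_mono fun h₁ => expect_mono fun h₂ => expect_mono fun x => hle h₁ h₂ x).trans ?_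
  simp only [expect_const]
  exact le_rfl

end Privacy

/-! ### Concavity of powers -/

section Jensen

variable {Ω : Type} [Fintype Ω] [Nonempty Ω]

/-- Jensen's inequality. It lets counts of vectors over a large field be treated through `q ^ ρ =
exp θ`, with `θ` independent of `q`. -/
theorem expect_rpow_le {X : Ω → ℝ} (hX : ∀ ω, 0 ≤ X ω) {ρ : ℝ} (h0 : 0 ≤ ρ) (h1 : ρ ≤ 1) :
    (expect fun ω => X ω ^ ρ) ≤ expect X ^ ρ := by
  have hc : (0 : ℝ) < Fintype.card Ω := by exact_mod_cast Fintype.card_pos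
  have := (Real.concaveOn_rpow h0 h1).le_map_sum (t := Finset.univ)
    (w := fun _ : Ω => (Fintype.card Ω : ℝ)⁻¹) (p := X) (fun _ _ => by positivity)
    (by rw [Finset.sum_const, Finset.card_univ, nsmul_eq_mul, mul_inv_cancel₀ hc.ne'])
    (fun ω _ => hX ω)
  simp only [smul_eq_mul, ← Finset.mul_sum] at this
  rw [expect_eq, expect_eq, div_eq_inv_mul, div_eq_inv_mul]
  exact this

end Jensen

/-! ### Moments of the number of kernel vectors -/

section Moment

variable {F U : Type} [Field F] {m w : ℕ}

theorem rowBand_add (h₁ : U → Fin (m - w + 1)) (a b : U → Fin w → F) (u : U) (j : ℕ) :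
    rowBand h₁ (a + b) u j = rowBand h₁ a u j + rowBand h₁ b u j := by
  unfold rowBand
  split_ifs <;> simp

variable [Fintype F] [Fintype U] [DecidableEq U]

/-- If every column in `J` meets a band of the support of its coefficient vector, the corresponding
linear combinations of the rows vanish simultaneously on `J` with probability at most
`|F| ^ (-|J|)`. -/
theorem expect_columns_vanish_le (h₁ : U → Fin (m - w + 1)) (J : Finset ℕ) (y : ℕ → U → F)
    (hy : ∀ j ∈ J, ∃ u, y j u ≠ 0 ∧ (h₁ u : ℕ) ≤ j ∧ j < (h₁ u : ℕ) + w) :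
    (expect fun h₂ : U → Fin w → F => ind (∀ j ∈ J, ∑ u, y j u * rowBand h₁ h₂ u j = 0)) ≤
      ((Fintype.card F : ℝ) ^ J.card)⁻¹ := by
  classical
  rcases isEmpty_or_nonempty U with hU | hU
  · obtain rfl : J = ∅ := Finset.eq_empty_of_forall_notMem fun j hj => by
      obtain ⟨u, -⟩ := hy j hj
      exact hU.elim u
    simpa using (expect_mono fun _ => ind_le_one _).trans_eq
      (expect_const (Ω := U → Fin w → F) 1)
  choose! pick hp1 hp2 hp3 using hy
  -- The correction puts `t j` into the entry of `h₂` that lies in row `pick j` and column `j`.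
  -- These entries are distinct, so the column sums can be shifted independently.
  let corr : (J → F) → U → Fin w → F := fun t u i =>
    if hJ : (h₁ u : ℕ) + i ∈ J then if pick (h₁ u + i) = u then t ⟨_, hJ⟩ else 0 else 0
  have hcorr : ∀ (t : J → F) (j : J), ∑ u, y j u * rowBand h₁ (corr t) u j =
      y j (pick j) * t j := by
    intro t j
    rw [Finset.sum_eq_single (pick j)]
    · congr 1
      rw [rowBand, dif_pos ⟨hp2 j j.2, hp3 j j.2⟩]
      have hj : (h₁ (pick j) : ℕ) + (j - h₁ (pick j)) = j := Nat.add_sub_cancel' (hp2 j j.2)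
      simp only [corr, hj]
      rw [dif_pos j.2, if_pos trivial]
    · intro u _ hu
      rw [rowBand]
      split_ifs with hb
      · have hj : (h₁ u : ℕ) + (j - h₁ u) = j := Nat.add_sub_cancel' hb.1
        simp only [corr, hj]
        rw [dif_pos j.2, if_neg hu.symm, mul_zero]
      · rw [mul_zero]
    · simp
  set Z := Finset.univ.filter fun h₂ : U → Fin w → F =>
    ∀ j ∈ J, ∑ u, y j u * rowBand h₁ h₂ u j = 0 with hZ
  -- The translates of `Z` by the corrections are disjoint: the column sums reveal `t`.
  have hcard : Z.card * Fintype.card F ^ J.card ≤ Fintype.card (U → Fin w → F) := by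
    have h1 : Fintype.card F ^ J.card = (Finset.univ : Finset (J → F)).card := by
      rw [Finset.card_univ, Fintype.card_fun, Fintype.card_coe]
    rw [h1, ← Finset.card_product, ← Finset.card_univ]
    refine Finset.card_le_card_of_injOn (fun p => p.1 + corr p.2) (fun _ _ => Finset.mem_univ _) ?_
    rintro ⟨a, s⟩ ha ⟨b, t⟩ hb hab
    simp only [Finset.coe_product, Set.mem_prod, Finset.mem_coe, hZ, Finset.mem_filter,
      Finset.mem_univ, true_and] at ha hb
    have hst : s = t := by
      funext j
      have h2 : ∑ u, y j u * rowBand h₁ (a + corr s) u j =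
          ∑ u, y j u * rowBand h₁ (b + corr t) u j := by rw [show a + corr s = b + corr t from hab]
      simp only [rowBand_add, mul_add, Finset.sum_add_distrib, hcorr] at h2
      rw [ha.1 j j.2, hb.1 j j.2, zero_add, zero_add] at h2
      exact mul_left_cancel₀ (hp1 j j.2) h2
    subst hst
    exact Prod.ext (add_right_cancel hab) rfl
  have hF : (0 : ℝ) < Fintype.card F := by exact_mod_cast Fintype.card_pos
  have hall : (0 : ℝ) < Fintype.card (U → Fin w → F) := by exact_mod_cast Fintype.card_pos
  rw [expect_eq, sum_ind]
  rw [div_le_iff₀ hall, inv_mul_eq_div, le_div_iff₀ (by positivity)]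
  exact_mod_cast hcard

open Classical in
/-- The vectors that are supported on elements of `S` with bands starting in `B`, whose bands cover
the columns in `J`, and that annihilate these columns. -/
noncomputable def kernelVecs (S : Finset U) (h₁ : U → Fin (m - w + 1)) (h₂ : U → Fin w → F)
    (B J : Finset ℕ) : Finset (U → F) :=
  Finset.univ.filter fun y => (∀ u, y u ≠ 0 → u ∈ S ∧ (h₁ u : ℕ) ∈ B) ∧
    ∀ j ∈ J, (∃ u, y u ≠ 0 ∧ (h₁ u : ℕ) ≤ j ∧ j < (h₁ u : ℕ) + w) ∧
      ∑ u, y u * rowBand h₁ h₂ u j = 0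

open Classical in
theorem card_supported (T : Finset U) :
    (Finset.univ.filter fun y : U → F => ∀ u, y u ≠ 0 → u ∈ T).card =
      Fintype.card F ^ T.card := by
  have : (Finset.univ.filter fun y : U → F => ∀ u, y u ≠ 0 → u ∈ T) =
      Fintype.piFinset fun u => if u ∈ T then Finset.univ else {0} := by
    ext y
    simp only [Finset.mem_filter, Finset.mem_univ, true_and, Fintype.mem_piFinset]
    refine forall_congr' fun u => ?_
    by_cases hu : u ∈ T
    · simp [hu]
    · simp [hu]
  rw [this, Fintype.card_piFinset]
  have h2 : ∀ u, (if u ∈ T then (Finset.univ : Finset F) else {0}).card =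
      if u ∈ T then Fintype.card F else 1 := by
    intro u
    split_ifs <;> simp
  rw [Finset.prod_congr rfl fun c _ => h2 c, Finset.prod_ite_mem, Finset.univ_inter,
    Finset.prod_const]

variable {ι : Type} [Fintype ι]

/-- First moment of the number of tuples of vectors. Since the `J i` are disjoint, a tuple defines
one coefficient vector per column of their union, and `expect_columns_vanish_le` handles all the
conditions at once, even if the vectors share rows. -/
theorem expect_prod_card_kernelVecs_le (S : Finset U) (h₁ : U → Fin (m - w + 1))
    (B J : ι → Finset ℕ) (hJ : ∀ i i', i ≠ i' → Disjoint (J i) (J i')) :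
    (expect fun h₂ : U → Fin w → F => ∏ i, ((kernelVecs S h₁ h₂ (B i) (J i)).card : ℝ)) ≤
      ∏ i, (Fintype.card F : ℝ) ^ (S.filter fun u => (h₁ u : ℕ) ∈ B i).card *
        ((Fintype.card F : ℝ) ^ (J i).card)⁻¹ := by
  classical
  let V : ι → Finset (U → F) := fun i =>
    Finset.univ.filter fun y => ∀ u, y u ≠ 0 → u ∈ S.filter fun u => (h₁ u : ℕ) ∈ B i
  have hV : ∀ i, (V i).card = Fintype.card F ^ (S.filter fun u => (h₁ u : ℕ) ∈ B i).card :=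
    fun i => card_supported _
  have hcount : ∀ h₂ : U → Fin w → F, ∏ i, ((kernelVecs S h₁ h₂ (B i) (J i)).card : ℝ) =
      ∑ y ∈ Fintype.piFinset V, ind (∀ i, y i ∈ kernelVecs S h₁ h₂ (B i) (J i)) := by
    intro h₂
    rw [← Nat.cast_prod, ← Fintype.card_piFinset]
    rw [sum_ind]
    congr 2
    ext y
    simp only [Fintype.mem_piFinset, Finset.mem_filter]
    refine (and_iff_right_of_imp fun hy i => ?_).symm
    have := (Finset.mem_filter.1 (hy i)).2.1
    simpa [V] using this
  simp only [hcount, expect_sum]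
  have hone : ∀ y : ι → U → F, (expect fun h₂ : U → Fin w → F =>
      ind (∀ i, y i ∈ kernelVecs S h₁ h₂ (B i) (J i))) ≤
      ∏ i, ((Fintype.card F : ℝ) ^ (J i).card)⁻¹ := by
    intro y
    by_cases hcov : ∀ i, ∀ j ∈ J i, ∃ u, y i u ≠ 0 ∧ (h₁ u : ℕ) ≤ j ∧ j < (h₁ u : ℕ) + w
    · have hidx : ∀ j, ∃ z : U → F, ∀ i, j ∈ J i → z = y i := by
        intro j
        by_cases hj : ∃ i, j ∈ J i
        · obtain ⟨i, hi⟩ := hj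
          refine ⟨y i, fun i' hi' => ?_⟩
          by_contra hne
          exact Finset.disjoint_left.1 (hJ i i' fun h => hne (h ▸ rfl)) hi hi'
        · exact ⟨0, fun i hi => absurd ⟨i, hi⟩ hj⟩
      choose z hz using hidx
      have hb := expect_columns_vanish_le h₁ (Finset.univ.biUnion J) z (by
        intro j hj
        obtain ⟨i, -, hi⟩ := Finset.mem_biUnion.1 hj
        rw [hz j i hi]
        exact hcov i j hi)
      rw [Finset.card_biUnion fun i _ i' _ h => hJ i i' h, ← Finset.prod_pow_eq_pow_sum,
        ← Finset.prod_inv_distrib] at hb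
      refine (expect_mono fun h₂ => ind_mono fun hy j hj => ?_).trans hb
      obtain ⟨i, -, hi⟩ := Finset.mem_biUnion.1 hj
      rw [hz j i hi]
      exact ((Finset.mem_filter.1 (hy i)).2.2 j hi).2
    · have : ∀ h₂ : U → Fin w → F, ind (∀ i, y i ∈ kernelVecs S h₁ h₂ (B i) (J i)) = 0 := by
        intro h₂
        refine ind_of_not fun hy => hcov fun i j hj => ?_
        exact ((Finset.mem_filter.1 (hy i)).2.2 j hj).1
      simp only [this, expect_const]
      positivity
  refine (Finset.sum_le_sum fun y _ => hone y).trans ?_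
  rw [Finset.sum_const, nsmul_eq_mul, Fintype.card_piFinset, Finset.prod_mul_distrib]
  simp only [hV]
  push_cast
  exact le_rfl

/-- The starts are independent and uniform, so the moment generating function of the number of
starts in the union `T` of the `B i` is at most `exp ((exp θ - 1) |S| |T| / (m - w + 1))`. The
hypothesis `hload` says that the load leaves the margin `η`. -/
theorem expect_exp_starts_le (S : Finset U) (B : ι → Finset ℕ)
    (hB : ∀ i i', i ≠ i' → Disjoint (B i) (B i')) {θ η : ℝ} (hθ : 0 ≤ θ)
    (hload : S.card * (Real.exp θ - 1) ≤ (θ - η) * ((m - w + 1 : ℕ) : ℝ)) :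
    (expect fun h₁ : U → Fin (m - w + 1) =>
      Real.exp (θ * ∑ i, ((S.filter fun u => (h₁ u : ℕ) ∈ B i).card : ℝ))) ≤
      Real.exp ((θ - η) * ∑ i, ((B i).card : ℝ)) := by
  classical
  set T := Finset.univ.biUnion B with hT
  have hM : (0 : ℝ) < ((m - w + 1 : ℕ) : ℝ) := by positivity
  have hexp : 0 ≤ Real.exp θ - 1 := by
    have := Real.add_one_le_exp θ
    linarith
  have hsum : ∀ h₁ : U → Fin (m - w + 1),
      Real.exp (θ * ∑ i, ((S.filter fun u => (h₁ u : ℕ) ∈ B i).card : ℝ)) =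
      ∏ u, if u ∈ S ∧ (h₁ u : ℕ) ∈ T then Real.exp θ else 1 := by
    intro h₁
    have h1 : ∑ i, (S.filter fun u => (h₁ u : ℕ) ∈ B i).card =
        (S.filter fun u => (h₁ u : ℕ) ∈ T).card := by
      rw [← Finset.card_biUnion]
      · congr 1
        ext u
        simp [hT]
      · intro i _ i' _ hne
        refine Finset.disjoint_filter.2 fun u _ h h' => ?_
        exact Finset.disjoint_left.1 (hB i i' hne) h h'
    rw [← Nat.cast_sum, h1, mul_comm, Real.exp_nat_mul, ← Finset.prod_const, Finset.prod_filter,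
      ← Finset.univ_inter S, ← Finset.prod_ite_mem]
    simp only [Finset.univ_inter, ite_and]
  simp only [hsum]
  rw [expect_pi fun u (a : Fin (m - w + 1)) => if u ∈ S ∧ (a : ℕ) ∈ T then Real.exp θ else 1]
  have hone : ∀ u, (expect fun a : Fin (m - w + 1) =>
      if u ∈ S ∧ (a : ℕ) ∈ T then Real.exp θ else 1) ≤
      if u ∈ S then Real.exp ((Real.exp θ - 1) * T.card / ((m - w + 1 : ℕ) : ℝ)) else 1 := by
    intro u
    by_cases hu : u ∈ S
    · have h2 : ∀ a : Fin (m - w + 1), (if u ∈ S ∧ (a : ℕ) ∈ T then Real.exp θ else 1) =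
          1 + (Real.exp θ - 1) * ind ((a : ℕ) ∈ T) := by
        intro a
        by_cases ha : (a : ℕ) ∈ T <;> simp [hu, ha, ind]
      have h3 : (expect fun a : Fin (m - w + 1) => ind ((a : ℕ) ∈ T)) ≤
          T.card / ((m - w + 1 : ℕ) : ℝ) := by
        rw [expect_eq, Fintype.card_fin]
        gcongr
        rw [sum_ind]
        have := Finset.card_le_card_of_injOn (s := Finset.univ.filter
          fun a : Fin (m - w + 1) => (a : ℕ) ∈ T) (t := T) (fun a => (a : ℕ))
          (fun a ha => (Finset.mem_filter.1 ha).2) (fun a _ b _ hab => Fin.ext hab)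
        exact_mod_cast this
      rw [if_pos hu]
      simp only [h2, expect_add, expect_const, expect_mul_left]
      refine le_trans ?_ (Real.add_one_le_exp _)
      rw [add_comm, mul_div_assoc]
      gcongr
    · simp [hu, expect_const]
  have hnn : ∀ u, 0 ≤ expect fun a : Fin (m - w + 1) =>
      if u ∈ S ∧ (a : ℕ) ∈ T then Real.exp θ else (1 : ℝ) := fun u => expect_nonneg fun a => by
    split_ifs <;> positivity
  refine (Finset.prod_le_prod (fun u _ => hnn u) fun u _ => hone u).trans ?_
  rw [Finset.prod_ite_mem, Finset.univ_inter, Finset.prod_const, ← Real.exp_nat_mul,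
    ← Nat.cast_sum, ← Finset.card_biUnion fun i _ i' _ h => hB i i' h]
  refine Real.exp_le_exp.2 ?_
  rw [← mul_div_assoc, div_le_iff₀ hM]
  have : (0 : ℝ) ≤ T.card := Nat.cast_nonneg _
  nlinarith [mul_le_mul_of_nonneg_right hload this]

/-- Jensen over `h₂` for fixed starts turns the first moment into `exp (θ (starts - columns))`; the
average over `h₁` then replaces `θ` times the number of starts by `θ - η` times the number of
starting columns. -/
theorem expect_prod_rpow_le (S : Finset U) (B J : ι → Finset ℕ)
    (hB : ∀ i i', i ≠ i' → Disjoint (B i) (B i'))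
    (hJ : ∀ i i', i ≠ i' → Disjoint (J i) (J i')) {θ η ρ : ℝ} (hρ0 : 0 ≤ ρ) (hρ1 : ρ ≤ 1)
    (hθ : θ = ρ * Real.log (Fintype.card F))
    (hload : S.card * (Real.exp θ - 1) ≤ (θ - η) * ((m - w + 1 : ℕ) : ℝ)) :
    (expect fun h₁ : U → Fin (m - w + 1) => expect fun h₂ : U → Fin w → F =>
      ∏ i, ((kernelVecs S h₁ h₂ (B i) (J i)).card : ℝ) ^ ρ) ≤
      ∏ i, Real.exp ((θ - η) * (B i).card - θ * (J i).card) := by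
  classical
  have hq := one_lt_card_real (F := F)
  have hq0 : (0 : ℝ) < Fintype.card F := by linarith
  have hlog : 0 ≤ Real.log (Fintype.card F) := Real.log_nonneg hq.le
  have hθ0 : 0 ≤ θ := hθ ▸ mul_nonneg hρ0 hlog
  have hpow : ∀ n : ℕ, ((Fintype.card F : ℝ) ^ n) ^ ρ = Real.exp (θ * n) := by
    intro n
    rw [← Real.rpow_natCast, ← Real.rpow_mul hq0.le, Real.rpow_def_of_pos hq0, hθ]
    congr 1
    ring
  have hstep : ∀ h₁ : U → Fin (m - w + 1), (expect fun h₂ : U → Fin w → F =>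
      ∏ i, ((kernelVecs S h₁ h₂ (B i) (J i)).card : ℝ) ^ ρ) ≤
      Real.exp (-(θ * ∑ i, ((J i).card : ℝ))) *
        Real.exp (θ * ∑ i, ((S.filter fun u => (h₁ u : ℕ) ∈ B i).card : ℝ)) := by
    intro h₁
    have h1 : ∀ h₂ : U → Fin w → F, ∏ i, ((kernelVecs S h₁ h₂ (B i) (J i)).card : ℝ) ^ ρ =
        (∏ i, ((kernelVecs S h₁ h₂ (B i) (J i)).card : ℝ)) ^ ρ := fun h₂ =>
      Real.finsetProd_rpow _ _ (fun i _ => Nat.cast_nonneg _) ρ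
    simp only [h1]
    refine (expect_rpow_le (fun h₂ => Finset.prod_nonneg fun i _ => Nat.cast_nonneg _)
      hρ0 hρ1).trans ?_
    refine (Real.rpow_le_rpow
      (expect_nonneg fun h₂ => Finset.prod_nonneg fun i _ => Nat.cast_nonneg _)
      (expect_prod_card_kernelVecs_le S h₁ B J hJ) hρ0).trans_eq ?_
    rw [← Real.finsetProd_rpow _ _ (fun i _ => by positivity)]
    simp only [Real.mul_rpow (pow_nonneg hq0.le _) (inv_nonneg.2 (pow_nonneg hq0.le _)),
      Real.inv_rpow (pow_nonneg hq0.le _), hpow]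
    rw [Finset.prod_mul_distrib, Finset.prod_inv_distrib, ← Real.exp_sum, ← Real.exp_sum,
      ← Real.exp_neg, ← Finset.mul_sum, ← Finset.mul_sum, mul_comm]
  refine (expect_mono hstep).trans ?_
  rw [expect_mul_left]
  refine (mul_le_mul_of_nonneg_left (expect_exp_starts_le S B hB hθ0 hload)
    (Real.exp_nonneg _)).trans_eq ?_
  rw [← Real.exp_add, ← Real.exp_sum, Finset.sum_sub_distrib, ← Finset.mul_sum, ← Finset.mul_sum]
  congr 1
  ring

end Moment

/-! ### Dependencies and kernel vectors occupy intervals -/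

section Dependencies

variable {F U : Type} [Field F] [Fintype U] {m w : ℕ}

/-- The column `j` is met by a band of the support of `y`. -/
def Covers (h₁ : U → Fin (m - w + 1)) (y : U → F) (j : ℕ) : Prop :=
  ∃ u, y u ≠ 0 ∧ (h₁ u : ℕ) ≤ j ∧ j < (h₁ u : ℕ) + w

/-- The part of `y` on the bands that start before column `e`. -/
def cut {F U : Type} [Field F] {m w : ℕ} (h₁ : U → Fin (m - w + 1)) (y : U → F) (e : ℕ) (u : U) : F :=
  if (h₁ u : ℕ) < e then y u else 0

theorem cut_ne_zero {F U : Type} [Field F] {m w : ℕ} {h₁ : U → Fin (m - w + 1)} {y : U → F} {e : ℕ} {u : U} :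
    cut h₁ y e u ≠ 0 ↔ (h₁ u : ℕ) < e ∧ y u ≠ 0 := by
  simp [cut]

theorem sum_cut_of_lt (h₁ : U → Fin (m - w + 1)) (h₂ : U → Fin w → F) (y : U → F) {e j : ℕ}
    (hj : j < e) :
    ∑ u, cut h₁ y e u * rowBand h₁ h₂ u j = ∑ u, y u * rowBand h₁ h₂ u j := by
  refine Finset.sum_congr rfl fun u _ => ?_
  by_cases hu : (h₁ u : ℕ) < e
  · rw [cut, if_pos hu]
  · rw [rowBand_eq_zero h₁ h₂ (by omega), mul_zero, mul_zero]

/-- No band of the support crosses an uncovered column, so the bands that start before it also end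
before it. -/
theorem sum_cut_of_le {h₁ : U → Fin (m - w + 1)} (h₂ : U → Fin w → F) {y : U → F} {e j : ℕ}
    (he : ¬ Covers h₁ y e) (hj : e ≤ j) :
    ∑ u, cut h₁ y e u * rowBand h₁ h₂ u j = 0 := by
  refine Finset.sum_eq_zero fun u _ => ?_
  by_cases hu : cut h₁ y e u = 0
  · rw [hu, zero_mul]
  · obtain ⟨h1, h2⟩ := cut_ne_zero.1 hu
    have : ¬ ((h₁ u : ℕ) ≤ e ∧ e < (h₁ u : ℕ) + w) := fun h => he ⟨u, h2, h⟩
    rw [rowBand_eq_zero h₁ h₂ (by omega), mul_zero]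

theorem exists_min_start {h₁ : U → Fin (m - w + 1)} {y : U → F} (hy : ∃ u, y u ≠ 0) :
    ∃ u, y u ≠ 0 ∧ ∀ v, y v ≠ 0 → (h₁ u : ℕ) ≤ h₁ v := by
  classical
  obtain ⟨u, hu, hmin⟩ := Finset.exists_min_image (Finset.univ.filter fun u => y u ≠ 0)
    (fun u => (h₁ u : ℕ)) (by
      obtain ⟨u, hu⟩ := hy
      exact ⟨u, by simpa using hu⟩)
  exact ⟨u, by simpa using hu, fun v hv => hmin v (by simpa using hv)⟩

theorem indepRows_iff {h₁ : U → Fin (m - w + 1)} {h₂ : U → Fin w → F} {S : Finset U} :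
    IndepRows h₁ h₂ S ↔ ∀ y : U → F, (∀ u, y u ≠ 0 → u ∈ S) →
      (∀ j, ∑ u, y u * rowBand h₁ h₂ u j = 0) → ∀ u, y u = 0 := by
  classical
  rw [IndepRows, linearIndepOn_finset_iff]
  constructor
  · intro h y hy hsum u
    by_contra hu
    refine hu (h y ?_ u (hy u hu))
    funext j
    rw [Finset.sum_apply]
    refine (Finset.sum_subset (Finset.subset_univ S) fun v _ hv => ?_).trans (hsum j)
    have : y v = 0 := by
      by_contra h0
      exact hv (hy v h0)
    simp [this]
  · intro h f hf u hu
    have := h (fun u => if u ∈ S then f u else 0) (fun u hu => by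
      by_contra h0
      simp [h0] at hu) (fun j => by
      simp only [ite_mul, zero_mul]
      rw [Finset.sum_ite_mem, Finset.univ_inter]
      have := congrFun hf j
      simpa [Finset.sum_apply] using this) u
    simpa [hu] using this

variable [Fintype F] [DecidableEq U]

theorem mem_kernelVecs {S : Finset U} {h₁ : U → Fin (m - w + 1)} {h₂ : U → Fin w → F}
    {B J : Finset ℕ} {y : U → F} :
    y ∈ kernelVecs S h₁ h₂ B J ↔ (∀ u, y u ≠ 0 → u ∈ S ∧ (h₁ u : ℕ) ∈ B) ∧
      ∀ j ∈ J, Covers h₁ y j ∧ ∑ u, y u * rowBand h₁ h₂ u j = 0 := by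
  simp [kernelVecs, Covers]

/-- Start at the first band of a dependency and cut at the first uncovered column `e`. The bands
kept end by `e`, so they start before `c = e + 1 - w`, while they cover all of `[a, e) = [a, c + w -
1)`: the number of columns exceeds that of possible starts by `w - 1`. -/
theorem exists_kernelVecs_of_not_indep (hw : 1 ≤ w) (hwm : w ≤ m) {S : Finset U}
    {h₁ : U → Fin (m - w + 1)} {h₂ : U → Fin w → F} (hdep : ¬ IndepRows h₁ h₂ S) :
    ∃ a < m, ∃ c ≤ m, a ≤ c ∧
      (kernelVecs S h₁ h₂ (Finset.Ico a c) (Finset.Ico a (c + w - 1))).Nonempty := by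
  classical
  rw [indepRows_iff] at hdep
  push Not at hdep
  obtain ⟨y, hS, hsum, hne⟩ := hdep
  obtain ⟨u, hu, hmin⟩ := exists_min_start (h₁ := h₁) hne
  have hex : ∃ e, (h₁ u : ℕ) ≤ e ∧ ¬ Covers h₁ y e := by
    refine ⟨m, by have := (h₁ u).2; omega, ?_⟩
    rintro ⟨v, -, -, hv⟩
    have := (h₁ v).2
    omega
  obtain ⟨he1, he2⟩ := Nat.find_spec hex
  have hlt : ∀ j, (h₁ u : ℕ) ≤ j → j < Nat.find hex → Covers h₁ y j := by
    intro j hj1 hj2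
    by_contra h
    exact Nat.find_min hex hj2 ⟨hj1, h⟩
  have hem : Nat.find hex ≤ m := Nat.find_min' hex (by
    refine ⟨by have := (h₁ u).2; omega, ?_⟩
    rintro ⟨v, -, -, hv⟩
    have := (h₁ v).2
    omega)
  set e := Nat.find hex
  have hend : ∀ v, y v ≠ 0 → (h₁ v : ℕ) < e → (h₁ v : ℕ) + w ≤ e := by
    intro v hv hve
    by_contra h
    exact he2 ⟨v, hv, by omega, by omega⟩
  have hue : (h₁ u : ℕ) < e := by
    by_contra h
    exact he2 ⟨u, hu, by omega, by omega⟩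
  have huw := hend u hu hue
  refine ⟨h₁ u, by omega, e + 1 - w, by omega, by omega, cut h₁ y e, ?_⟩
  rw [mem_kernelVecs]
  refine ⟨fun v hv => ?_, fun j hj => ?_⟩
  · obtain ⟨hv1, hv2⟩ := cut_ne_zero.1 hv
    have h1 := hmin v hv2
    have h2 := hend v hv2 hv1
    refine ⟨hS v hv2, ?_⟩
    rw [Finset.mem_Ico]
    omega
  · rw [Finset.mem_Ico] at hj
    obtain ⟨v, hv1, hv2, hv3⟩ := hlt j hj.1 (by omega)
    refine ⟨⟨v, cut_ne_zero.2 ⟨by omega, hv1⟩, hv2, hv3⟩, ?_⟩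
    rw [sum_cut_of_lt _ _ _ (by omega), hsum]

/-- A column left uncovered between the first start and `c` would let the vector be cut there into a
full linear dependency, which independence excludes. -/
theorem exists_mem_kernelVecs_of_mem_truncKer (hw : 1 ≤ w) {S : Finset U}
    {h₁ : U → Fin (m - w + 1)} {h₂ : U → Fin w → F} (hind : IndepRows h₁ h₂ S) {c : ℕ}
    {y : U → F} (hy : y ∈ truncKer S (fun u => (h₁ u : ℕ)) (rowBand h₁ h₂) c) :
    ∃ a ≤ c + 1, y ∈ kernelVecs S h₁ h₂ (Finset.Ico a (c + 1)) (Finset.Ico a (c + 1)) := by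
  rw [mem_truncKer] at hy
  by_cases hne : ∃ u, y u ≠ 0
  · obtain ⟨u, hu, hmin⟩ := exists_min_start (h₁ := h₁) hne
    have huc := (hy.1 u hu).2
    refine ⟨h₁ u, by omega, ?_⟩
    rw [mem_kernelVecs]
    refine ⟨fun v hv => ⟨(hy.1 v hv).1, ?_⟩, fun j hj => ?_⟩
    · have h1 := hmin v hv
      have h2 := (hy.1 v hv).2
      rw [Finset.mem_Ico]
      omega
    · rw [Finset.mem_Ico] at hj
      refine ⟨?_, hy.2 j (by omega)⟩
      by_contra hcov
      have huj : (h₁ u : ℕ) < j := by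
        by_contra h
        exact hcov ⟨u, hu, by omega, by omega⟩
      refine cut_ne_zero.2 ⟨huj, hu⟩ (indepRows_iff.1 hind (cut h₁ y j)
        (fun v hv => (hy.1 v (cut_ne_zero.1 hv).2).1) (fun i => ?_) u)
      by_cases hi : i < j
      · rw [sum_cut_of_lt _ _ _ hi, hy.2 i (by omega)]
      · exact sum_cut_of_le h₂ hcov (not_lt.1 hi)
  · push Not at hne
    -- The zero vector is assigned to the empty interval.
    refine ⟨c + 1, le_rfl, ?_⟩
    rw [mem_kernelVecs]
    simp [hne]

/-- The left-hand side counts the vectors of the truncated kernel; classify them by the first column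
they occupy. -/
theorem card_pow_finrank_le (hw : 1 ≤ w) {S : Finset U} {h₁ : U → Fin (m - w + 1)}
    {h₂ : U → Fin w → F} (hind : IndepRows h₁ h₂ S) (c : ℕ) :
    Fintype.card F ^ Module.finrank F (truncKer S (fun u => (h₁ u : ℕ)) (rowBand h₁ h₂) c) ≤
      ∑ a ∈ Finset.range (c + 2),
        (kernelVecs S h₁ h₂ (Finset.Ico a (c + 1)) (Finset.Ico a (c + 1))).card := by
  classical
  rw [← Nat.card_eq_fintype_card, ← Module.natCard_eq_pow_finrank (K := F)]
  refine le_trans ?_ Finset.card_biUnion_le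
  rw [← Set.ncard_coe_finset]
  refine Set.ncard_le_ncard (fun y hy => ?_) (Finset.finite_toSet _)
  obtain ⟨a, ha, hya⟩ := exists_mem_kernelVecs_of_mem_truncKer hw hind hy
  exact Finset.mem_coe.2 (Finset.mem_biUnion.2 ⟨a, Finset.mem_range.2 (by omega), hya⟩)

end Dependencies

theorem rpow_sum_le_sum_rpow {ι : Type} (s : Finset ι) (f : ι → ℕ) {ρ : ℝ} (h0 : 0 < ρ)
    (h1 : ρ ≤ 1) : ((∑ i ∈ s, f i : ℕ) : ℝ) ^ ρ ≤ ∑ i ∈ s, (f i : ℝ) ^ ρ := by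
  have := Finset.le_sum_of_subadditive (fun x : NNReal => x ^ ρ) (by simp [h0.ne'])
    (fun x y => NNReal.rpow_add_le_add_rpow x y h0.le h1) s fun i => (f i : NNReal)
  have h2 := NNReal.coe_le_coe.2 this
  push_cast at h2 ⊢
  exact h2

/-! ### Failure probability, mean and tail of the backlog -/

section Tail

variable {F U : Type} [Field F] [Fintype F] [Fintype U] [DecidableEq U] {m w : ℕ}

/-- The dimension of the left kernel of the columns up to `c`, which bounds the number of bands
that wait for a pivot at column `c`. -/
noncomputable def backlog (S : Finset U)
    (p : (U → Fin (m - w + 1)) × (U → Fin w → F)) (c : ℕ) : ℕ :=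
  Module.finrank F (truncKer S (fun u => (p.1 u : ℕ)) (rowBand p.1 p.2) c)

/-- The number of vectors that occupy exactly the columns from `a` to `e - 1`. -/
noncomputable def spanCount (S : Finset U) (p : (U → Fin (m - w + 1)) × (U → Fin w → F))
    (a e : ℕ) : ℕ :=
  (kernelVecs S p.1 p.2 (Finset.Ico a e) (Finset.Ico a e)).card

variable {S : Finset U} {θ η ρ : ℝ}

theorem expect_prod_spanCount_le {ι : Type} [Fintype ι] (hρ0 : 0 ≤ ρ) (hρ1 : ρ ≤ 1)
    (hθ : θ = ρ * Real.log (Fintype.card F))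
    (hload : S.card * (Real.exp θ - 1) ≤ (θ - η) * ((m - w + 1 : ℕ) : ℝ)) (a e : ι → ℕ)
    (hdisj : ∀ i i', i ≠ i' → Disjoint (Finset.Ico (a i) (e i)) (Finset.Ico (a i') (e i'))) :
    (expect fun p : (U → Fin (m - w + 1)) × (U → Fin w → F) =>
      ∏ i, (spanCount S p (a i) (e i) : ℝ) ^ ρ) ≤
      ∏ i, Real.exp (-(η * ((e i - a i : ℕ) : ℝ))) := by
  rw [expect_prod]
  refine (expect_prod_rpow_le S (fun i => Finset.Ico (a i) (e i))
    (fun i => Finset.Ico (a i) (e i)) hdisj hdisj hρ0 hρ1 hθ hload).trans_eq ?_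
  refine Finset.prod_congr rfl fun i _ => ?_
  rw [Nat.card_Ico]
  congr 1
  ring

theorem expect_spanCount_le (hρ0 : 0 ≤ ρ) (hρ1 : ρ ≤ 1)
    (hθ : θ = ρ * Real.log (Fintype.card F))
    (hload : S.card * (Real.exp θ - 1) ≤ (θ - η) * ((m - w + 1 : ℕ) : ℝ)) (a e : ℕ) :
    (expect fun p : (U → Fin (m - w + 1)) × (U → Fin w → F) => (spanCount S p a e : ℝ) ^ ρ) ≤
      Real.exp (-(η * ((e - a : ℕ) : ℝ))) := by
  have := expect_prod_spanCount_le (ι := Unit) hρ0 hρ1 hθ hload (fun _ => a) (fun _ => e)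
    (fun i i' h => absurd rfl h)
  simpa using this

theorem ind_pos_le_rpow (hρ0 : 0 ≤ ρ) (n : ℕ) : ind (0 < n) ≤ (n : ℝ) ^ ρ := by
  by_cases h : 0 < n
  · rw [ind_of h]
    exact Real.one_le_rpow (by exact_mod_cast h) hρ0
  · rw [ind_of_not h]
    positivity

theorem ind_exists_le {ι : Type} (s : Finset ι) (p : ι → Prop) :
    ind (∃ i ∈ s, p i) ≤ ∑ i ∈ s, ind (p i) := by
  by_cases h : ∃ i ∈ s, p i
  · obtain ⟨i, hi, hp⟩ := h
    rw [ind_of ⟨i, hi, hp⟩, ← ind_of hp]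
    exact Finset.single_le_sum (f := fun i => ind (p i)) (fun _ _ => ind_nonneg _) hi
  · rw [ind_of_not h]
    exact Finset.sum_nonneg fun _ _ => ind_nonneg _

/-- Union bound over the pairs `(a, c)`. Each term is at most `exp (-η (c - a) - θ (w - 1))`, of
which only the second factor is retained. -/
theorem expect_not_indep_le (hw : 1 ≤ w) (hwm : w ≤ m) (hρ0 : 0 ≤ ρ) (hρ1 : ρ ≤ 1) (hη : 0 ≤ η)
    (hθ : θ = ρ * Real.log (Fintype.card F))
    (hload : S.card * (Real.exp θ - 1) ≤ (θ - η) * ((m - w + 1 : ℕ) : ℝ)) :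
    (expect fun p : (U → Fin (m - w + 1)) × (U → Fin w → F) => ind (¬ IndepRows p.1 p.2 S)) ≤
      m * (m + 1) * Real.exp (-(θ * (w - 1))) := by
  have h1 : ∀ p : (U → Fin (m - w + 1)) × (U → Fin w → F), ind (¬ IndepRows p.1 p.2 S) ≤
      ∑ x ∈ (Finset.range m ×ˢ Finset.range (m + 1)).filter fun x => x.1 ≤ x.2,
        ((kernelVecs S p.1 p.2 (Finset.Ico x.1 x.2)
          (Finset.Ico x.1 (x.2 + w - 1))).card : ℝ) ^ ρ := by
    intro p
    refine (ind_mono (q := ∃ x ∈ (Finset.range m ×ˢ Finset.range (m + 1)).filter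
      (fun x => x.1 ≤ x.2), 0 < (kernelVecs S p.1 p.2 (Finset.Ico x.1 x.2)
        (Finset.Ico x.1 (x.2 + w - 1))).card) fun h => ?_).trans ((ind_exists_le _ _).trans
        (Finset.sum_le_sum fun x _ => ind_pos_le_rpow hρ0 _))
    obtain ⟨a, ha, c, hc, hac, hne⟩ := exists_kernelVecs_of_not_indep hw hwm h
    refine ⟨(a, c), ?_, Finset.card_pos.2 hne⟩
    simp only [Finset.mem_filter, Finset.mem_product, Finset.mem_range]
    omega
  refine (expect_mono h1).trans ?_
  rw [expect_sum]
  have h2 : ∀ x ∈ (Finset.range m ×ˢ Finset.range (m + 1)).filter (fun x => x.1 ≤ x.2),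
      (expect fun p : (U → Fin (m - w + 1)) × (U → Fin w → F) =>
        ((kernelVecs S p.1 p.2 (Finset.Ico x.1 x.2)
          (Finset.Ico x.1 (x.2 + w - 1))).card : ℝ) ^ ρ) ≤ Real.exp (-(θ * (w - 1))) := by
    intro x hx
    have hx2 := (Finset.mem_filter.1 hx).2
    rw [expect_prod]
    have := expect_prod_rpow_le (ι := Unit) S (fun _ => Finset.Ico x.1 x.2)
      (fun _ => Finset.Ico x.1 (x.2 + w - 1)) (fun i i' h => absurd rfl h)
      (fun i i' h => absurd rfl h) hρ0 hρ1 hθ hload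
    simp only [Finset.univ_unique, Finset.prod_singleton, Nat.card_Ico] at this
    refine this.trans (Real.exp_le_exp.2 ?_)
    have e1 : ((x.2 + w - 1 - x.1 : ℕ) : ℝ) = ((x.2 - x.1 : ℕ) : ℝ) + (w - 1) := by
      rw [show x.2 + w - 1 - x.1 = (x.2 - x.1) + (w - 1) by omega]
      push_cast [hw]
      ring
    rw [e1]
    have e2 : (0 : ℝ) ≤ ((x.2 - x.1 : ℕ) : ℝ) := Nat.cast_nonneg _
    nlinarith
  refine (Finset.sum_le_sum h2).trans ?_
  rw [Finset.sum_const, nsmul_eq_mul]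
  refine mul_le_mul_of_nonneg_right ?_ (Real.exp_nonneg _)
  have := Finset.card_filter_le (Finset.range m ×ˢ Finset.range (m + 1)) fun x => x.1 ≤ x.2
  rw [Finset.card_product, Finset.card_range, Finset.card_range] at this
  exact_mod_cast this

/-- Some vector occupies at least `w` consecutive columns. -/
def HasLongSpan (S : Finset U) (p : (U → Fin (m - w + 1)) × (U → Fin w → F)) : Prop :=
  ∃ e ≤ 2 * m, ∃ a, a + w ≤ e ∧ 0 < spanCount S p a e

/-- A span of length at least `w` costs `exp (-η w)`. Spans may end as late as `2 m`, because the
residue classes used for the tail overshoot `m`. -/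
theorem expect_hasLongSpan_le (hρ0 : 0 ≤ ρ) (hρ1 : ρ ≤ 1) (hη : 0 ≤ η)
    (hθ : θ = ρ * Real.log (Fintype.card F))
    (hload : S.card * (Real.exp θ - 1) ≤ (θ - η) * ((m - w + 1 : ℕ) : ℝ)) :
    (expect fun p : (U → Fin (m - w + 1)) × (U → Fin w → F) => ind (HasLongSpan S p)) ≤
      (2 * m + 1) * (2 * m + 1) * Real.exp (-(η * w)) := by
  have h1 : ∀ p : (U → Fin (m - w + 1)) × (U → Fin w → F), ind (HasLongSpan S p) ≤
      ∑ x ∈ (Finset.range (2 * m + 1) ×ˢ Finset.range (2 * m + 1)).filter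
        fun x => x.1 + w ≤ x.2, (spanCount S p x.1 x.2 : ℝ) ^ ρ := by
    intro p
    refine (ind_mono (q := ∃ x ∈ (Finset.range (2 * m + 1) ×ˢ Finset.range (2 * m + 1)).filter
      (fun x => x.1 + w ≤ x.2), 0 < spanCount S p x.1 x.2) fun h => ?_).trans
        ((ind_exists_le _ _).trans (Finset.sum_le_sum fun x _ => ind_pos_le_rpow hρ0 _))
    obtain ⟨e, he, a, hae, hpos⟩ := h
    refine ⟨(a, e), ?_, hpos⟩
    simp only [Finset.mem_filter, Finset.mem_product, Finset.mem_range]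
    omega
  refine (expect_mono h1).trans ?_
  rw [expect_sum]
  have h2 : ∀ x ∈ (Finset.range (2 * m + 1) ×ˢ Finset.range (2 * m + 1)).filter
      (fun x => x.1 + w ≤ x.2), (expect fun p : (U → Fin (m - w + 1)) × (U → Fin w → F) =>
        (spanCount S p x.1 x.2 : ℝ) ^ ρ) ≤ Real.exp (-(η * w)) := by
    intro x hx
    have hx2 := (Finset.mem_filter.1 hx).2
    refine (expect_spanCount_le hρ0 hρ1 hθ hload _ _).trans (Real.exp_le_exp.2 ?_)
    have : (w : ℝ) ≤ ((x.2 - x.1 : ℕ) : ℝ) := by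
      exact_mod_cast (by omega : w ≤ x.2 - x.1)
    nlinarith
  refine (Finset.sum_le_sum h2).trans ?_
  rw [Finset.sum_const, nsmul_eq_mul]
  refine mul_le_mul_of_nonneg_right ?_ (Real.exp_nonneg _)
  have := Finset.card_filter_le (Finset.range (2 * m + 1) ×ˢ Finset.range (2 * m + 1))
    fun x => x.1 + w ≤ x.2
  rw [Finset.card_product, Finset.card_range] at this
  exact_mod_cast this

/-- The left side is the `ρ`-th power of the number of kernel vectors, and `x ^ ρ` is subadditive
for `ρ ≤ 1`. -/
theorem exp_backlog_le (hw : 1 ≤ w) (hρ0 : 0 < ρ) (hρ1 : ρ ≤ 1)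
    (hθ : θ = ρ * Real.log (Fintype.card F))
    {p : (U → Fin (m - w + 1)) × (U → Fin w → F)} (hind : IndepRows p.1 p.2 S) (c : ℕ) :
    Real.exp (θ * backlog S p c) ≤
      ∑ a ∈ Finset.range (c + 2), (spanCount S p a (c + 1) : ℝ) ^ ρ := by
  have hq := one_lt_card_real (F := F)
  have h1 : Real.exp (θ * backlog S p c) =
      ((Fintype.card F ^ backlog S p c : ℕ) : ℝ) ^ ρ := by
    rw [Nat.cast_pow, ← Real.rpow_natCast, ← Real.rpow_mul (by linarith),
      Real.rpow_def_of_pos (by linarith), hθ]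
    congr 1
    ring
  rw [h1]
  refine le_trans (Real.rpow_le_rpow (Nat.cast_nonneg _) ?_ hρ0.le)
    (rpow_sum_le_sum_rpow _ _ hρ0 hρ1)
  exact_mod_cast card_pow_finrank_le hw hind c

theorem exp_backlog_le_of_not_hasLongSpan (hw : 1 ≤ w) (hρ0 : 0 < ρ) (hρ1 : ρ ≤ 1)
    (hθ : θ = ρ * Real.log (Fintype.card F))
    {p : (U → Fin (m - w + 1)) × (U → Fin w → F)} (hind : IndepRows p.1 p.2 S)
    (hlong : ¬ HasLongSpan S p) {c : ℕ} (hc : c + 1 ≤ 2 * m) :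
    Real.exp (θ * backlog S p c) ≤
      ∑ a ∈ Finset.Icc (c + 2 - w) (c + 1), (spanCount S p a (c + 1) : ℝ) ^ ρ := by
  refine (exp_backlog_le hw hρ0 hρ1 hθ hind c).trans_eq (Finset.sum_subset ?_ ?_).symm
  · intro a ha
    simp only [Finset.mem_Icc, Finset.mem_range] at ha ⊢
    omega
  · intro a ha1 ha2
    simp only [Finset.mem_Icc, Finset.mem_range] at ha1 ha2
    have : spanCount S p a (c + 1) = 0 := by
      by_contra h
      exact hlong ⟨c + 1, hc, a, by omega, Nat.pos_of_ne_zero h⟩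
    rw [this, Nat.cast_zero, Real.zero_rpow hρ0.ne']

theorem sum_exp_neg_le (hη : 0 < η) (e : ℕ) (s : Finset ℕ) (hs : s ⊆ Finset.range (e + 1)) :
    ∑ a ∈ s, Real.exp (-(η * ((e - a : ℕ) : ℝ))) ≤ (1 - Real.exp (-η))⁻¹ := by
  have h1 : Real.exp (-η) < 1 := Real.exp_lt_one_iff.2 (by linarith)
  refine (Finset.sum_le_sum_of_subset_of_nonneg hs fun _ _ _ => Real.exp_nonneg _).trans ?_
  have h2 := Finset.sum_range_reflect (fun i => Real.exp (-(η * (i : ℝ)))) (e + 1)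
  simp only [Nat.add_sub_cancel] at h2
  rw [h2]
  have h3 : ∀ i : ℕ, Real.exp (-(η * (i : ℝ))) = Real.exp (-η) ^ i := by
    intro i
    rw [← Real.exp_nat_mul]
    congr 1
    ring
  simp only [h3]
  rw [← tsum_geometric_of_lt_one (Real.exp_nonneg _) h1]
  exact (summable_geometric_of_lt_one (Real.exp_nonneg _) h1).sum_le_tsum _
    fun _ _ => pow_nonneg (Real.exp_nonneg _) _

/-- The bounds `exp (-η * length)` form a geometric series, so the exponential moment of each
backlog is bounded by a constant; then `x ≤ exp x` bounds the mean. -/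
theorem expect_sum_backlog_le (hw : 1 ≤ w) (hρ0 : 0 < ρ) (hρ1 : ρ ≤ 1) (hη : 0 < η)
    (hθ0 : 0 < θ) (hθ : θ = ρ * Real.log (Fintype.card F))
    (hload : S.card * (Real.exp θ - 1) ≤ (θ - η) * ((m - w + 1 : ℕ) : ℝ)) :
    (expect fun p : (U → Fin (m - w + 1)) × (U → Fin w → F) =>
      ind (IndepRows p.1 p.2 S) * ∑ c ∈ Finset.range m, (backlog S p c : ℝ)) ≤
      m * ((1 - Real.exp (-η))⁻¹ / θ) := by
  have h1 : ∀ p : (U → Fin (m - w + 1)) × (U → Fin w → F),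
      ind (IndepRows p.1 p.2 S) * ∑ c ∈ Finset.range m, (backlog S p c : ℝ) ≤
      ∑ c ∈ Finset.range m, θ⁻¹ *
        ∑ a ∈ Finset.range (c + 2), (spanCount S p a (c + 1) : ℝ) ^ ρ := by
    intro p
    by_cases hind : IndepRows p.1 p.2 S
    · rw [ind_of hind, one_mul]
      refine Finset.sum_le_sum fun c _ => ?_
      rw [inv_mul_eq_div, le_div_iff₀ hθ0]
      have h2 := exp_backlog_le hw hρ0 hρ1 hθ hind c
      have h3 := Real.add_one_le_exp (θ * backlog S p c)
      linarith
    · rw [ind_of_not hind, zero_mul]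
      positivity
  refine (expect_mono h1).trans ?_
  simp only [expect_sum, expect_mul_left]
  have h2 : ∀ c ∈ Finset.range m, θ⁻¹ * ∑ a ∈ Finset.range (c + 2),
      (expect fun p : (U → Fin (m - w + 1)) × (U → Fin w → F) =>
        (spanCount S p a (c + 1) : ℝ) ^ ρ) ≤ (1 - Real.exp (-η))⁻¹ / θ := by
    intro c _
    rw [inv_mul_eq_div]
    gcongr
    exact (Finset.sum_le_sum fun a _ => expect_spanCount_le hρ0.le hρ1 hθ hload a (c + 1)).trans
      (sum_exp_neg_le hη (c + 1) _ subset_rfl)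
  refine (Finset.sum_le_sum h2).trans_eq ?_
  rw [Finset.sum_const, Finset.card_range, nsmul_eq_mul]

/-- The total backlog of the columns of a residue class modulo `w` is rarely large. -/
theorem expect_residue_backlog_le (hw : 1 ≤ w) (hρ0 : 0 < ρ) (hρ1 : ρ ≤ 1) (hη : 0 < η)
    (hθ : θ = ρ * Real.log (Fintype.card F))
    (hload : S.card * (Real.exp θ - 1) ≤ (θ - η) * ((m - w + 1 : ℕ) : ℝ)) (r n : ℕ) (hr : r < w)
    (hn : n * w ≤ 2 * m) :
    (expect fun p : (U → Fin (m - w + 1)) × (U → Fin w → F) =>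
      ind (IndepRows p.1 p.2 S ∧ ¬ HasLongSpan S p ∧
        n * (1 + Real.log (1 - Real.exp (-η))⁻¹) <
          θ * ∑ i : Fin n, (backlog S p (r + i * w) : ℝ))) ≤ Real.exp (-n) := by
  set G := (1 - Real.exp (-η))⁻¹ with hG
  have hG0 : 0 < G := by
    have : Real.exp (-η) < 1 := Real.exp_lt_one_iff.2 (by linarith)
    exact inv_pos.2 (by linarith)
  let e : Fin n → ℕ := fun i => r + i * w + 1
  -- Intervals that end at `e i` and have length at most `w - 1`. Consecutive ends are `w` apart, so
  -- such intervals are disjoint for different `i` and the joint moment factors.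
  let t : Fin n → Finset ℕ := fun i => Finset.Icc (e i + 1 - w) (e i)
  -- Chernoff's method: the threshold is `n log G`, the logarithm of the moment bound `G ^ n`, plus
  -- `n`, which leaves `exp (-n)`.
  have hpt : ∀ p : (U → Fin (m - w + 1)) × (U → Fin w → F),
      ind (IndepRows p.1 p.2 S ∧ ¬ HasLongSpan S p ∧
        n * (1 + Real.log G) < θ * ∑ i : Fin n, (backlog S p (r + i * w) : ℝ)) ≤
      Real.exp (-(n * (1 + Real.log G))) *
        ∑ a ∈ Fintype.piFinset t, ∏ i, (spanCount S p (a i) (e i) : ℝ) ^ ρ := by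
    intro p
    by_cases h : IndepRows p.1 p.2 S ∧ ¬ HasLongSpan S p ∧
        n * (1 + Real.log G) < θ * ∑ i : Fin n, (backlog S p (r + i * w) : ℝ)
    · rw [ind_of h, ← Finset.prod_univ_sum t fun i a => (spanCount S p a (e i) : ℝ) ^ ρ]
      obtain ⟨hind, hlong, hlt⟩ := h
      have h1 : Real.exp (θ * ∑ i : Fin n, (backlog S p (r + i * w) : ℝ)) ≤
          ∏ i, ∑ a ∈ t i, (spanCount S p a (e i) : ℝ) ^ ρ := by
        rw [Finset.mul_sum, Real.exp_sum]
        refine Finset.prod_le_prod (fun _ _ => Real.exp_nonneg _) fun i _ => ?_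
        refine exp_backlog_le_of_not_hasLongSpan hw hρ0 hρ1 hθ hind hlong ?_
        have : (i : ℕ) * w + w ≤ n * w := by
          rw [← Nat.succ_mul]
          exact Nat.mul_le_mul_right _ i.2
        omega
      refine le_trans ?_ (mul_le_mul_of_nonneg_left h1 (Real.exp_nonneg _))
      rw [← Real.exp_add]
      exact Real.one_le_exp (by linarith)
    · rw [ind_of_not h]
      positivity
  refine (expect_mono hpt).trans ?_
  rw [expect_mul_left, expect_sum]
  have hterm : ∀ a ∈ Fintype.piFinset t,
      (expect fun p : (U → Fin (m - w + 1)) × (U → Fin w → F) =>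
        ∏ i, (spanCount S p (a i) (e i) : ℝ) ^ ρ) ≤
      ∏ i, Real.exp (-(η * ((e i - a i : ℕ) : ℝ))) := by
    intro a ha
    refine expect_prod_spanCount_le hρ0.le hρ1 hθ hload a e ?_
    have key : ∀ i i' : Fin n, i < i' →
        Disjoint (Finset.Ico (a i) (e i)) (Finset.Ico (a i') (e i')) := by
      intro i i' hii
      have h1 : e i + w ≤ e i' := by
        have : ((i : ℕ) + 1) * w ≤ i' * w := Nat.mul_le_mul_right _ hii
        simp only [e]
        nlinarith
      have h2 := (Finset.mem_Icc.1 (Fintype.mem_piFinset.1 ha i')).1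
      rw [Finset.disjoint_left]
      intro x hx hx'
      rw [Finset.mem_Ico] at hx hx'
      omega
    intro i i' hne
    rcases lt_or_gt_of_ne hne with h | h
    · exact key i i' h
    · exact (key i' i h).symm
  have hsum : ∑ a ∈ Fintype.piFinset t,
      (expect fun p : (U → Fin (m - w + 1)) × (U → Fin w → F) =>
        ∏ i, (spanCount S p (a i) (e i) : ℝ) ^ ρ) ≤ G ^ n := by
    refine (Finset.sum_le_sum hterm).trans ?_
    rw [← Finset.prod_univ_sum t fun i a => Real.exp (-(η * ((e i - a : ℕ) : ℝ)))]
    refine (Finset.prod_le_prod (fun i _ => Finset.sum_nonneg fun _ _ => Real.exp_nonneg _)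
      fun i _ => sum_exp_neg_le hη (e i) (t i) fun a ha => ?_).trans_eq ?_
    · rw [Finset.mem_range]
      have := (Finset.mem_Icc.1 ha).2
      omega
    · rw [Finset.prod_const, Finset.card_univ, Fintype.card_fin]
  refine (mul_le_mul_of_nonneg_left hsum (Real.exp_nonneg _)).trans_eq ?_
  have : G ^ n = Real.exp (n * Real.log G) := by
    rw [Real.exp_nat_mul, Real.exp_log hG0]
  rw [this, ← Real.exp_add]
  congr 1
  ring

theorem sum_range_le_sum_residues (f : ℕ → ℝ) (hf : ∀ c, 0 ≤ f c) (hw : 1 ≤ w) {n : ℕ}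
    (hn : m ≤ n * w) :
    ∑ c ∈ Finset.range m, f c ≤ ∑ r ∈ Finset.range w, ∑ i : Fin n, f (r + i * w) := by
  have h1 : ∀ r, ∑ i : Fin n, f (r + i * w) = ∑ i ∈ Finset.range n, f (r + i * w) := fun r =>
    Fin.sum_univ_eq_sum_range (fun i => f (r + i * w)) n
  simp only [h1]
  rw [← Finset.sum_product' (Finset.range w) (Finset.range n) fun r i => f (r + i * w)]
  have h2 : ∑ c ∈ Finset.range m, f c =
      ∑ x ∈ (Finset.range m).image fun c => (c % w, c / w), f (x.1 + x.2 * w) := by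
    rw [Finset.sum_image]
    · refine Finset.sum_congr rfl fun c _ => ?_
      dsimp only
      rw [mul_comm, Nat.mod_add_div]
    · intro c _ c' _ h
      simp only [Prod.mk.injEq] at h
      rw [← Nat.mod_add_div c w, ← Nat.mod_add_div c' w, h.1, h.2]
  rw [h2]
  refine Finset.sum_le_sum_of_subset_of_nonneg ?_ fun _ _ _ => hf _
  intro x hx
  obtain ⟨c, hc, rfl⟩ := Finset.mem_image.1 hx
  rw [Finset.mem_product, Finset.mem_range, Finset.mem_range]
  refine ⟨Nat.mod_lt _ hw, Nat.div_lt_of_lt_mul ?_⟩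
  rw [mul_comm]
  exact (Finset.mem_range.1 hc).trans_le hn

end Tail

/-! ### Size of the encoding -/

theorem logb_card_le {F : Type} [Field F] [Fintype F] {m : ℕ} {ε β : ℝ} (hF : (Fintype.card F : ℝ) = Real.exp ε + 1) {k : ℕ}
    (hm : (m : ℝ) ≤ (1 + β) * k) : Real.logb 2 (Fintype.card (Fin m → F)) ≤
      (1 + β) * k * (ε * Real.logb 2 (Real.exp 1) + Real.logb 2 (1 + Real.exp (-ε))) := by
  have hq := one_lt_card_real (F := F)
  have h1 : Real.logb 2 (Fintype.card F) =
      ε * Real.logb 2 (Real.exp 1) + Real.logb 2 (1 + Real.exp (-ε)) := by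
    have : (Fintype.card F : ℝ) = Real.exp 1 ^ ε * (1 + Real.exp (-ε)) := by
      rw [hF, Real.exp_one_rpow, mul_add, mul_one, ← Real.exp_add, add_neg_cancel, Real.exp_zero]
    rw [this, Real.logb_mul (by positivity) (by positivity),
      Real.logb_rpow_eq_mul_logb_of_pos (Real.exp_pos 1)]
  rw [Fintype.card_fun, Fintype.card_fin, Nat.cast_pow, Real.logb_pow, ← h1]
  exact mul_le_mul_of_nonneg_right hm (Real.logb_nonneg (by norm_num) hq.le)

/-! ### From the hash functions to the costs of the mechanism -/

section Mechanism

variable {F U : Type} [Field F] [DecidableEq F] [LinearOrder U] {m w : ℕ} {S : Finset U}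

theorem isSolved_encode (hw : 1 ≤ w) (hwm : w ≤ m) (ω : Tape F U m w)
    (hind : IndepRows ω.2.1 ω.2.2.1 S) : (encode m w S ω).val.IsSolved := by
  obtain ⟨h, h₁, h₂, coin, free⟩ := ω
  obtain ⟨_, -, hy⟩ := encode_val_of_indep hw hwm S h h₁ h₂ coin
    (hind.mono (Finset.filter_subset _ _))
  obtain ⟨y, hy, -⟩ := hy free
  rw [hy]
  trivial

theorem decode_steps_le (hw : 1 ≤ w) (hwm : w ≤ m) {k : ℕ} (hk : 1 ≤ Real.log k)
    (hkw : Real.log k ≤ w) (hS : S.card ≤ k) (ω : Tape F U m w) (u : U) :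
    (((bandMechanism F U m w).decode ((bandMechanism F U m w).encode S ω).val u).steps : ℝ) ≤
      16 * w := by
  have hw' : (1 : ℝ) ≤ w := by exact_mod_cast hw
  obtain ⟨h, h₁, h₂, coin, free⟩ := ω
  change ((decode (encode m w S (h, h₁, h₂, coin, free)).val u).steps : ℝ) ≤ 16 * w
  by_cases hind : IndepRows h₁ h₂ (kept coin S)
  · obtain ⟨_, -, hy⟩ := encode_val_of_indep hw hwm S h h₁ h₂ coin hind
    obtain ⟨y, hy, -⟩ := hy free
    rw [hy, decode_solved_steps]
    push_cast
    linarith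
  · rw [encode_val_of_not_indep hw hwm S h h₁ h₂ coin free hind]
    have h1 : (decode (Encoding.failed (S.sort (· ≤ ·)) : Encoding F U m w) u).steps ≤
        5 * (Nat.log 2 k + 1) + 1 :=
      (decode_failed_steps S u).trans (by
        have := Nat.log_mono_right (b := 2) hS
        omega)
    have h2 : (Nat.log 2 k : ℝ) ≤ 2 * Real.log k := by
      have h3 := Real.natLog_le_logb k 2
      refine h3.trans ?_
      rw [Real.logb, div_le_iff₀ (by positivity)]
      have := Real.log_two_gt_d9
      push_cast
      nlinarith
    have h4 : ((decode (Encoding.failed (S.sort (· ≤ ·)) : Encoding F U m w) u).steps : ℝ) ≤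
        5 * (Nat.log 2 k + 1) + 1 := by exact_mod_cast h1
    linarith

variable [Fintype F] [Fintype U] {θ η ρ : ℝ}

theorem expect_tape (g : (U → Fin (m - w + 1)) × (U → Fin w → F) → ℝ) :
    (expect fun ω : Tape F U m w => g (ω.2.1, ω.2.2.1)) = expect g := by
  rw [expect_prod]
  simp only [expect_const]
  rw [expect_prod, expect_prod]
  congr 1; funext h₁
  rw [expect_prod]
  simp only [expect_const]

theorem expect_tape_le {f : Tape F U m w → ℝ}
    {g : (U → Fin (m - w + 1)) × (U → Fin w → F) → ℝ} (h : ∀ ω, f ω ≤ g (ω.2.1, ω.2.2.1)) :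
    expect f ≤ expect g :=
  (expect_mono h).trans_eq (expect_tape g)

theorem prob_not_isSolved_le (hw : 1 ≤ w) (hwm : w ≤ m) :
    prob {ω | ¬ ((bandMechanism F U m w).encode S ω).val.IsSolved} ≤
      expect fun p : (U → Fin (m - w + 1)) × (U → Fin w → F) => ind (¬ IndepRows p.1 p.2 S) := by
  rw [prob_eq]
  exact expect_tape_le fun ω => ind_mono fun h hind => h (isSolved_encode hw hwm ω hind)

/-- Split according to whether the rows of `S` are independent: the backlog bound in the first case,
the quadratic worst case in the second. -/
theorem expect_encode_steps_le (hw : 1 ≤ w) (hwm : w ≤ m) :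
    (expect fun ω => (((bandMechanism F U m w).encode S ω).steps : ℝ)) ≤
      40 * w * (S.card + m) +
      40 * w * (expect fun p : (U → Fin (m - w + 1)) × (U → Fin w → F) =>
        ind (IndepRows p.1 p.2 S) * ∑ c ∈ Finset.range m, (backlog S p c : ℝ)) +
      40 * w ^ 2 * (S.card + m) *
        expect fun p : (U → Fin (m - w + 1)) × (U → Fin w → F) => ind (¬ IndepRows p.1 p.2 S) := by
  let g : (U → Fin (m - w + 1)) × (U → Fin w → F) → ℝ := fun p => 40 * w * (S.card + m) +
    40 * w * (ind (IndepRows p.1 p.2 S) * ∑ c ∈ Finset.range m, (backlog S p c : ℝ)) +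
    40 * (w : ℝ) ^ 2 * (S.card + m) * ind (¬ IndepRows p.1 p.2 S)
  have h1 : ∀ ω : Tape F U m w, (((bandMechanism F U m w).encode S ω).steps : ℝ) ≤
      g (ω.2.1, ω.2.2.1) := by
    intro ω
    dsimp only [g]
    by_cases hind : IndepRows ω.2.1 ω.2.2.1 S
    · have h2 := encode_steps_le_of_indep hw hwm S ω.1 ω.2.1 ω.2.2.1 ω.2.2.2.1 ω.2.2.2.2 hind
      rw [ind_of hind, ind_of_not (not_not.2 hind)]
      have h3 : ((encode m w S ω).steps : ℝ) ≤ 40 * w * (S.card + m +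
          ∑ c ∈ Finset.range m, (backlog S (ω.2.1, ω.2.2.1) c : ℝ)) := by exact_mod_cast h2
      refine h3.trans (le_of_eq ?_)
      ring
    · have h2 := encode_steps_le hw hwm S ω
      rw [ind_of_not hind, ind_of hind]
      have h3 : ((encode m w S ω).steps : ℝ) ≤ 40 * w ^ 2 * (S.card + m) := by exact_mod_cast h2
      refine h3.trans ?_
      have : (0 : ℝ) ≤ 40 * w * (S.card + m) := by positivity
      linarith
  refine (expect_tape_le (g := g) h1).trans_eq ?_
  simp only [g, expect_add, expect_mul_left, expect_const]

/-- The three error terms are dependent rows, a long span, and an excessive backlog in one of the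
`w` residue classes. With `n = m / w + 1` the classes cover all columns below `m`, and `n w ≤ 2 m`
explains the factor `2` in the time bound. -/
theorem prob_encode_steps_le (hw : 1 ≤ w) (hwm : w ≤ m) (hρ0 : 0 < ρ) (hρ1 : ρ ≤ 1) (hη : 0 < η)
    (hθ0 : 0 < θ) (hθ : θ = ρ * Real.log (Fintype.card F))
    (hload : S.card * (Real.exp θ - 1) ≤ (θ - η) * ((m - w + 1 : ℕ) : ℝ)) {T : ℝ}
    (hT : 40 * w * (S.card + m + 2 * m * (1 + Real.log (1 - Real.exp (-η))⁻¹) / θ) ≤ T) :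
    prob {ω | T < (((bandMechanism F U m w).encode S ω).steps : ℝ)} ≤
      m * (m + 1) * Real.exp (-(θ * (w - 1))) +
      (2 * m + 1) * (2 * m + 1) * Real.exp (-(η * w)) +
      w * Real.exp (-((m / w + 1 : ℕ) : ℝ)) := by
  set n := m / w + 1 with hn
  set t := 1 + Real.log (1 - Real.exp (-η))⁻¹ with ht
  have ht0 : 0 ≤ t := by
    have h1 : Real.exp (-η) < 1 := Real.exp_lt_one_iff.2 (by linarith)
    have h2 : 1 ≤ (1 - Real.exp (-η))⁻¹ := (one_le_inv₀ (by linarith)).2 (by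
      have := Real.exp_nonneg (-η)
      linarith)
    have := Real.log_nonneg h2
    linarith
  have hn1 : m ≤ n * w := by
    rw [hn, add_mul, one_mul, mul_comm]
    have := Nat.div_add_mod m w
    have := Nat.mod_lt m hw
    omega
  have hn2 : n * w ≤ 2 * m := by
    rw [hn, add_mul, one_mul]
    have := Nat.div_mul_le_self m w
    omega
  let R : (U → Fin (m - w + 1)) × (U → Fin w → F) → ℕ → Prop := fun p r =>
    IndepRows p.1 p.2 S ∧ ¬ HasLongSpan S p ∧
      n * t < θ * ∑ i : Fin n, (backlog S p (r + i * w) : ℝ)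
  let g : (U → Fin (m - w + 1)) × (U → Fin w → F) → ℝ := fun p =>
    ind (¬ IndepRows p.1 p.2 S) + ind (HasLongSpan S p) + ∑ r ∈ Finset.range w, ind (R p r)
  have hsteps : ∀ ω : Tape F U m w, ind (T < (((bandMechanism F U m w).encode S ω).steps : ℝ)) ≤
      g (ω.2.1, ω.2.2.1) := by
    intro ω
    dsimp only [g]
    have hnn : 0 ≤ ∑ r ∈ Finset.range w, ind (R (ω.2.1, ω.2.2.1) r) :=
      Finset.sum_nonneg fun _ _ => ind_nonneg _
    by_cases hind : IndepRows ω.2.1 ω.2.2.1 S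
    · by_cases hlong : HasLongSpan S (ω.2.1, ω.2.2.1)
      · rw [ind_of hlong]
        have h1 := ind_le_one (T < (((bandMechanism F U m w).encode S ω).steps : ℝ))
        have h2 := ind_nonneg (¬ IndepRows ω.2.1 ω.2.2.1 S)
        linarith
      · by_cases hR : ∃ r ∈ Finset.range w, R (ω.2.1, ω.2.2.1) r
        · have h1 := ind_exists_le (Finset.range w) (R (ω.2.1, ω.2.2.1))
          rw [ind_of hR] at h1
          have h2 := ind_le_one (T < (((bandMechanism F U m w).encode S ω).steps : ℝ))
          have h3 := ind_nonneg (¬ IndepRows ω.2.1 ω.2.2.1 S)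
          have h4 := ind_nonneg (HasLongSpan S (ω.2.1, ω.2.2.1))
          linarith
        · have hle : ∀ r ∈ Finset.range w,
              ∑ i : Fin n, (backlog S (ω.2.1, ω.2.2.1) (r + i * w) : ℝ) ≤ n * t / θ := by
            intro r hr
            by_contra hcon
            refine hR ⟨r, hr, hind, hlong, ?_⟩
            rw [not_le, div_lt_iff₀ hθ0] at hcon
            linarith
          have hD := (sum_range_le_sum_residues (fun c => (backlog S (ω.2.1, ω.2.2.1) c : ℝ))
            (fun _ => Nat.cast_nonneg _) hw hn1).trans (Finset.sum_le_sum hle)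
          rw [Finset.sum_const, Finset.card_range, nsmul_eq_mul] at hD
          have h2 := encode_steps_le_of_indep hw hwm S ω.1 ω.2.1 ω.2.2.1 ω.2.2.2.1 ω.2.2.2.2 hind
          have h3 : ((encode m w S ω).steps : ℝ) ≤ 40 * w * (S.card + m +
              ∑ c ∈ Finset.range m, (backlog S (ω.2.1, ω.2.2.1) c : ℝ)) := by exact_mod_cast h2
          have h4 : ∑ c ∈ Finset.range m, (backlog S (ω.2.1, ω.2.2.1) c : ℝ) ≤
              2 * m * t / θ := by
            refine hD.trans ?_
            rw [← mul_div_assoc, ← mul_assoc]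
            have : (w : ℝ) * n ≤ 2 * m := by
              rw [mul_comm]
              exact_mod_cast hn2
            gcongr
          have h5 : ¬ T < (((bandMechanism F U m w).encode S ω).steps : ℝ) := by
            rw [not_lt]
            refine h3.trans (le_trans ?_ hT)
            gcongr
          rw [ind_of_not h5]
          have h6 := ind_nonneg (¬ IndepRows ω.2.1 ω.2.2.1 S)
          have h7 := ind_nonneg (HasLongSpan S (ω.2.1, ω.2.2.1))
          linarith
    · rw [ind_of hind]
      have h1 := ind_le_one (T < (((bandMechanism F U m w).encode S ω).steps : ℝ))
      have h2 := ind_nonneg (HasLongSpan S (ω.2.1, ω.2.2.1))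
      linarith
  rw [prob_eq]
  refine (expect_tape_le (g := g) hsteps).trans ?_
  simp only [g]
  rw [expect_add, expect_add, expect_sum]
  refine add_le_add (add_le_add (expect_not_indep_le hw hwm hρ0.le hρ1 hη.le hθ hload)
    (expect_hasLongSpan_le hρ0.le hρ1 hη.le hθ hload)) ?_
  refine (Finset.sum_le_sum fun r hr => expect_residue_backlog_le hw hρ0 hρ1 hη hθ hload r n
    (Finset.mem_range.1 hr) hn2).trans_eq ?_
  rw [Finset.sum_const, Finset.card_range, nsmul_eq_mul]

end Mechanism

/-! ### Choice of the constants -/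

theorem log_le_two_mul_sqrt {x : ℝ} (hx : 0 ≤ x) : Real.log x ≤ 2 * √x := by
  have h1 := Real.log_le_self (Real.sqrt_nonneg x)
  rw [Real.log_sqrt hx] at h1
  linarith

theorem log_sq_le {x : ℝ} (hx : 1 ≤ x) : Real.log x ^ 2 ≤ 16 * √x := by
  have h1 := log_le_two_mul_sqrt (Real.sqrt_nonneg x)
  rw [Real.log_sqrt (by linarith)] at h1
  have h2 := Real.sq_sqrt (Real.sqrt_nonneg x)
  have h3 := Real.log_nonneg hx
  have h4 := Real.sqrt_nonneg √x
  nlinarith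

set_option maxHeartbeats 4000000 in
/-- The choice of the band width. -/
theorem exists_bandWidth {β : ℝ} (hβ : 0 < β) :
    ∃ θ η s₀ : ℝ, 0 < θ ∧ θ ≤ 1 ∧ 0 < η ∧ η ≤ θ ∧ 1 ≤ s₀ ∧ ∀ s : ℝ, s₀ ≤ s → ∀ L : ℝ, 0 ≤ L →
      ∀ k : ℕ, s ^ 2 * (1 + L) ≤ k → ∃ w : ℕ, 1 ≤ w ∧ w ≤ ⌊(1 + β) * (k : ℝ)⌋₊ ∧
        (w : ℝ) ≤ s ^ 2 * (L + Real.log k) ∧ 1 ≤ Real.log k ∧ Real.log k ≤ w ∧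
        k * (Real.exp θ - 1) ≤ (θ - η) * ((⌊(1 + β) * (k : ℝ)⌋₊ - w + 1 : ℕ) : ℝ) ∧
        3 * (2 * (⌊(1 + β) * (k : ℝ)⌋₊ : ℝ) + 1) ^ 2 * Real.exp (-(η * (w - 1))) ≤
          Real.exp (-L) ∧
        (2 * (⌊(1 + β) * (k : ℝ)⌋₊ : ℝ) + 1) ^ 3 * Real.exp (-(η * (w - 1))) ≤ 1 ∧
        (s ^ 2 * (1 + L) ^ 2 ≤ k →
          3 * w * Real.exp (-((⌊(1 + β) * (k : ℝ)⌋₊ / w + 1 : ℕ) : ℝ)) ≤ Real.exp (-L)) := by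
  obtain ⟨θ, hθ⟩ : ∃ θ, θ = min 1 (β / 4) := ⟨_, rfl⟩
  have hθ0 : 0 < θ := by rw [hθ]; positivity
  have hθ1 : θ ≤ 1 := hθ ▸ min_le_left _ _
  have hθ2 : θ ≤ β / 4 := hθ ▸ min_le_right _ _
  -- Chosen so that `(θ - η) (1 + β / 2) = θ (1 + β / 4)`, which is at least `θ + θ ^ 2 ≥ exp θ - 1`
  -- as `θ ≤ β / 4`.
  obtain ⟨η, hη⟩ : ∃ η, η = θ * (β / 4) / (1 + β / 2) := ⟨_, rfl⟩
  have hη0 : 0 < η := by rw [hη]; positivity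
  have hηmul : η * (1 + β / 2) = θ * (β / 4) := by
    rw [hη, div_mul_cancel₀ _ (by positivity)]
  have hηθ : η ≤ θ := by
    by_contra h
    nlinarith
  -- With `w - 1 ≥ A (L + log k)` this gives `exp (-η (w - 1)) ≤ exp (-L) / k ^ 4`, enough to beat
  -- cubic factors in `m`.
  obtain ⟨A, hA⟩ : ∃ A, A = 4 / η := ⟨_, rfl⟩
  have hηA : η * A = 4 := by
    rw [hA]
    field_simp
  have hA1 : 1 ≤ A := by
    by_contra h
    nlinarith
  -- The bound `w ≤ b k` yields `w ≤ m` and leaves at least `(1 + β / 2) k` possible starts.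
  obtain ⟨b, hb⟩ : ∃ b, b = min 1 (β / 2) := ⟨_, rfl⟩
  have hb0 : 0 < b := by rw [hb]; positivity
  have hb1 : b ≤ 1 := hb ▸ min_le_left _ _
  have hb2 : b ≤ β / 2 := hb ▸ min_le_right _ _
  -- The summands serve, in order, `s ≥ 1`, the bound `w ≤ b k`, the tail bound (`102 = 6 * (1 +
  -- 16)`), and the constants in powers of `2 m + 1`.
  refine ⟨θ, η, 1 + 3 * (A + 2) / b + 102 * (A + 2) + 3 * (3 + 2 * β) ^ 3, hθ0, hθ1, hη0, hηθ, ?_,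
    ?_⟩
  · have : 0 ≤ 3 * (A + 2) / b := by positivity
    have : 0 ≤ 3 * (3 + 2 * β) ^ 3 := by positivity
    linarith
  intro s hs L hL k hk
  have p1 : 0 ≤ 3 * (A + 2) / b := by positivity
  have p2 : 0 ≤ 3 * (3 + 2 * β) ^ 3 := by positivity
  have hs1 : 1 ≤ s := by linarith
  have hs2 : 3 * (A + 2) ≤ s * b := by
    rw [← div_le_iff₀ hb0]
    linarith
  have hs3 : 102 * (A + 2) ≤ s := by linarith
  have hs4 : 3 * (3 + 2 * β) ^ 3 ≤ s := by linarith
  have hss : s ≤ s ^ 2 := le_self_pow₀ hs1 two_ne_zero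
  have hsL : 0 ≤ s ^ 2 * L := by positivity
  rw [mul_add, mul_one] at hk
  have hk1 : s ^ 2 ≤ k := by linarith
  have hkL : s ^ 2 * L ≤ k := by linarith [sq_nonneg s]
  have hk0 : (0 : ℝ) < k := by linarith
  have hβ27 : 27 ≤ (3 + 2 * β) ^ 3 := by
    calc (27 : ℝ) = 3 ^ 3 := by norm_num
      _ ≤ (3 + 2 * β) ^ 3 := by gcongr; linarith
  have hk81 : (81 : ℝ) ≤ k := by linarith
  have hlog1 : 1 ≤ Real.log k := by
    rw [Real.le_log_iff_exp_le hk0]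
    have := Real.exp_one_lt_d9
    linarith
  have hsqrt : s ≤ √k := Real.le_sqrt_of_sq_le hk1
  have hsq : √(k : ℝ) * √(k : ℝ) = k := Real.mul_self_sqrt hk0.le
  have hsk : s * √k ≤ k := (mul_le_mul_of_nonneg_right hsqrt (Real.sqrt_nonneg _)).trans_eq hsq
  have hlogk : s * Real.log k ≤ 2 * k := by
    have := mul_le_mul_of_nonneg_left (log_le_two_mul_sqrt hk0.le) (by linarith : 0 ≤ s)
    linarith
  have hLk : s * L ≤ k := (mul_le_mul_of_nonneg_right hss hL).trans hkL
  obtain ⟨m, hm⟩ : ∃ m, m = ⌊(1 + β) * (k : ℝ)⌋₊ := ⟨_, rfl⟩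
  rw [← hm]
  have hm1 : (m : ℝ) ≤ (1 + β) * k := hm ▸ Nat.floor_le (by positivity)
  have hm2 : (1 + β) * k < m + 1 := hm ▸ Nat.lt_floor_add_one _
  have hkm : k ≤ m := by
    rw [hm]
    refine Nat.le_floor ?_
    rw [one_add_mul]
    linarith [mul_pos hβ hk0]
  obtain ⟨w, hw⟩ : ∃ w, w = ⌈A * (L + Real.log k)⌉₊ + 1 := ⟨_, rfl⟩
  have hAL : 0 ≤ A * (L + Real.log k) := by
    refine mul_nonneg (by linarith) (by linarith)
  have hw1 : A * (L + Real.log k) ≤ w - 1 := by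
    rw [hw]
    push_cast
    linarith [Nat.le_ceil (A * (L + Real.log k))]
  have hw2 : (w : ℝ) ≤ (A + 2) * (L + Real.log k) := by
    rw [hw]
    push_cast
    have := Nat.ceil_lt_add_one hAL
    linarith
  have hwk : (w : ℝ) ≤ b * k := by
    have h1 : s * ((A + 2) * (L + Real.log k)) ≤ s * (b * k) := by
      have : s * L + s * Real.log k ≤ 3 * k := by linarith
      calc s * ((A + 2) * (L + Real.log k)) = (A + 2) * (s * L + s * Real.log k) := by ring
        _ ≤ (A + 2) * (3 * k) := by gcongr
        _ = 3 * (A + 2) * k := by ring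
        _ ≤ s * b * k := by gcongr
        _ = s * (b * k) := by ring
    exact hw2.trans (le_of_mul_le_mul_left h1 (by linarith))
  have hwk1 : (w : ℝ) ≤ k := hwk.trans (mul_le_of_le_one_left hk0.le hb1)
  have hwkn : w ≤ k := by exact_mod_cast hwk1
  have hw0 : 1 ≤ w := by omega
  have hwm : w ≤ m := hwkn.trans hkm
  have hexp : Real.exp (-(η * (w - 1))) ≤ Real.exp (-L) * ((k : ℝ) ^ 4)⁻¹ := by
    have h1 : ((k : ℝ) ^ 4)⁻¹ = Real.exp (-(4 * Real.log k)) := by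
      rw [Real.exp_neg, show (4 : ℝ) * Real.log k = ((4 : ℕ) : ℝ) * Real.log k by norm_num,
        Real.exp_nat_mul, Real.exp_log hk0]
    rw [h1, ← Real.exp_add]
    refine Real.exp_le_exp.2 ?_
    have h2 := mul_le_mul_of_nonneg_left hw1 hη0.le
    rw [← mul_assoc, hηA] at h2
    linarith
  have h2m : 2 * (m : ℝ) + 1 ≤ (3 + 2 * β) * k := by linarith
  have hβk : 3 * (3 + 2 * β) ^ 3 ≤ k := by linarith
  have hL1 : Real.exp (-L) ≤ 1 := Real.exp_le_one_iff.2 (by linarith)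
  have hk4 : (0 : ℝ) < (k : ℝ) ^ 4 := by positivity
  refine ⟨w, hw0, hwm, ?_, hlog1, ?_, ?_, ?_, ?_, ?_⟩
  · refine hw2.trans (mul_le_mul_of_nonneg_right ?_ (by linarith))
    linarith
  · have := le_mul_of_one_le_left (by linarith : 0 ≤ L + Real.log k) hA1
    linarith
  · have h1 : Real.exp θ - 1 ≤ θ + θ ^ 2 := by
      have := Real.abs_exp_sub_one_sub_id_le (abs_le.2 ⟨by linarith, hθ1⟩ : |θ| ≤ 1)
      have := (abs_le.1 this).2
      linarith
    have h2 : (1 + β / 2) * k ≤ ((m - w + 1 : ℕ) : ℝ) := by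
      push_cast [hwm]
      have := mul_le_mul_of_nonneg_right hb2 hk0.le
      linarith
    have h3 : θ + θ ^ 2 ≤ (θ - η) * (1 + β / 2) := by
      have := mul_le_mul_of_nonneg_left hθ2 hθ0.le
      linarith
    calc (k : ℝ) * (Real.exp θ - 1) ≤ k * (θ + θ ^ 2) := by gcongr
      _ ≤ k * ((θ - η) * (1 + β / 2)) := by gcongr
      _ = (θ - η) * ((1 + β / 2) * k) := by ring
      _ ≤ _ := mul_le_mul_of_nonneg_left h2 (by linarith)
  · calc 3 * (2 * (m : ℝ) + 1) ^ 2 * Real.exp (-(η * (w - 1)))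
        ≤ 3 * ((3 + 2 * β) * k) ^ 2 * (Real.exp (-L) * ((k : ℝ) ^ 4)⁻¹) := by gcongr
      _ = Real.exp (-L) * (3 * (3 + 2 * β) ^ 2 * (k : ℝ) ^ 2 / (k : ℝ) ^ 4) := by ring
      _ ≤ Real.exp (-L) * 1 := by
        gcongr
        rw [div_le_one hk4]
        have h1 : 3 * (3 + 2 * β) ^ 2 ≤ 3 * (3 + 2 * β) ^ 3 := by
          gcongr <;> linarith
        have h2 : (k : ℝ) ≤ (k : ℝ) ^ 2 := le_self_pow₀ (by linarith) two_ne_zero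
        calc 3 * (3 + 2 * β) ^ 2 * (k : ℝ) ^ 2 ≤ (k : ℝ) ^ 2 * (k : ℝ) ^ 2 := by
              gcongr
              linarith
          _ = (k : ℝ) ^ 4 := by ring
      _ = _ := mul_one _
  · calc (2 * (m : ℝ) + 1) ^ 3 * Real.exp (-(η * (w - 1)))
        ≤ ((3 + 2 * β) * k) ^ 3 * (1 * ((k : ℝ) ^ 4)⁻¹) := by
          gcongr
          exact hexp.trans (by gcongr)
      _ = (3 + 2 * β) ^ 3 * (k : ℝ) ^ 3 / (k : ℝ) ^ 4 := by ring
      _ ≤ 1 := by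
        rw [div_le_one hk4]
        calc (3 + 2 * β) ^ 3 * (k : ℝ) ^ 3 ≤ k * (k : ℝ) ^ 3 := by
              gcongr
              linarith
          _ = (k : ℝ) ^ 4 := by ring
  · intro hk2
    have hw' : (0 : ℝ) < w := by exact_mod_cast hw0
    -- The tail needs `m / w` to exceed `L + log (3 w)`. As `w` is of order `L + log k`, this is why
    -- `k` must grow like the square of `1 + L`.
    have h1 : L + Real.log (3 * w) ≤ k / w := by
      rw [le_div_iff₀ hw']
      have h2 : Real.log (3 * w) ≤ 3 * Real.log k := by
        have h3 : Real.log (3 * w) ≤ Real.log (3 * k) := Real.log_le_log (by positivity) (by linarith)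
        rw [Real.log_mul (by norm_num) hk0.ne'] at h3
        have h4 : Real.log 3 ≤ 2 := by
          have := Real.log_le_sub_one_of_pos (by norm_num : (0 : ℝ) < 3)
          linarith
        linarith
      have h5 : s * L ^ 2 ≤ k := by
        have : s * L ^ 2 ≤ s ^ 2 * (1 + L) ^ 2 := by
          gcongr
          linarith
        linarith
      have h6 : s * Real.log k ^ 2 ≤ 16 * k := by
        have := mul_le_mul_of_nonneg_left (log_sq_le (by linarith : (1 : ℝ) ≤ k))
          (by linarith : 0 ≤ s)
        linarith
      have h7 : (L + Real.log k) ^ 2 ≤ 2 * L ^ 2 + 2 * Real.log k ^ 2 := by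
        linarith [sq_nonneg (L - Real.log k)]
      have h8 : 3 * (A + 2) * (L + Real.log k) ^ 2 ≤ k := by
        have h9 : s * (3 * (A + 2) * (L + Real.log k) ^ 2) ≤ s * k := by
          calc s * (3 * (A + 2) * (L + Real.log k) ^ 2)
              ≤ s * (3 * (A + 2) * (2 * L ^ 2 + 2 * Real.log k ^ 2)) := by gcongr
            _ = 6 * (A + 2) * (s * L ^ 2 + s * Real.log k ^ 2) := by ring
            _ ≤ 6 * (A + 2) * (k + 16 * k) := by gcongr
            _ = 102 * (A + 2) * k := by ring
            _ ≤ s * k := by gcongr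
        exact le_of_mul_le_mul_left h9 (by linarith)
      calc (L + Real.log (3 * w)) * w
          ≤ (3 * (L + Real.log k)) * ((A + 2) * (L + Real.log k)) := by
            gcongr
            linarith
        _ = 3 * (A + 2) * (L + Real.log k) ^ 2 := by ring
        _ ≤ k := h8
    have h2 : (k : ℝ) / w ≤ ((m / w + 1 : ℕ) : ℝ) := by
      rw [div_le_iff₀ hw']
      have h3 : m ≤ (m / w + 1) * w := by
        rw [add_mul, one_mul, mul_comm]
        have := Nat.div_add_mod m w
        have := Nat.mod_lt m hw0
        omega
      exact_mod_cast hkm.trans h3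
    have h3 : 3 * (w : ℝ) = Real.exp (Real.log (3 * w)) := (Real.exp_log (by positivity)).symm
    rw [h3, ← Real.exp_add]
    exact Real.exp_le_exp.2 (by linarith)

end DPSet

/-! ### The main theorem -/

open DPSet

set_option maxHeartbeats 4000000 in
theorem theorem3p4 (β : ℝ) (hβ : 0 < β) :
    ∃ C : ℝ, 0 < C ∧
      ∀ (F : Type) [Field F] [Fintype F] [DecidableEq F]
        (U : Type) [Fintype U] [LinearOrder U]
        (ε δ : ℝ) (k : ℕ), 0 < ε → 0 < δ →
        (Fintype.card F : ℝ) = Real.exp ε + 1 →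
        C * (1 + Real.posLog (1 / δ)) ≤ (k : ℝ) →
        ∃ m w : ℕ, m = ⌊(1 + β) * (k : ℝ)⌋₊ ∧ 1 ≤ w ∧ w ≤ m ∧
          (w : ℝ) ≤ C * (Real.posLog (1 / δ) + Real.log k) ∧
          -- privacy and error probability
          (DPSet.bandMechanism F U m w).IsDP k ε δ ∧
          (DPSet.bandMechanism F U m w).HasError k (1 / (Real.exp ε + 1)) ∧
          -- form and size of the encodings
          (∀ S : Finset U, S.card ≤ k →
            DPSet.prob {ω | ¬ ((DPSet.bandMechanism F U m w).encode S ω).val.IsSolved} ≤ δ) ∧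
          Real.logb 2 (Fintype.card (Fin m → F)) ≤
            (1 + β) * k * (ε * Real.logb 2 (Real.exp 1) + Real.logb 2 (1 + Real.exp (-ε))) ∧
          -- encoding time: in expectation, and except with probability `δ`
          (∀ S : Finset U, S.card ≤ k →
            DPSet.expect (fun ω => (((DPSet.bandMechanism F U m w).encode S ω).steps : ℝ)) ≤
              C * (k * w)) ∧
          (C * (1 + Real.posLog (1 / δ)) ^ 2 ≤ (k : ℝ) → ∀ S : Finset U, S.card ≤ k →
            DPSet.prob {ω | C * (k * w) <
              (((DPSet.bandMechanism F U m w).encode S ω).steps : ℝ)} ≤ δ) ∧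
          -- decoding time, in the worst case
          (∀ S : Finset U, S.card ≤ k → ∀ (ω : DPSet.Tape F U m w) (u : U),
            (((DPSet.bandMechanism F U m w).decode
              ((DPSet.bandMechanism F U m w).encode S ω).val u).steps : ℝ) ≤ C * w) := by
  obtain ⟨θ, η, s₀, hθ0, hθ1, hη0, hηθ, hs₀, hpar⟩ := exists_bandWidth hβ
  obtain ⟨G, hG⟩ : ∃ G, G = (1 - Real.exp (-η))⁻¹ := ⟨_, rfl⟩
  have hG1 : 1 ≤ G := by
    have h1 : Real.exp (-η) < 1 := Real.exp_lt_one_iff.2 (by linarith)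
    rw [hG, one_le_inv₀ (by linarith)]
    linarith [Real.exp_nonneg (-η)]
  obtain ⟨t, ht⟩ : ∃ t, t = 1 + Real.log G := ⟨_, rfl⟩
  have ht0 : 0 ≤ t := by linarith [Real.log_nonneg hG1]
  obtain ⟨T₁, hT₁⟩ : ∃ T₁, T₁ = 40 * (2 * (2 + β) + (1 + β) * (G / θ)) := ⟨_, rfl⟩
  obtain ⟨T₂, hT₂⟩ : ∃ T₂, T₂ = 40 * (2 + β + 2 * (1 + β) * t / θ) := ⟨_, rfl⟩
  have hT₁mul : ∀ x y : ℝ, 40 * y * ((2 + β) * x) + 40 * y * ((1 + β) * x * (G / θ)) +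
      40 * y * ((2 + β) * x) * 1 = T₁ * (x * y) := fun x y => by rw [hT₁]; ring
  have hT₂mul : ∀ x y : ℝ, 40 * y * ((2 + β) * x + 2 * ((1 + β) * x) * t / θ) =
      T₂ * (x * y) := fun x y => by rw [hT₂]; ring
  have hT₁0 : 0 ≤ T₁ := by rw [hT₁]; positivity
  have hT₂0 : 0 ≤ T₂ := by rw [hT₂]; positivity
  -- `T₁` and `T₂` are the constants of the expected and the high-probability encoding time, and
  -- `16` is that of decoding; all are below `s ≤ s ^ 2 = C`.
  obtain ⟨s, hs⟩ : ∃ s, s = s₀ + T₁ + T₂ + 16 := ⟨_, rfl⟩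
  have hs1 : 1 ≤ s := by linarith
  have hss : s ≤ s ^ 2 := le_self_pow₀ hs1 two_ne_zero
  refine ⟨s ^ 2, by positivity, ?_⟩
  intro F _ _ _ U _ _ ε δ k hε hδ hF hk
  set L := Real.posLog (1 / δ) with hL
  have hL0 : 0 ≤ L := Real.posLog_nonneg
  have hLδ : Real.exp (-L) ≤ δ := by
    have h1 : Real.log (1 / δ) ≤ L := le_max_right _ _
    rw [one_div, Real.log_inv] at h1
    calc Real.exp (-L) ≤ Real.exp (Real.log δ) := Real.exp_le_exp.2 (by linarith)
      _ = δ := Real.exp_log hδ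
  obtain ⟨w, hw, hwm, hwle, hlog1, hlogw, hload, hb1, hb2, hb3⟩ :=
    hpar s (by linarith) L hL0 k hk
  have hm1 : ((⌊(1 + β) * (k : ℝ)⌋₊ : ℕ) : ℝ) ≤ (1 + β) * k := Nat.floor_le (by positivity)
  obtain ⟨m, hm⟩ : ∃ m, m = ⌊(1 + β) * (k : ℝ)⌋₊ := ⟨_, rfl⟩
  rw [← hm] at hwm hload hb1 hb2 hb3 hm1
  have hw' : (1 : ℝ) ≤ w := by exact_mod_cast hw
  have hwm' : (w : ℝ) ≤ m := by exact_mod_cast hwm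
  have hq3 : (3 : ℝ) ≤ Fintype.card F := by
    have h1 : (2 : ℝ) < Fintype.card F := by
      have := Real.add_one_lt_exp hε.ne'
      linarith
    exact_mod_cast h1
  have hlogq : 1 ≤ Real.log (Fintype.card F) := by
    rw [Real.le_log_iff_exp_le (by linarith)]
    linarith [Real.exp_one_lt_d9]
  -- Only `ρ` depends on the field. It is at most one because `ε > 0` forces `q ≥ 3`, so that `log q
  -- ≥ 1 ≥ θ`.
  obtain ⟨ρ, hρ⟩ : ∃ ρ, ρ = θ / Real.log (Fintype.card F) := ⟨_, rfl⟩
  have hρ0 : 0 < ρ := by rw [hρ]; positivity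
  have hρ1 : ρ ≤ 1 := by
    rw [hρ, div_le_one (by linarith)]
    linarith
  have hθρ : θ = ρ * Real.log (Fintype.card F) := by
    rw [hρ, div_mul_cancel₀ _ (by linarith)]
  have hexpθ : 0 ≤ Real.exp θ - 1 := by linarith [Real.add_one_le_exp θ]
  have hloadS : ∀ S : Finset U, S.card ≤ k →
      S.card * (Real.exp θ - 1) ≤ (θ - η) * ((m - w + 1 : ℕ) : ℝ) := by
    intro S hS
    refine le_trans (mul_le_mul_of_nonneg_right ?_ hexpθ) hload
    exact_mod_cast hS
  have hexp : Real.exp (-(θ * (w - 1))) ≤ Real.exp (-(η * (w - 1))) := by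
    refine Real.exp_le_exp.2 (neg_le_neg ?_)
    gcongr
  have hexp' : Real.exp (-(η * w)) ≤ Real.exp (-(η * (w - 1))) := by
    refine Real.exp_le_exp.2 ?_
    linarith
  have hm0 : (0 : ℝ) ≤ m := Nat.cast_nonneg _
  have hind1 : m * (m + 1) * Real.exp (-(θ * (w - 1))) ≤ δ / 3 := by
    have : (m : ℝ) * (m + 1) * Real.exp (-(θ * (w - 1))) ≤
        (2 * m + 1) ^ 2 * Real.exp (-(η * (w - 1))) := by
      gcongr
      linarith [pow_nonneg hm0 2]
    linarith
  -- In the expected time this cancels the extra factor `w` of the worst case when the rows are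
  -- dependent.
  have hind2 : w * (m * (m + 1) * Real.exp (-(θ * (w - 1)))) ≤ 1 := by
    refine le_trans ?_ hb2
    rw [← mul_assoc]
    gcongr
    calc (w : ℝ) * (m * (m + 1)) ≤ m * (m * (m + 1)) := by gcongr
      _ ≤ (2 * m + 1) ^ 3 := by linarith [pow_nonneg hm0 3, pow_nonneg hm0 2]
  have hfail : ∀ S : Finset U, S.card ≤ k →
      prob {ω | ¬ ((bandMechanism F U m w).encode S ω).val.IsSolved} ≤ δ := by
    intro S hS
    have h1 := expect_not_indep_le hw hwm hρ0.le hρ1 hη0.le hθρ (hloadS S hS)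
    linarith [prob_not_isSolved_le (F := F) (S := S) hw hwm]
  refine ⟨m, w, hm, hw, hwm, hwle, isDP_bandMechanism hw hwm hF hfail, ?_, hfail,
    logb_card_le hF hm1, ?_, ?_, ?_⟩
  · rw [← hF]
    exact hasError_bandMechanism hw hwm k
  · intro S hS
    have hSk : (S.card : ℝ) ≤ k := by exact_mod_cast hS
    have h1 := expect_not_indep_le hw hwm hρ0.le hρ1 hη0.le hθρ (hloadS S hS)
    have h2 := expect_sum_backlog_le hw hρ0 hρ1 hη0 hθ0 hθρ (hloadS S hS)
    rw [← hG] at h2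
    refine (expect_encode_steps_le hw hwm).trans ?_
    have h3 : (w : ℝ) * (expect fun p : (U → Fin (m - w + 1)) × (U → Fin w → F) =>
        ind (¬ IndepRows p.1 p.2 S)) ≤ 1 :=
      (mul_le_mul_of_nonneg_left h1 (by linarith)).trans hind2
    have h4 : (S.card : ℝ) + m ≤ (2 + β) * k := by linarith
    have hGθ : 0 ≤ G / θ := by positivity
    calc _ ≤ 40 * w * ((2 + β) * k) + 40 * w * ((1 + β) * k * (G / θ)) +
          40 * w * ((2 + β) * k) * 1 := by
          refine add_le_add (add_le_add ?_ ?_) ?_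
          · exact mul_le_mul_of_nonneg_left h4 (by positivity)
          · refine mul_le_mul_of_nonneg_left (h2.trans ?_) (by positivity)
            gcongr
          · calc _ = 40 * (w : ℝ) * (S.card + m) *
                  (w * (expect fun p : (U → Fin (m - w + 1)) × (U → Fin w → F) =>
                    ind (¬ IndepRows p.1 p.2 S))) := by ring
              _ ≤ 40 * (w : ℝ) * (S.card + m) * 1 :=
                mul_le_mul_of_nonneg_left h3 (mul_nonneg (by positivity)
                  (add_nonneg (Nat.cast_nonneg _) hm0))
              _ ≤ _ := by gcongr
      _ = T₁ * (k * w) := hT₁mul k w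
      _ ≤ s ^ 2 * (k * w) := by
        gcongr
        linarith
  · intro hk2 S hS
    have hSk : (S.card : ℝ) ≤ k := by exact_mod_cast hS
    have h4 : (S.card : ℝ) + m ≤ (2 + β) * k := by linarith
    refine (prob_encode_steps_le hw hwm hρ0 hρ1 hη0 hθ0 hθρ (hloadS S hS) ?_).trans ?_
    · rw [← hG, ← ht]
      calc 40 * (w : ℝ) * (S.card + m + 2 * m * t / θ)
          ≤ 40 * w * ((2 + β) * k + 2 * ((1 + β) * k) * t / θ) := by gcongr
        _ = T₂ * (k * w) := hT₂mul k w
        _ ≤ s ^ 2 * (k * w) := by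
          gcongr
          linarith
    · have h5 := hb3 hk2
      have h6 : (2 * (m : ℝ) + 1) * (2 * m + 1) * Real.exp (-(η * w)) ≤ δ / 3 := by
        have : (2 * (m : ℝ) + 1) * (2 * m + 1) * Real.exp (-(η * w)) ≤
            (2 * m + 1) ^ 2 * Real.exp (-(η * (w - 1))) := by
          rw [← sq]
          gcongr
        linarith
      linarith
  · intro S hS ω u
    refine (decode_steps_le hw hwm hlog1 hlogw hS ω u).trans ?_
    gcongr
    linarith
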